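/- Let $M$ be a smooth closed (compact, without boundary) manifold of dimension $n$, foliated by an integrable subbundle $H\subseteq TM$ of rank $p$: near every point of $M$ there are foliation coordinates $x=(x_1,\dots,x_n)$ in which $H$ is spanned by $\partial_1,\dots,\partial_p$. For a multi-index $\alpha=(\alpha_1,\dots,\alpha_n)$ put $\|\alpha\|=\alpha_1+\cdots+\alpha_p+2(\alpha_{p+1}+\cdots+\alpha_n)$. Let $E,F$ be smooth complex vector bundles of finite rank over $M$ with smooth Hermitian metrics, let $\mu$ be a smooth positive density on $M$, and let $L^2(E), L^2(F)$ be the resulting spaces of square integrable sections. Let $P\colon C^\infty(E)\to C^\infty(F)$ be a differential operator of weighted order (at most) $d$, i.e. a linear map which in foliation coordinates and local trivializations of $E$ and $F$ around each point has the form $P=\sum_{\|\alpha\|\le d}a_\alpha(x)\,\partial^\alpha$ with smooth matrix-valued coefficients $a_\alpha$. Its weighted principal symbol is $$\sigma_H(P)(x,\xi)=\sum_{\|\alpha\|=d}a_\alpha(x)\,(i\xi)^\alpha ,\qquad \xi\in\mathbb R^n .$$ **Theorem.** If $\sigma_H(P)(x,\xi)$ is invertible for all $x\in M$ and all $\xi\neq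 0$, then $P$, regarded as an unbounded operator $L^2(E)\to L^2(F)$ with domain $C^\infty(E)$, is closable, and its closure $\bar P\colon L^2(E)\to L^2(F)$ is Fredholm: $\bar P$ has closed range, finite-dimensional kernel and finite-dimensional cokernel $L^2(F)/\operatorname{ran}\bar P$. -/

import Mathlib

open Set MeasureTheory Bundle Manifold
open scoped ContDiff Topology Manifold ENNReal ComplexConjugate

set_option linter.unusedSectionVars false

noncomputable section

namespace WeightedFoliation

/-! ## Complex vector bundles over a real manifold -/

/-- The real vector bundle underlying a complex vector bundle. It is needed in order to say, with
`ContMDiffVectorBundle`, that a complex bundle over a real manifold is smooth. -/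
instance realVectorBundle {B F : Type*} {E : B → Type*}
    [TopologicalSpace B] [NormedAddCommGroup F] [NormedSpace ℂ F]
    [∀ x, AddCommGroup (E x)] [∀ x, Module ℂ (E x)]
    [TopologicalSpace (TotalSpace F E)] [∀ x, TopologicalSpace (E x)]
    [FiberBundle F E] [VectorBundle ℂ F E] : VectorBundle ℝ F E where
  trivialization_linear' e _ :=
    ⟨fun b hb => ⟨(e.linear ℂ hb).map_add, fun c x => by
      rw [← algebraMap_smul ℂ c x, (e.linear ℂ hb).map_smul, algebraMap_smul]⟩⟩
  continuousOn_coordChange' e e' he he' := by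
    have h := continuousOn_coordChange ℂ e e'
    have h2 := (ContinuousLinearMap.restrictScalarsL ℂ F F ℝ ℝ).continuous.comp_continuousOn h
    refine h2.congr fun b hb => ?_
    ext v
    simp [Trivialization.coordChangeL_apply _ _ hb]

section Sections

variable {n : ℕ} {M : Type*} [TopologicalSpace M] [ChartedSpace (EuclideanSpace ℝ (Fin n)) M]
  (F : Type*) [NormedAddCommGroup F] [NormedSpace ℂ F]
  (E : M → Type*) [∀ x, AddCommGroup (E x)] [∀ x, Module ℂ (E x)]
  [TopologicalSpace (TotalSpace F E)] [∀ x, TopologicalSpace (E x)]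
  [FiberBundle F E] [VectorBundle ℂ F E]

/-- `C^∞(E)`: the complex vector space of smooth sections of `E`. -/
def smoothSections : Submodule ℂ (∀ x, E x) where
  carrier := {s | ContMDiff (𝓡 n) ((𝓡 n).prod 𝓘(ℝ, F)) ∞ (fun x => TotalSpace.mk' F x (s x))}
  add_mem' hs ht := ContMDiff.add_section hs ht
  zero_mem' := contMDiff_zeroSection ℝ E
  smul_mem' c s hs := by
    intro x₀
    have h := hs x₀
    rw [contMDiffAt_section] at h ⊢
    have hc : ContDiff ℝ ∞ (fun v : F => c • v) := contDiff_const_smul c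
    refine (hc.contMDiff.contMDiffAt.comp x₀ h).congr_of_eventuallyEq ?_
    have hb := (trivializationAt F E x₀).open_baseSet.mem_nhds
      (mem_baseSet_trivializationAt F E x₀)
    filter_upwards [hb] with x hx
    exact ((trivializationAt F E x₀).linear ℂ hx).map_smul c (s x)

/-- A smooth Hermitian metric on the complex vector bundle `E` (conjugate linear in the first
variable): its matrix entries in local trivializations are smooth. -/
structure HermitianMetric where
  inner : ∀ x, E x →ₗ⋆[ℂ] E x →ₗ[ℂ] ℂ
  conj_symm : ∀ x v w, conj (inner x v w) = inner x w v
  pos : ∀ x v, v ≠ 0 → 0 < (inner x v v).re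
  smooth : ∀ (x₀ : M) (v w : F), ContMDiffOn (𝓡 n) 𝓘(ℝ, ℂ) ∞
    (fun x => inner x ((trivializationAt F E x₀).symm x v) ((trivializationAt F E x₀).symm x w))
    (trivializationAt F E x₀).baseSet

end Sections

/-- A smooth positive density on `M`: a measure which in every chart of the smooth structure has a
smooth strictly positive density with respect to Lebesgue measure. -/
structure SmoothDensity (n : ℕ) (M : Type*) [TopologicalSpace M]
    [ChartedSpace (EuclideanSpace ℝ (Fin n)) M] [MeasurableSpace M] where
  measure : Measure M
  smooth : ∀ φ ∈ IsManifold.maximalAtlas (𝓡 n) ∞ M,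
    ∃ ρ : EuclideanSpace ℝ (Fin n) → ℝ, ContDiffOn ℝ ∞ ρ φ.target ∧ (∀ y ∈ φ.target, 0 < ρ y) ∧
      (measure.restrict φ.source).map φ =
        (volume.restrict φ.target).withDensity (fun y => ENNReal.ofReal (ρ y))

/-! ## The Hilbert space of square integrable sections -/

section L2

variable {n : ℕ} {M : Type*} [TopologicalSpace M] [ChartedSpace (EuclideanSpace ℝ (Fin n)) M]
  [CompactSpace M] [MeasurableSpace M] [BorelSpace M]
  {F : Type*} [NormedAddCommGroup F] [NormedSpace ℂ F] [FiniteDimensional ℂ F]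
  {E : M → Type*} [∀ x, AddCommGroup (E x)] [∀ x, Module ℂ (E x)]
  [TopologicalSpace (TotalSpace F E)] [∀ x, TopologicalSpace (E x)]
  [FiberBundle F E] [VectorBundle ℂ F E]

variable (F) in
/-- A (not necessarily continuous) section is measurable if its expressions in local
trivializations are, up to null sets. -/
def IsMeasurableSection (μ : Measure M) (s : ∀ x, E x) : Prop :=
  ∀ x₀ : M, AEStronglyMeasurable (fun x => (trivializationAt F E x₀ ⟨x, s x⟩).2)
    (μ.restrict (trivializationAt F E x₀).baseSet)

theorem IsMeasurableSection.add {μ : Measure M} {s t : ∀ x, E x}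
    (hs : IsMeasurableSection F μ s) (ht : IsMeasurableSection F μ t) :
    IsMeasurableSection F μ (s + t) := by
  intro x₀
  refine ((hs x₀).add (ht x₀)).congr ?_
  filter_upwards [ae_restrict_mem (trivializationAt F E x₀).open_baseSet.measurableSet] with x hx
  exact (((trivializationAt F E x₀).linear ℂ hx).map_add (s x) (t x)).symm

theorem IsMeasurableSection.smul {μ : Measure M} {s : ∀ x, E x} (c : ℂ)
    (hs : IsMeasurableSection F μ s) : IsMeasurableSection F μ (c • s) := by
  intro x₀
  refine ((hs x₀).const_smul c).congr ?_
  filter_upwards [ae_restrict_mem (trivializationAt F E x₀).open_baseSet.measurableSet] with x hx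
  exact (((trivializationAt F E x₀).linear ℂ hx).map_smul c (s x)).symm

theorem IsMeasurableSection.zero (μ : Measure M) :
    IsMeasurableSection F μ (0 : ∀ x, E x) := by
  intro x₀
  refine (aestronglyMeasurable_const (b := (0 : F))).congr ?_
  filter_upwards [ae_restrict_mem (trivializationAt F E x₀).open_baseSet.measurableSet] with x hx
  exact (((trivializationAt F E x₀).linear ℂ hx).map_zero).symm

namespace HermitianMetric

variable (h : HermitianMetric (n := n) F E)

theorem self_re_nonneg (x : M) (v : E x) : 0 ≤ (h.inner x v v).re := by
  by_cases hv : v = 0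
  · simp [hv]
  · exact (h.pos x v hv).le

/-- The Hermitian inner product on the fibre at `x`. -/
@[reducible] def core (x : M) : PreInnerProductSpace.Core ℂ (E x) where
  inner v w := h.inner x v w
  conj_inner_symm v w := h.conj_symm x w v
  re_inner_nonneg v := h.self_re_nonneg x v
  add_left u v w := by simp
  smul_left v w r := by simp

theorem norm_inner_le (x : M) (v w : E x) :
    ‖h.inner x v w‖ ≤ ((h.inner x v v).re + (h.inner x w w).re) / 2 := by
  let _ := h.core x
  have h1 := InnerProductSpace.Core.inner_mul_inner_self_le (𝕜 := ℂ) v w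
  have h2 : ‖h.inner x w v‖ = ‖h.inner x v w‖ := by
    rw [← h.conj_symm x v w, RCLike.norm_conj]
  change ‖h.inner x v w‖ * ‖h.inner x w v‖ ≤ (h.inner x v v).re * (h.inner x w w).re at h1
  rw [h2] at h1
  have := h.self_re_nonneg x v
  have := h.self_re_nonneg x w
  refine abs_le_of_sq_le_sq' ?_ (by positivity) |>.2
  nlinarith [sq_nonneg ((h.inner x v v).re - (h.inner x w w).re)]

theorem inner_eq_sum (x₀ : M) {x : M} (hx : x ∈ (trivializationAt F E x₀).baseSet) {ι : Type*}
    [Fintype ι] (b : Module.Basis ι ℂ F) (v w : E x) :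
    h.inner x v w = ∑ i, ∑ j, conj (b.repr (trivializationAt F E x₀ ⟨x, v⟩).2 i) *
      (b.repr (trivializationAt F E x₀ ⟨x, w⟩).2 j *
        h.inner x ((trivializationAt F E x₀).symm x (b i))
          ((trivializationAt F E x₀).symm x (b j))) := by
  set e := trivializationAt F E x₀
  have hrep : ∀ v : E x, v = ∑ i, b.repr (e ⟨x, v⟩).2 i • e.symm x (b i) := by
    intro v
    have h1 : e.symmₗ ℂ x (e ⟨x, v⟩).2 = v := by
      rw [e.symmₗ_apply hx]
      exact e.symm_apply_apply_mk hx v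
    conv_lhs => rw [← h1, ← b.sum_repr (e ⟨x, v⟩).2, map_sum]
    exact Finset.sum_congr rfl fun i _ => by rw [map_smul, e.symmₗ_apply hx]
  conv_lhs => rw [hrep v, hrep w]
  simp only [map_sum, LinearMap.sum_apply, map_smulₛₗ, LinearMap.smul_apply, smul_eq_mul,
    RingHom.id_apply]
  rw [Finset.sum_comm]
  refine Finset.sum_congr rfl fun i _ => ?_
  rw [Finset.mul_sum]
  exact Finset.sum_congr rfl fun j _ => by ring

theorem aestronglyMeasurable_inner {μ : Measure M} {s t : ∀ x, E x}
    (hs : IsMeasurableSection F μ s) (ht : IsMeasurableSection F μ t) :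
    AEStronglyMeasurable (fun x => h.inner x (s x) (t x)) μ := by
  obtain ⟨c, hc⟩ := isCompact_univ.elim_finite_subcover
    (fun x₀ : M => (trivializationAt F E x₀).baseSet)
    (fun x₀ => (trivializationAt F E x₀).open_baseSet)
    (fun x _ => mem_iUnion.2 ⟨x, mem_baseSet_trivializationAt F E x⟩)
  have hU : (⋃ i : c, (trivializationAt F E i.1).baseSet) = univ := by
    rw [eq_univ_iff_forall]
    intro x
    obtain ⟨i, hi, hx⟩ := mem_iUnion₂.1 (hc (mem_univ x))
    exact mem_iUnion.2 ⟨⟨i, hi⟩, hx⟩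
  rw [← Measure.restrict_univ (μ := μ), ← hU, aestronglyMeasurable_iUnion_iff]
  rintro ⟨x₀, -⟩
  set e := trivializationAt F E x₀
  let b := Module.finBasis ℂ F
  have hL : ∀ i, Continuous (fun v : F => b.repr v i) := fun i =>
    ((b.coord i).continuous_of_finiteDimensional)
  have key : AEStronglyMeasurable (fun x => ∑ i, ∑ j,
      conj (b.repr (e ⟨x, s x⟩).2 i) * (b.repr (e ⟨x, t x⟩).2 j *
        h.inner x (e.symm x (b i)) (e.symm x (b j)))) (μ.restrict e.baseSet) := by
    refine Finset.aestronglyMeasurable_fun_sum _ fun i _ =>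
      Finset.aestronglyMeasurable_fun_sum _ fun j _ => ?_
    refine AEStronglyMeasurable.mul ?_ (AEStronglyMeasurable.mul ?_ ?_)
    · exact (Complex.continuous_conj.comp (hL i)).comp_aestronglyMeasurable (hs x₀)
    · exact (hL j).comp_aestronglyMeasurable (ht x₀)
    · exact (h.smooth x₀ (b i) (b j)).continuousOn.aestronglyMeasurable
        e.open_baseSet.measurableSet
  refine key.congr ?_
  filter_upwards [ae_restrict_mem e.open_baseSet.measurableSet] with x hx
  exact (h.inner_eq_sum x₀ hx b (s x) (t x)).symm

end HermitianMetric

variable (h : HermitianMetric (n := n) F E) (μ : Measure M)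

/-- The measurable sections `s` of `E` with `∫ ‖s‖² dμ < ∞`. -/
def squareIntegrable : Submodule ℂ (∀ x, E x) where
  carrier := {s | IsMeasurableSection F μ s ∧ Integrable (fun x => (h.inner x (s x) (s x)).re) μ}
  add_mem' {s t} hs ht := by
    refine ⟨hs.1.add ht.1, ?_⟩
    refine ((hs.2.add ht.2).const_mul 2).mono'
      (h.aestronglyMeasurable_inner (hs.1.add ht.1) (hs.1.add ht.1)).re ?_
    refine .of_forall fun x => ?_
    have h0 := h.self_re_nonneg x (s x + t x)
    have h1 := (Complex.abs_re_le_norm _).trans (h.norm_inner_le x (s x) (t x))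
    have h2 := (Complex.abs_re_le_norm _).trans (h.norm_inner_le x (t x) (s x))
    have h3 := (abs_le.1 h1).2
    have h4 := (abs_le.1 h2).2
    simp only [Pi.add_apply, Real.norm_eq_abs]
    rw [abs_of_nonneg h0]
    simp only [map_add, LinearMap.add_apply, Complex.add_re]
    linarith
  zero_mem' := ⟨.zero μ, by simp⟩
  smul_mem' c s hs := by
    refine ⟨hs.1.smul c, ?_⟩
    refine (hs.2.const_mul (‖c‖ ^ 2)).congr (.of_forall fun x => ?_)
    have : conj c * (c * h.inner x (s x) (s x)) = ((‖c‖ ^ 2 : ℝ) : ℂ) * h.inner x (s x) (s x) := by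
      rw [← mul_assoc, Complex.conj_mul']; push_cast; rfl
    simp only [Pi.smul_apply, map_smulₛₗ, LinearMap.smul_apply, smul_eq_mul,
      RingHom.id_apply]
    rw [mul_left_comm, this, Complex.re_ofReal_mul]

/-- The square integrable sections, as a type on its own, which carries the `L²` seminorm. -/
def L2Section : Type _ := squareIntegrable h μ

instance : AddCommGroup (L2Section h μ) := inferInstanceAs (AddCommGroup (squareIntegrable h μ))
instance : Module ℂ (L2Section h μ) := inferInstanceAs (Module ℂ (squareIntegrable h μ))

theorem L2Section.integrable_inner (s t : L2Section h μ) :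
    Integrable (fun x => h.inner x (s.1 x) (t.1 x)) μ :=
  ((s.2.2.add t.2.2).div_const 2).mono' (h.aestronglyMeasurable_inner s.2.1 t.2.1)
    (.of_forall fun x => h.norm_inner_le x (s.1 x) (t.1 x))

/-- The `L²` inner product `⟨s, t⟩ = ∫ h(s, t) dμ`. -/
instance : PreInnerProductSpace.Core ℂ (L2Section h μ) where
  inner s t := ∫ x, h.inner x (s.1 x) (t.1 x) ∂μ
  conj_inner_symm s t := by
    rw [← integral_conj]
    exact integral_congr_ae (.of_forall fun x => h.conj_symm x (t.1 x) (s.1 x))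
  re_inner_nonneg s := by
    have h1 : RCLike.re (∫ x, h.inner x (s.1 x) (s.1 x) ∂μ) =
        ∫ x, (h.inner x (s.1 x) (s.1 x)).re ∂μ := (integral_re (s.integrable_inner h μ s)).symm
    rw [h1]
    exact integral_nonneg fun x => h.self_re_nonneg x _
  add_left s t u := by
    rw [← integral_add (s.integrable_inner h μ u) (t.integrable_inner h μ u)]
    refine integral_congr_ae (.of_forall fun x => ?_)
    change h.inner x (s.1 x + t.1 x) (u.1 x) = _
    simp
  smul_left s t c := by
    rw [← integral_const_mul]
    refine integral_congr_ae (.of_forall fun x => ?_)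
    change h.inner x (c • s.1 x) (t.1 x) = _
    simp

instance : SeminormedAddCommGroup (L2Section h μ) :=
  InnerProductSpace.Core.toSeminormedAddCommGroup (𝕜 := ℂ)

instance : InnerProductSpace ℂ (L2Section h μ) := InnerProductSpace.ofCore inferInstance

/-- The space `L²(E)`: square integrable sections modulo sections of norm zero, that is modulo
equality almost everywhere. -/
abbrev L2 : Type _ := SeparationQuotient (L2Section h μ)

end L2

/-! ## Differential operators as unbounded operators on `L²` -/

namespace SmoothDensity

variable {n : ℕ} {M : Type*} [TopologicalSpace M] [ChartedSpace (EuclideanSpace ℝ (Fin n)) M]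
  [IsManifold (𝓡 n) ∞ M] [MeasurableSpace M] [BorelSpace M] (μ : SmoothDensity n M)

theorem measure_chart_preimage (x : M) {K : Set (EuclideanSpace ℝ (Fin n))}
    (hK : MeasurableSet K)
    {ρ : EuclideanSpace ℝ (Fin n) → ℝ}
    (h : (μ.measure.restrict (chartAt (EuclideanSpace ℝ (Fin n)) x).source).map
        (chartAt (EuclideanSpace ℝ (Fin n)) x) =
        (volume.restrict (chartAt (EuclideanSpace ℝ (Fin n)) x).target).withDensity
          (fun y => ENNReal.ofReal (ρ y))) :
    μ.measure ((chartAt (EuclideanSpace ℝ (Fin n)) x).source ∩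
      chartAt (EuclideanSpace ℝ (Fin n)) x ⁻¹' K) =
      ∫⁻ y in K ∩ (chartAt (EuclideanSpace ℝ (Fin n)) x).target, ENNReal.ofReal (ρ y) := by
  set φ := chartAt (EuclideanSpace ℝ (Fin n)) x
  have hm : AEMeasurable φ (μ.measure.restrict φ.source) :=
    φ.continuousOn.aemeasurable φ.open_source.measurableSet
  have h1 := congrArg (fun ν => ν K) h
  simp only [Measure.map_apply_of_aemeasurable hm hK, withDensity_apply _ hK,
    Measure.restrict_restrict hK] at h1
  rw [← h1, Measure.restrict_apply' φ.open_source.measurableSet, inter_comm]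

instance : IsLocallyFiniteMeasure μ.measure where
  finiteAtNhds x := by
    obtain ⟨ρ, hρ, -, h⟩ := μ.smooth _ (IsManifold.chart_mem_maximalAtlas x)
    set φ := chartAt (EuclideanSpace ℝ (Fin n)) x with hφ
    have hx := mem_chart_source (EuclideanSpace ℝ (Fin n)) x
    obtain ⟨K, hK, hxK, hKt⟩ := exists_compact_subset φ.open_target (φ.map_source hx)
    refine ⟨φ.source ∩ φ ⁻¹' K, ?_, ?_⟩
    · exact Filter.inter_mem (φ.open_source.mem_nhds hx)
        ((φ.continuousAt hx).preimage_mem_nhds (mem_interior_iff_mem_nhds.1 hxK))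
    · rw [μ.measure_chart_preimage x hK.measurableSet h, inter_eq_left.2 hKt]
      exact Integrable.lintegral_lt_top ((hρ.continuousOn.mono hKt).integrableOn_compact hK)

instance : Measure.IsOpenPosMeasure μ.measure where
  open_pos U hU hne h0 := by
    obtain ⟨x, hxU⟩ := hne
    obtain ⟨ρ, hρ, hpos, h⟩ := μ.smooth _ (IsManifold.chart_mem_maximalAtlas x)
    have hx := mem_chart_source (EuclideanSpace ℝ (Fin n)) x
    have hV := (chartAt (EuclideanSpace ℝ (Fin n)) x).isOpen_inter_preimage_symm hU
    have h1 := μ.measure_chart_preimage x hV.measurableSet h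
    set φ := chartAt (EuclideanSpace ℝ (Fin n)) x with hφ
    rw [inter_eq_left.2 inter_subset_left] at h1
    have h2 : μ.measure (φ.source ∩ φ ⁻¹' (φ.target ∩ φ.symm ⁻¹' U)) = 0 := by
      refine measure_mono_null ?_ h0
      rintro y ⟨hy, -, hy2⟩
      simpa [φ.left_inv hy] using hy2
    rw [h2] at h1
    have hmeas : AEMeasurable (fun y => ENNReal.ofReal (ρ y))
        (volume.restrict (φ.target ∩ φ.symm ⁻¹' U)) :=
      ((hρ.continuousOn.mono inter_subset_left).aemeasurable hV.measurableSet).ennreal_ofReal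
    have h3 := (lintegral_eq_zero_iff' hmeas).1 h1.symm
    have h4 : (volume.restrict (φ.target ∩ φ.symm ⁻¹' U)) = 0 := by
      rw [← ae_eq_bot, ← Filter.eventually_false_iff_eq_bot]
      filter_upwards [h3, ae_restrict_mem hV.measurableSet] with y hy hy2
      have := hpos y hy2.1
      simp at hy
      linarith
    rw [Measure.restrict_eq_zero] at h4
    exact (hV.measure_pos volume ⟨φ x, φ.map_source hx, by simpa [φ.left_inv hx] using hxU⟩).ne' h4

end SmoothDensity

section Operator

variable {n : ℕ} {M : Type*} [TopologicalSpace M] [ChartedSpace (EuclideanSpace ℝ (Fin n)) M]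
  [IsManifold (𝓡 n) ∞ M] [CompactSpace M] [MeasurableSpace M] [BorelSpace M]
  {F : Type*} [NormedAddCommGroup F] [NormedSpace ℂ F] [FiniteDimensional ℂ F]
  {E : M → Type*} [∀ x, AddCommGroup (E x)] [∀ x, Module ℂ (E x)]
  [TopologicalSpace (TotalSpace F E)] [∀ x, TopologicalSpace (E x)]
  [FiberBundle F E] [VectorBundle ℂ F E]

theorem continuousOn_smoothSection (u : smoothSections (n := n) F E) (x₀ : M) :
    ContinuousOn (fun x => (trivializationAt F E x₀ ⟨x, u.1 x⟩).2)
      (trivializationAt F E x₀).baseSet := by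
  have hu : Continuous (fun x => TotalSpace.mk' F x (u.1 x)) := ContMDiff.continuous u.2
  refine continuous_snd.comp_continuousOn
    ((trivializationAt F E x₀).continuousOn.comp hu.continuousOn fun x hx => ?_)
  exact (trivializationAt F E x₀).mem_source.2 hx

theorem HermitianMetric.continuous_inner (h : HermitianMetric (n := n) F E)
    (u v : smoothSections (n := n) F E) : Continuous (fun x => h.inner x (u.1 x) (v.1 x)) := by
  rw [continuous_iff_continuousAt]
  intro x₀
  let b := Module.finBasis ℂ F
  have hL : ∀ i, Continuous (fun v : F => b.repr v i) := fun i =>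
    ((b.coord i).continuous_of_finiteDimensional)
  have key : ContinuousOn (fun x => ∑ i, ∑ j,
      conj (b.repr (trivializationAt F E x₀ ⟨x, u.1 x⟩).2 i) *
        (b.repr (trivializationAt F E x₀ ⟨x, v.1 x⟩).2 j *
        h.inner x ((trivializationAt F E x₀).symm x (b i))
          ((trivializationAt F E x₀).symm x (b j)))) (trivializationAt F E x₀).baseSet := by
    refine continuousOn_finsetSum _ fun i _ => continuousOn_finsetSum _ fun j _ => ?_
    refine ContinuousOn.mul ?_ (ContinuousOn.mul ?_ ?_)
    · exact (Complex.continuous_conj.comp (hL i)).comp_continuousOn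
        (continuousOn_smoothSection u x₀)
    · exact (hL j).comp_continuousOn (continuousOn_smoothSection v x₀)
    · exact (h.smooth x₀ (b i) (b j)).continuousOn
  have hb := (trivializationAt F E x₀).open_baseSet.mem_nhds
      (mem_baseSet_trivializationAt F E x₀)
  refine (key.continuousAt hb).congr ?_
  filter_upwards [hb] with x hx
  exact (h.inner_eq_sum x₀ hx b (u.1 x) (v.1 x)).symm

theorem smoothSections_le_squareIntegrable (h : HermitianMetric (n := n) F E)
    (μ : SmoothDensity n M) : smoothSections (n := n) F E ≤ squareIntegrable h μ.measure := by
  intro u hu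
  refine ⟨fun x₀ => (continuousOn_smoothSection ⟨u, hu⟩ x₀).aestronglyMeasurable
    (trivializationAt F E x₀).open_baseSet.measurableSet, ?_⟩
  exact (Complex.continuous_re.comp (h.continuous_inner ⟨u, hu⟩ ⟨u, hu⟩)).integrable_of_hasCompactSupport
    (HasCompactSupport.of_compactSpace _)

/-- The inclusion `C^∞(E) → L²(E)`. -/
def toL2 (h : HermitianMetric (n := n) F E) (μ : SmoothDensity n M) :
    smoothSections (n := n) F E →ₗ[ℂ] L2 h μ.measure :=
  (SeparationQuotient.mkCLM ℂ (L2Section h μ.measure)).toLinearMap ∘ₗ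
    (Submodule.inclusion (smoothSections_le_squareIntegrable h μ) :
      smoothSections (n := n) F E →ₗ[ℂ] L2Section h μ.measure)

theorem toL2_injective (h : HermitianMetric (n := n) F E) (μ : SmoothDensity n M) :
    Function.Injective (toL2 h μ) := by
  rw [injective_iff_map_eq_zero]
  intro u hu
  let s : L2Section h μ.measure :=
    Submodule.inclusion (smoothSections_le_squareIntegrable h μ) u
  have h1 : ‖s‖ = 0 := by
    have : ‖toL2 h μ u‖ = ‖s‖ := rfl
    rw [← this, hu, norm_zero]
  have h2 : ∫ x, (h.inner x (u.1 x) (u.1 x)).re ∂μ.measure = 0 := by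
    have h3 : ‖s‖ ^ 2 = RCLike.re (inner ℂ s s) := InnerProductSpace.norm_sq_eq_re_inner s
    have h4 : RCLike.re (∫ x, h.inner x (s.1 x) (s.1 x) ∂μ.measure) =
      ∫ x, (h.inner x (s.1 x) (s.1 x)).re ∂μ.measure :=
        (integral_re (s.integrable_inner h _ s)).symm
    rw [h1] at h3
    refine h4.symm.trans (h3.symm.trans (by norm_num))
  have hc : Continuous (fun x => (h.inner x (u.1 x) (u.1 x)).re) :=
    Complex.continuous_re.comp (h.continuous_inner u u)
  rw [integral_eq_zero_iff_of_nonneg (fun x => h.self_re_nonneg x _)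
    (smoothSections_le_squareIntegrable h μ u.2).2, hc.ae_eq_iff_eq _ continuous_zero] at h2
  ext x
  by_contra hne
  exact (h.pos x _ hne).ne' (congrFun h2 x)

variable {F' : Type*} [NormedAddCommGroup F'] [NormedSpace ℂ F'] [FiniteDimensional ℂ F']
  {E' : M → Type*} [∀ x, AddCommGroup (E' x)] [∀ x, Module ℂ (E' x)]
  [TopologicalSpace (TotalSpace F' E')] [∀ x, TopologicalSpace (E' x)]
  [FiberBundle F' E'] [VectorBundle ℂ F' E']

/-- A linear operator `P : C^∞(E) → C^∞(E')`, as an unbounded operator `L²(E) → L²(E')` with domain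
`C^∞(E)`. -/
def unboundedOperator (h : HermitianMetric (n := n) F E) (h' : HermitianMetric (n := n) F' E')
    (μ : SmoothDensity n M)
    (P : smoothSections (n := n) F E →ₗ[ℂ] smoothSections (n := n) F' E') :
    L2 h μ.measure →ₗ.[ℂ] L2 h' μ.measure where
  domain := LinearMap.range (toL2 h μ)
  toFun := toL2 h' μ ∘ₗ P ∘ₗ (LinearEquiv.ofInjective (toL2 h μ) (toL2_injective h μ)).symm

end Operator

/-- An unbounded operator is Fredholm if it has closed range, finite dimensional kernel and finite
dimensional cokernel. -/
structure IsFredholm {X Y : Type*} [NormedAddCommGroup X] [InnerProductSpace ℂ X]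
    [NormedAddCommGroup Y] [InnerProductSpace ℂ Y] (T : X →ₗ.[ℂ] Y) : Prop where
  isClosed_range : IsClosed (LinearMap.range T.toFun : Set Y)
  finite_ker : FiniteDimensional ℂ (LinearMap.ker T.toFun)
  finite_coker : FiniteDimensional ℂ (Y ⧸ LinearMap.range T.toFun)

/-! ## Foliations and the weighted calculus -/

/-- The chart `φ` is a foliation chart for the distribution `H`: on its domain, `H` is spanned by
the first `p` coordinate vector fields. -/
def IsFoliationChart {n : ℕ} {M : Type*} [TopologicalSpace M]
    [ChartedSpace (EuclideanSpace ℝ (Fin n)) M] (p : ℕ)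
    (H : ∀ x : M, Submodule ℝ (TangentSpace (𝓡 n) x))
    (φ : OpenPartialHomeomorph M (EuclideanSpace ℝ (Fin n))) : Prop :=
  φ ∈ IsManifold.maximalAtlas (𝓡 n) ∞ M ∧ ∀ x ∈ φ.source, ∀ v : TangentSpace (𝓡 n) x,
    v ∈ H x ↔ ∀ i : Fin n, p ≤ i.val →
      EuclideanSpace.proj (𝕜 := ℝ) i (mfderiv (𝓡 n) (𝓡 n) φ x v) = 0

/-- A foliation of rank `p` of the `n`-dimensional manifold `M`, given by an integrable subbundle
`H` of the tangent bundle. -/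
structure Foliation (n : ℕ) (M : Type*) [TopologicalSpace M]
    [ChartedSpace (EuclideanSpace ℝ (Fin n)) M] (p : ℕ) where
  rank_le : p ≤ n
  H : ∀ x : M, Submodule ℝ (TangentSpace (𝓡 n) x)
  integrable : ∀ x : M, ∃ φ, IsFoliationChart p H φ ∧ x ∈ φ.source

/-- The weighted degree `‖α‖ = α₁ + ⋯ + α_p + 2 (α_{p+1} + ⋯ + α_n)` of a multi-index. -/
def weightedDegree {n : ℕ} (p : ℕ) (α : Fin n → ℕ) : ℕ :=
  ∑ i, (if i.val < p then 1 else 2) * α i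

/-- The finite set of all multi-indices of weighted degree at most `d`. -/
def multiIndices (n p d : ℕ) : Finset (Fin n → ℕ) :=
  (Fintype.piFinset fun _ => Finset.range (d + 1)).filter fun α => weightedDegree p α ≤ d

theorem mem_multiIndices {n p d : ℕ} {α : Fin n → ℕ} :
    α ∈ multiIndices n p d ↔ weightedDegree p α ≤ d := by
  simp only [multiIndices, Finset.mem_filter, Fintype.mem_piFinset, Finset.mem_range,
    and_iff_right_iff_imp]
  intro h i
  have h1 : (if i.val < p then 1 else 2) * α i ≤ weightedDegree p α :=
    Finset.single_le_sum (f := fun i : Fin n => (if i.val < p then 1 else 2) * α i)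
      (fun _ _ => Nat.zero_le _) (Finset.mem_univ i)
  split_ifs at h1 <;> omega

section Calculus

variable {n : ℕ} {F : Type*} [NormedAddCommGroup F] [NormedSpace ℂ F]

/-- The partial derivative `∂ᵢ f`. -/
def partialDeriv (i : Fin n) (f : EuclideanSpace ℝ (Fin n) → F) : EuclideanSpace ℝ (Fin n) → F :=
  fun y => fderiv ℝ f y (EuclideanSpace.single i 1)

/-- The iterated partial derivative `∂^α f = ∂₁^α₁ ⋯ ∂ₙ^αₙ f`. -/
def multiDeriv (α : Fin n → ℕ) (f : EuclideanSpace ℝ (Fin n) → F) :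
    EuclideanSpace ℝ (Fin n) → F :=
  (List.finRange n).foldr (fun i g => (partialDeriv i)^[α i] g) f

end Calculus

section WeightedOrder

variable {n p : ℕ} {M : Type*} [TopologicalSpace M] [ChartedSpace (EuclideanSpace ℝ (Fin n)) M]
  (fol : Foliation n M p)
  (F : Type*) [NormedAddCommGroup F] [NormedSpace ℂ F]
  (E : M → Type*) [∀ x, AddCommGroup (E x)] [∀ x, Module ℂ (E x)]
  [TopologicalSpace (TotalSpace F E)] [∀ x, TopologicalSpace (E x)]
  [FiberBundle F E] [VectorBundle ℂ F E]
  (F' : Type*) [NormedAddCommGroup F'] [NormedSpace ℂ F']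
  (E' : M → Type*) [∀ x, AddCommGroup (E' x)] [∀ x, Module ℂ (E' x)]
  [TopologicalSpace (TotalSpace F' E')] [∀ x, TopologicalSpace (E' x)]
  [FiberBundle F' E'] [VectorBundle ℂ F' E']

/-- Foliation coordinates together with local trivializations of both bundles. -/
structure LocalFrame where
  chart : OpenPartialHomeomorph M (EuclideanSpace ℝ (Fin n))
  isFoliationChart : IsFoliationChart p fol.H chart
  triv : Trivialization F (π F E)
  triv_mem : MemTrivializationAtlas triv
  triv' : Trivialization F' (π F' E')
  triv'_mem : MemTrivializationAtlas triv'

variable {fol F E F' E'}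

namespace LocalFrame

variable (c : LocalFrame fol F E F' E')

/-- The open set on which the coordinates and both trivializations are defined. -/
def domain : Set M := c.chart.source ∩ c.triv.baseSet ∩ c.triv'.baseSet

/-- The expression in the coordinates of a section of `E`, as an `F`-valued function. -/
def localSection (u : ∀ x, E x) (y : EuclideanSpace ℝ (Fin n)) : F :=
  (c.triv ⟨c.chart.symm y, u (c.chart.symm y)⟩).2

/-- On the domain of `c`, the operator `P` equals `∑_{‖α‖ ≤ d} a_α ∂^α`, with smooth coefficients
`a_α` whose values are linear maps `F → F'`. -/
def IsLocalExpression (P : smoothSections (n := n) F E →ₗ[ℂ] smoothSections (n := n) F' E') (d : ℕ)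
    (a : (Fin n → ℕ) → EuclideanSpace ℝ (Fin n) → F →L[ℂ] F') : Prop :=
  (∀ α ∈ multiIndices n p d, ContDiffOn ℝ ∞ (a α) (c.chart '' c.domain)) ∧
  ∀ u, ∀ x ∈ c.domain, (c.triv' ⟨x, (P u).1 x⟩).2 =
    ∑ α ∈ multiIndices n p d, a α (c.chart x) (multiDeriv α (c.localSection u.1) (c.chart x))

end LocalFrame

/-- The weighted principal symbol `∑_{‖α‖ = d} a_α(y) (iξ)^α` of `∑_{‖α‖ ≤ d} a_α ∂^α`. -/
def weightedSymbol (p d : ℕ) (a : (Fin n → ℕ) → EuclideanSpace ℝ (Fin n) → F →L[ℂ] F')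
    (y : EuclideanSpace ℝ (Fin n)) (ξ : Fin n → ℝ) : F →L[ℂ] F' :=
  ∑ α ∈ multiIndices n p d with weightedDegree p α = d,
    (∏ i, (Complex.I * (ξ i : ℂ)) ^ α i) • a α y

/-- `P` is a differential operator of weighted order (at most) `d`: near every point it has the form
`∑_{‖α‖ ≤ d} a_α ∂^α` in foliation coordinates. -/
def IsWeightedDiffOp (fol : Foliation n M p) (d : ℕ)
    (P : smoothSections (n := n) F E →ₗ[ℂ] smoothSections (n := n) F' E') : Prop :=
  ∀ x : M, ∃ c : LocalFrame fol F E F' E', x ∈ c.domain ∧ ∃ a, c.IsLocalExpression P d a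

/-- The weighted principal symbol of `P` (as an operator of weighted order `d`) is invertible at all
points of `M` and all nonzero covectors `ξ`. -/
def HasInvertibleWeightedSymbol (fol : Foliation n M p) (d : ℕ)
    (P : smoothSections (n := n) F E →ₗ[ℂ] smoothSections (n := n) F' E') : Prop :=
  ∀ (c : LocalFrame fol F E F' E') (a : (Fin n → ℕ) → EuclideanSpace ℝ (Fin n) → F →L[ℂ] F'),
    c.IsLocalExpression P d a → ∀ x ∈ c.domain, ∀ ξ : Fin n → ℝ, ξ ≠ 0 →
      (weightedSymbol p d a (c.chart x) ξ).IsInvertible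

end WeightedOrder

end WeightedFoliation

end

open WeightedFoliation

/-!
The closure of `P` is shown to be Fredholm through its closed graph `Γ`, by the criterion
`isClosable_and_isFredholm_closure`. Three facts are needed: `(0, v) ∈ Γ` only for `v = 0`; there is
an approximable operator `K` (a norm limit of operators of finite rank) such that every `v + K v` is
the second component of a point of `Γ`; and there is an approximable operator `K'` which fixes every
`u` with `(u, 0) ∈ Γ`. The second fact makes the range closed and of finite codimension, the third
makes the kernel finite dimensional.

All three are local. In foliation coordinates around a point `y` the symbol is homogeneous of degree
`d` for the dilations `(ξ', ξ'') ↦ (s ξ', s² ξ'')`, whose unit sphere is compact. Hence its inverse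
is bounded by the power `-d` of the weighted norm, and it has a smooth version `q` which is cut off
at low frequencies (`exists_approximate_inverse_symbol`). The Fourier multiplier `q(D)` inverts the
operator frozen at `y`, up to low frequencies. On a small ball about `y`, the variation of the
leading coefficients and the lower order terms, applied to `q(D)`, form an operator of norm at most
`1/2`, which a Neumann series absorbs. What is left, namely the low frequencies and the commutator
of `P` with a cutoff `φ`, has the form of a compactly supported multiplication composed with a
multiplier that vanishes at infinity. Such an operator is approximable
(`isApproximable_of_tendsto_zero`); this replaces the Rellich lemma. The result is a right
parametrix of `P` over the support of `φ` (`exists_local_parametrix`). No pseudodifferential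
calculus is involved, since `L²` bounds are all that is used.

Elliptic regularity is avoided by duality. In coordinates the formal adjoint `P*` has the adjoint
symbol (`exists_formalAdjoint`), so that it has a right parametrix too: `P* Q = φ + K` for some
approximable `K`. If `(u, 0) ∈ Γ` then `u` is a weak solution of `P u = 0`, hence orthogonal to the
range of `φ + K`, that is, `φ u = - K* u` (`IsLocalForm.mulLp_localize_eq_neg_adjoint`). Likewise,
`(0, v) ∈ Γ` implies that `φ v` is orthogonal to all test functions, so that `φ v = 0`
(`IsLocalForm.mulLp_localize_eq_zero`).

The local statements are collected in `IsGoodPatch` and patched with a finite smooth partition of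
unity. Localization to a patch and extension by zero are bounded on `L²`, since over compact sets
densities and metrics are comparable with the Euclidean ones. The same operators exhibit the space
of square integrable sections as a retract of a complete space (`completeSpace_L2`).
-/

noncomputable section

namespace WeightedFoliation

/-! ### Norm limits of finite rank operators -/

section Approximable

variable {X Y Z : Type*} [NormedAddCommGroup X] [NormedSpace ℂ X]
  [NormedAddCommGroup Y] [NormedSpace ℂ Y] [NormedAddCommGroup Z] [NormedSpace ℂ Z]

/-- `K` is a limit, in operator norm, of bounded operators of finite rank. Between Hilbert spaces
these are the compact operators. -/
def IsApproximable (K : X →L[ℂ] Y) : Prop :=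
  ∀ ε > 0, ∃ G : X →L[ℂ] Y, FiniteDimensional ℂ (LinearMap.range (G : X →ₗ[ℂ] Y)) ∧ ‖K - G‖ ≤ ε

namespace IsApproximable

theorem zero : IsApproximable (0 : X →L[ℂ] Y) := fun ε hε =>
  ⟨0, by
    have : LinearMap.range ((0 : X →L[ℂ] Y) : X →ₗ[ℂ] Y) = ⊥ := by
      rw [ContinuousLinearMap.toLinearMap_zero, LinearMap.range_zero]
    rw [this]; infer_instance, by simpa using hε.le⟩

theorem add {K L : X →L[ℂ] Y} (hK : IsApproximable K) (hL : IsApproximable L) :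
    IsApproximable (K + L) := by
  intro ε hε
  obtain ⟨G, hG, hKG⟩ := hK (ε / 2) (half_pos hε)
  obtain ⟨H, hH, hLH⟩ := hL (ε / 2) (half_pos hε)
  refine ⟨G + H, ?_, ?_⟩
  · refine Submodule.finiteDimensional_of_le
      (S₂ := LinearMap.range (G : X →ₗ[ℂ] Y) ⊔ LinearMap.range (H : X →ₗ[ℂ] Y)) ?_
    rintro _ ⟨x, rfl⟩
    exact Submodule.add_mem_sup ⟨x, rfl⟩ ⟨x, rfl⟩
  · have : K + L - (G + H) = (K - G) + (L - H) := by abel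
    rw [this]
    exact (norm_add_le _ _).trans (by linarith)

theorem sum {ι : Type*} (s : Finset ι) {K : ι → X →L[ℂ] Y} (h : ∀ i ∈ s, IsApproximable (K i)) :
    IsApproximable (∑ i ∈ s, K i) := by
  classical
  induction s using Finset.induction_on with
  | empty => simpa using zero
  | insert a s ha ih =>
    rw [Finset.sum_insert ha]
    exact (h a (by simp)).add (ih fun i hi => h i (by simp [hi]))

theorem comp_left {K : X →L[ℂ] Y} (hK : IsApproximable K) (A : Y →L[ℂ] Z) :
    IsApproximable (A ∘L K) := by
  intro ε hε
  obtain ⟨G, hG, hKG⟩ := hK (ε / (‖A‖ + 1)) (by positivity)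
  refine ⟨A ∘L G, ?_, ?_⟩
  · rw [ContinuousLinearMap.toLinearMap_comp, LinearMap.range_comp]
    infer_instance
  · rw [← ContinuousLinearMap.comp_sub]
    refine (A.opNorm_comp_le _).trans ?_
    calc ‖A‖ * ‖K - G‖ ≤ (‖A‖ + 1) * (ε / (‖A‖ + 1)) := by gcongr; linarith
      _ = ε := by field_simp

theorem comp_right {K : Y →L[ℂ] Z} (hK : IsApproximable K) (A : X →L[ℂ] Y) :
    IsApproximable (K ∘L A) := by
  intro ε hε
  obtain ⟨G, hG, hKG⟩ := hK (ε / (‖A‖ + 1)) (by positivity)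
  refine ⟨G ∘L A, ?_, ?_⟩
  · refine Submodule.finiteDimensional_of_le (S₂ := LinearMap.range (G : Y →ₗ[ℂ] Z)) ?_
    rw [ContinuousLinearMap.toLinearMap_comp]
    exact LinearMap.range_comp_le_range _ _
  · rw [← ContinuousLinearMap.sub_comp]
    refine (ContinuousLinearMap.opNorm_comp_le _ _).trans ?_
    calc ‖K - G‖ * ‖A‖ ≤ (ε / (‖A‖ + 1)) * (‖A‖ + 1) := by gcongr; linarith
      _ = ε := by field_simp

theorem neg {K : X →L[ℂ] Y} (hK : IsApproximable K) : IsApproximable (-K) := by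
  simpa using hK.comp_left (-ContinuousLinearMap.id ℂ Y)

theorem of_forall_approximable {K : X →L[ℂ] Y}
    (h : ∀ ε > 0, ∃ L : X →L[ℂ] Y, IsApproximable L ∧ ‖K - L‖ ≤ ε) : IsApproximable K := by
  intro ε hε
  obtain ⟨L, hL, hKL⟩ := h (ε / 2) (half_pos hε)
  obtain ⟨G, hG, hLG⟩ := hL (ε / 2) (half_pos hε)
  refine ⟨G, hG, ?_⟩
  calc ‖K - G‖ = ‖(K - L) + (L - G)‖ := by abel_nf
    _ ≤ ε := (norm_add_le _ _).trans (by linarith)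

/-- The adjoint of an operator of finite rank has finite rank, and taking adjoints is isometric. -/
theorem adjoint {X Y : Type*} [NormedAddCommGroup X] [InnerProductSpace ℂ X] [CompleteSpace X]
    [NormedAddCommGroup Y] [InnerProductSpace ℂ Y] [CompleteSpace Y] {K : X →L[ℂ] Y}
    (hK : IsApproximable K) : IsApproximable (ContinuousLinearMap.adjoint K) := by
  intro ε hε
  obtain ⟨G, hG, hKG⟩ := hK ε hε
  refine ⟨ContinuousLinearMap.adjoint G, ?_, ?_⟩
  · -- `G` factors through its range `R`, so that `G†` factors through `R` as well.
    set R := LinearMap.range (G : X →ₗ[ℂ] Y)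
    have : CompleteSpace R := FiniteDimensional.complete ℂ R
    let G' : X →L[ℂ] R := G.codRestrict R fun x => ⟨x, rfl⟩
    have hfac : G = R.subtypeL ∘L G' := rfl
    rw [hfac, ContinuousLinearMap.adjoint_comp, ContinuousLinearMap.toLinearMap_comp]
    refine Submodule.finiteDimensional_of_le (LinearMap.range_comp_le_range _ _)
  · rwa [← map_sub, LinearIsometryEquiv.norm_map]

/-- The fixed vectors of an approximable operator form a finite dimensional space. -/
theorem finiteDimensional_of_eq {K : X →L[ℂ] X} (hK : IsApproximable K) (D : Submodule ℂ X)
    (h : ∀ u ∈ D, u = K u) : FiniteDimensional ℂ D := by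
  obtain ⟨G, hG, hKG⟩ := hK (1 / 2) (by norm_num)
  let f : D →ₗ[ℂ] LinearMap.range (G : X →ₗ[ℂ] X) := (G : X →ₗ[ℂ] X).rangeRestrict ∘ₗ D.subtype
  refine Module.Finite.of_injective f ?_
  rw [injective_iff_map_eq_zero]
  intro u hu
  have hu' : G u.1 = 0 := congrArg Subtype.val hu
  have h1 : u.1 = (K - G) u.1 := by
    rw [sub_apply, hu', sub_zero]; exact h _ u.2
  have h2 : ‖u.1‖ ≤ 1 / 2 * ‖u.1‖ := by
    conv_lhs => rw [h1]
    exact (K - G).le_of_opNorm_le hKG _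
  have h3 : ‖u.1‖ = 0 := by linarith [norm_nonneg u.1]
  exact Subtype.ext (norm_eq_zero.1 h3)

/-- A subspace containing the range of `1 + K`, with `K` approximable, is closed and of finite
codimension. -/
theorem isClosed_and_finiteDimensional_quotient [CompleteSpace Y] {K : Y →L[ℂ] Y}
    (hK : IsApproximable K) (R : Submodule ℂ Y) (h : ∀ v, v + K v ∈ R) :
    IsClosed (R : Set Y) ∧ FiniteDimensional ℂ (Y ⧸ R) := by
  obtain ⟨G, hG, hKG⟩ := hK (1 / 2) (by norm_num)
  have hlt : ‖-(K - G)‖ < 1 := by rw [norm_neg]; linarith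
  let T : (Y →L[ℂ] Y)ˣ := Units.oneSub (-(K - G)) hlt
  let e : Y ≃L[ℂ] Y := ContinuousLinearEquiv.ofUnit T
  have he : ∀ v, e v = v + (K - G) v := by
    intro v
    change (1 - -(K - G)) v = _
    simp only [sub_neg_eq_add, add_apply]
    rfl
  let N : Submodule ℂ Y := LinearMap.ker (G : Y →ₗ[ℂ] Y)
  have hN : ∀ v ∈ N, e v ∈ R := by
    intro v hv
    have hv' : G v = 0 := hv
    rw [he, sub_apply, hv', sub_zero]
    exact h v
  have hNfin : FiniteDimensional ℂ (Y ⧸ N) :=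
    Module.Finite.equiv (G : Y →ₗ[ℂ] Y).quotKerEquivRange.symm
  let N' : Submodule ℂ Y := N.map (e : Y →ₗ[ℂ] Y)
  have hN'R : N' ≤ R := by
    rintro _ ⟨v, hv, rfl⟩
    exact hN v hv
  have hN'closed : IsClosed (N' : Set Y) := by
    have hc : IsClosed (N : Set Y) := G.isClosed_ker
    exact e.toHomeomorph.isClosedMap _ hc
  have hN'fin : FiniteDimensional ℂ (Y ⧸ N') :=
    Module.Finite.equiv (Submodule.Quotient.equiv N N' e.toLinearEquiv rfl)
  constructor
  · have : IsClosed (N' : Set Y) := hN'closed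
    have h1 : (R : Set Y) = N'.mkQ ⁻¹' (R.map N'.mkQ : Submodule ℂ (Y ⧸ N')) := by
      have := Submodule.comap_map_mkQ N' R
      rw [sup_eq_right.2 hN'R] at this
      conv_lhs => rw [← this]
      rfl
    rw [h1]
    exact (Submodule.closed_of_finiteDimensional (R.map N'.mkQ)).preimage N'.mkQL.continuous
  · exact Module.Finite.of_surjective (Submodule.factor hN'R) (Submodule.factor_surjective hN'R)

end IsApproximable

end Approximable

/-- Fredholm criterion in terms of the closed graph `Γ` of an unbounded operator: `Γ` is a graph,
it contains a right inverse modulo approximable operators, and its kernel consists of fixed vectors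
of an approximable operator. -/
theorem isClosable_and_isFredholm_closure {X Y : Type*} [NormedAddCommGroup X]
    [InnerProductSpace ℂ X] [NormedAddCommGroup Y] [InnerProductSpace ℂ Y] [CompleteSpace Y]
    (T : X →ₗ.[ℂ] Y) (h0 : ∀ f, ((0 : X), f) ∈ T.graph.topologicalClosure → f = 0)
    {K : Y →L[ℂ] Y} (hK : IsApproximable K)
    (hR : ∀ v, ∃ u, (u, v + K v) ∈ T.graph.topologicalClosure)
    {K' : X →L[ℂ] X} (hK' : IsApproximable K')
    (hker : ∀ u, (u, (0 : Y)) ∈ T.graph.topologicalClosure → u = K' u) :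
    T.IsClosable ∧ IsFredholm T.closure := by
  have hc : T.IsClosable := by
    refine ⟨T.graph.topologicalClosure.toLinearPMap, ?_⟩
    rw [Submodule.toLinearPMap_graph_eq]
    rintro ⟨a, b⟩ hab ha
    obtain rfl : a = 0 := ha
    exact h0 b hab
  have hg := hc.graph_closure_eq_closure_graph
  rw [hg] at hR hker
  have hcok := hK.isClosed_and_finiteDimensional_quotient (LinearMap.range T.closure.toFun) (by
    intro v
    obtain ⟨u, hu⟩ := hR v
    obtain ⟨y, -, hy⟩ := (LinearPMap.mem_graph_iff _).1 hu
    exact ⟨y, hy⟩)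
  refine ⟨hc, hcok.1, ?_, hcok.2⟩
  let D : Submodule ℂ X := (LinearMap.ker T.closure.toFun).map T.closure.domain.subtype
  have hD : FiniteDimensional ℂ D := by
    refine hK'.finiteDimensional_of_eq D ?_
    rintro _ ⟨u, hu, rfl⟩
    refine hker _ ?_
    rw [LinearPMap.mem_graph_iff]
    exact ⟨u, rfl, hu⟩
  exact Module.Finite.equiv
    (Submodule.equivMapOfInjective T.closure.domain.subtype (Submodule.subtype_injective _) _).symm

/-! ### Differential operators written with words of partial derivatives -/

section Words

variable {n : ℕ} {V W : Type*} [NormedAddCommGroup V] [NormedSpace ℂ V]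
  [NormedAddCommGroup W] [NormedSpace ℂ W]

/-- The coordinate space `ℝⁿ`. -/
abbrev Coord (n : ℕ) : Type := EuclideanSpace ℝ (Fin n)

/-- The iterated partial derivative `∂_{i₁} ⋯ ∂_{iₖ} f` along the word `i₁ ⋯ iₖ`. Words, rather than
multi-indices, make it unnecessary to know that partial derivatives commute. -/
def wordDeriv (l : List (Fin n)) (f : Coord n → V) : Coord n → V :=
  l.foldr partialDeriv f

/-- The weighted length of a word: the first `p` letters have weight `1`, the others weight `2`. -/
def wordWeight (p : ℕ) (l : List (Fin n)) : ℕ :=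
  (l.map fun i => if i.val < p then 1 else 2).sum

/-- The monomial `(i ξ_{i₁}) ⋯ (i ξ_{iₖ})`. -/
def wordMonomial (l : List (Fin n)) (ξ : Fin n → ℝ) : ℂ :=
  (l.map fun i => Complex.I * (ξ i : ℂ)).prod

/-- The word `1^{α₁} ⋯ n^{αₙ}` of a multi-index. -/
def multiWord (α : Fin n → ℕ) : List (Fin n) :=
  (List.finRange n).flatMap fun i => List.replicate (α i) i

/-- The differential operator `∑ₜ aₜ ∂^{lₜ}`, applied to `w`. -/
def wordOp {ι : Type*} [Fintype ι] (a : ι → Coord n → V →L[ℂ] W) (l : ι → List (Fin n))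
    (w : Coord n → V) (y : Coord n) : W :=
  ∑ t, a t y (wordDeriv (l t) w y)

/-- The weighted principal symbol, of degree `d`, of `∑ₜ aₜ ∂^{lₜ}`. -/
def wordSymbol {ι : Type*} [Fintype ι] (p d : ℕ) (a : ι → Coord n → V →L[ℂ] W)
    (l : ι → List (Fin n)) (y : Coord n) (ξ : Fin n → ℝ) : V →L[ℂ] W :=
  ∑ t with wordWeight p (l t) = d, wordMonomial (l t) ξ • a t y

@[simp] theorem wordDeriv_nil (f : Coord n → V) : wordDeriv [] f = f := rfl

@[simp] theorem wordDeriv_cons (i : Fin n) (l : List (Fin n)) (f : Coord n → V) :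
    wordDeriv (i :: l) f = partialDeriv i (wordDeriv l f) := rfl

theorem wordDeriv_append (l l' : List (Fin n)) (f : Coord n → V) :
    wordDeriv (l ++ l') f = wordDeriv l (wordDeriv l' f) := List.foldr_append

@[simp] theorem wordWeight_nil (p : ℕ) : wordWeight p ([] : List (Fin n)) = 0 := rfl

@[simp] theorem wordWeight_cons (p : ℕ) (i : Fin n) (l : List (Fin n)) :
    wordWeight p (i :: l) = (if i.val < p then 1 else 2) + wordWeight p l := by
  simp [wordWeight]

theorem wordWeight_reverse (p : ℕ) (l : List (Fin n)) :
    wordWeight p l.reverse = wordWeight p l := by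
  simp [wordWeight, List.sum_reverse]

@[simp] theorem wordMonomial_nil (ξ : Fin n → ℝ) : wordMonomial [] ξ = 1 := rfl

@[simp] theorem wordMonomial_cons (i : Fin n) (l : List (Fin n)) (ξ : Fin n → ℝ) :
    wordMonomial (i :: l) ξ = Complex.I * (ξ i : ℂ) * wordMonomial l ξ := by
  simp [wordMonomial]

theorem wordMonomial_reverse (l : List (Fin n)) (ξ : Fin n → ℝ) :
    wordMonomial l.reverse ξ = wordMonomial l ξ := by
  simp [wordMonomial, List.prod_reverse]

theorem conj_wordMonomial (l : List (Fin n)) (ξ : Fin n → ℝ) :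
    conj (wordMonomial l ξ) = (-1) ^ l.length * wordMonomial l ξ := by
  induction l with
  | nil => simp
  | cons i l ih =>
    rw [wordMonomial_cons, map_mul, ih, map_mul, Complex.conj_I, Complex.conj_ofReal,
      List.length_cons, pow_succ]
    ring

theorem multiDeriv_eq_wordDeriv (α : Fin n → ℕ) (f : Coord n → V) :
    multiDeriv α f = wordDeriv (multiWord α) f := by
  have h1 : ∀ (k : ℕ) (i : Fin n) (g : Coord n → V),
      (partialDeriv i)^[k] g = wordDeriv (List.replicate k i) g := by
    intro k i g
    induction k with
    | zero => rfl
    | succ k ih => rw [Function.iterate_succ_apply', ih, List.replicate_succ]; rfl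
  unfold multiDeriv multiWord
  induction List.finRange n with
  | nil => rfl
  | cons i L ih =>
    rw [List.foldr_cons, ih, List.flatMap_cons, wordDeriv_append, h1]

theorem wordWeight_multiWord (p : ℕ) (α : Fin n → ℕ) :
    wordWeight p (multiWord α) = weightedDegree p α := by
  have h : ∀ L : List (Fin n), wordWeight p (L.flatMap fun i => List.replicate (α i) i) =
      (L.map fun i => (if i.val < p then 1 else 2) * α i).sum := by
    intro L
    induction L with
    | nil => rfl
    | cons i L ih =>
      rw [List.flatMap_cons, List.map_cons, List.sum_cons, ← ih]
      simp [wordWeight, mul_comm]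
  rw [multiWord, h, weightedDegree, Fin.sum_univ_def]

theorem wordMonomial_multiWord (α : Fin n → ℕ) (ξ : Fin n → ℝ) :
    wordMonomial (multiWord α) ξ = ∏ i, (Complex.I * (ξ i : ℂ)) ^ α i := by
  have h : ∀ L : List (Fin n), wordMonomial (L.flatMap fun i => List.replicate (α i) i) ξ =
      (L.map fun i => (Complex.I * (ξ i : ℂ)) ^ α i).prod := by
    intro L
    induction L with
    | nil => rfl
    | cons i L ih =>
      rw [List.flatMap_cons, List.map_cons, List.prod_cons, ← ih]
      simp [wordMonomial]
  rw [multiWord, h, Fin.prod_univ_def]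

theorem contDiff_partialDeriv {f : Coord n → V} (hf : ContDiff ℝ ∞ f) (i : Fin n) :
    ContDiff ℝ ∞ (partialDeriv i f) :=
  (hf.fderiv_right (m := ∞) (by simp)).clm_apply contDiff_const

theorem contDiff_wordDeriv {f : Coord n → V} (hf : ContDiff ℝ ∞ f) (l : List (Fin n)) :
    ContDiff ℝ ∞ (wordDeriv l f) := by
  induction l with
  | nil => exact hf
  | cons i l ih => exact contDiff_partialDeriv ih i

theorem tsupport_partialDeriv_subset (i : Fin n) (f : Coord n → V) :
    tsupport (partialDeriv i f) ⊆ tsupport f :=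
  tsupport_fderiv_apply_subset ℝ _

theorem tsupport_wordDeriv_subset (l : List (Fin n)) (f : Coord n → V) :
    tsupport (wordDeriv l f) ⊆ tsupport f := by
  induction l with
  | nil => exact Subset.rfl
  | cons i l ih => exact (tsupport_partialDeriv_subset i _).trans ih

theorem wordDeriv_congr {f g : Coord n → V} {y : Coord n} (h : f =ᶠ[𝓝 y] g) (l : List (Fin n)) :
    wordDeriv l f =ᶠ[𝓝 y] wordDeriv l g := by
  induction l with
  | nil => exact h
  | cons i l ih =>
    exact (ih.fderiv (𝕜 := ℝ)).mono fun z hz => by simp only [wordDeriv_cons, partialDeriv, hz]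

theorem wordOp_congr {ι : Type*} [Fintype ι] (a : ι → Coord n → V →L[ℂ] W)
    (l : ι → List (Fin n)) {f g : Coord n → V} {y : Coord n} (h : f =ᶠ[𝓝 y] g) :
    wordOp a l f y = wordOp a l g y :=
  Finset.sum_congr rfl fun t _ => by rw [(wordDeriv_congr h (l t)).eq_of_nhds]

theorem wordDeriv_eq_zero {f : Coord n → V} {y : Coord n} (h : y ∉ tsupport f)
    (l : List (Fin n)) : wordDeriv l f y = 0 :=
  image_eq_zero_of_notMem_tsupport fun h' => h (tsupport_wordDeriv_subset l f h')

theorem wordOp_eq_zero {ι : Type*} [Fintype ι] (a : ι → Coord n → V →L[ℂ] W)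
    (l : ι → List (Fin n)) {f : Coord n → V} {y : Coord n} (h : y ∉ tsupport f) :
    wordOp a l f y = 0 := by
  simp [wordOp, wordDeriv_eq_zero h]

theorem contDiff_clm_apply_of_complex {b : Coord n → V →L[ℂ] W} (hb : ContDiff ℝ ∞ b)
    {f : Coord n → V} (hf : ContDiff ℝ ∞ f) : ContDiff ℝ ∞ (fun y => b y (f y)) :=
  ((ContinuousLinearMap.restrictScalarsL ℂ V W ℝ ℝ).contDiff.comp hb).clm_apply hf

theorem contDiff_wordOp {ι : Type*} [Fintype ι] {a : ι → Coord n → V →L[ℂ] W}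
    (ha : ∀ t, ContDiff ℝ ∞ (a t)) (l : ι → List (Fin n)) {f : Coord n → V}
    (hf : ContDiff ℝ ∞ f) : ContDiff ℝ ∞ (wordOp a l f) :=
  ContDiff.sum fun t _ => contDiff_clm_apply_of_complex (ha t) (contDiff_wordDeriv hf (l t))

theorem tsupport_wordOp_subset {ι : Type*} [Fintype ι] (a : ι → Coord n → V →L[ℂ] W)
    (l : ι → List (Fin n)) (f : Coord n → V) : tsupport (wordOp a l f) ⊆ tsupport f := by
  refine closure_minimal (fun y hy => ?_) isClosed_closure
  by_contra h
  exact hy (wordOp_eq_zero a l h)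

theorem partialDeriv_clm_apply {b : Coord n → V →L[ℂ] W} (hb : ContDiff ℝ ∞ b)
    {f : Coord n → V} (hf : ContDiff ℝ ∞ f) (i : Fin n) (y : Coord n) :
    partialDeriv i (fun y => b y (f y)) y =
      partialDeriv i b y (f y) + b y (partialDeriv i f y) := by
  let R := ContinuousLinearMap.restrictScalarsL ℂ V W ℝ ℝ
  have h1 : HasFDerivAt (fun y => R (b y)) (R.comp (fderiv ℝ b y)) y :=
    R.hasFDerivAt.comp y ((hb.differentiable (by simp)) y).hasFDerivAt
  have h2 := h1.clm_apply ((hf.differentiable (by simp)) y).hasFDerivAt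
  have h3 : HasFDerivAt (fun y => b y (f y)) _ y := h2
  rw [partialDeriv, h3.fderiv]
  simp [R, partialDeriv, add_comm]

theorem partialDeriv_sum {ι : Type*} [Fintype ι] {f : ι → Coord n → V}
    (hf : ∀ t, ContDiff ℝ ∞ (f t)) (i : Fin n) (y : Coord n) :
    partialDeriv i (fun y => ∑ t, f t y) y = ∑ t, partialDeriv i (f t) y := by
  rw [partialDeriv, fderiv_fun_sum fun t _ => (hf t).differentiable (by simp) y]
  simp [partialDeriv]

/-- The commutator of `∂^l` with multiplication by `b` is a differential operator of smaller
weighted order, with coefficients supported in the support of `b`. -/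
theorem exists_wordDeriv_clm_apply (p : ℕ) {b : Coord n → V →L[ℂ] W} (hb : ContDiff ℝ ∞ b)
    (l : List (Fin n)) : ∃ (κ : Type) (_ : Fintype κ) (c : κ → Coord n → V →L[ℂ] W)
      (m : κ → List (Fin n)), (∀ t, ContDiff ℝ ∞ (c t)) ∧ (∀ t, tsupport (c t) ⊆ tsupport b) ∧
      (∀ t, wordWeight p (m t) < wordWeight p l) ∧ ∀ f : Coord n → V, ContDiff ℝ ∞ f → ∀ y,
        wordDeriv l (fun y => b y (f y)) y = b y (wordDeriv l f y) + wordOp c m f y := by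
  induction l with
  | nil =>
    exact ⟨Empty, inferInstance, fun t => t.elim, fun t => t.elim, fun t => t.elim,
      fun t => t.elim, fun t => t.elim, fun f _ y => by simp [wordOp]⟩
  | cons i l ih =>
    obtain ⟨κ, _, c, m, hc, hcs, hm, h⟩ := ih
    refine ⟨Option (κ ⊕ κ), inferInstance,
      fun t => t.elim (partialDeriv i b) (Sum.elim (fun t => partialDeriv i (c t)) c),
      fun t => t.elim l (Sum.elim m (fun t => i :: m t)), ?_, ?_, ?_, ?_⟩
    · rintro (_ | t | t)
      · exact contDiff_partialDeriv hb i
      · exact contDiff_partialDeriv (hc t) i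
      · exact hc t
    · rintro (_ | t | t)
      · exact tsupport_partialDeriv_subset i b
      · exact (tsupport_partialDeriv_subset i _).trans (hcs t)
      · exact hcs t
    · rintro (_ | t | t)
      · simp only [Option.elim, wordWeight_cons]; split_ifs <;> omega
      · have := hm t
        simp only [Option.elim, Sum.elim_inl, wordWeight_cons]; split_ifs <;> omega
      · have := hm t
        simp only [Option.elim, Sum.elim_inr, wordWeight_cons]; split_ifs <;> omega
    · intro f hf y
      have h1 : wordDeriv l (fun y => b y (f y)) =
          fun y => b y (wordDeriv l f y) + wordOp c m f y := funext (h f hf)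
      have hd1 := contDiff_clm_apply_of_complex hb (contDiff_wordDeriv hf l)
      have hd2 := contDiff_wordOp hc m hf
      have h2 : partialDeriv i (wordOp c m f) y =
          ∑ t, (partialDeriv i (c t) y (wordDeriv (m t) f y) +
            c t y (wordDeriv (i :: m t) f y)) := by
        refine (partialDeriv_sum (fun t => contDiff_clm_apply_of_complex (hc t)
          (contDiff_wordDeriv hf (m t))) i y).trans (Finset.sum_congr rfl fun t _ => ?_)
        exact partialDeriv_clm_apply (hc t) (contDiff_wordDeriv hf (m t)) i y
      have h3 : partialDeriv i (fun y => b y (wordDeriv l f y) + wordOp c m f y) y =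
          partialDeriv i (fun y => b y (wordDeriv l f y)) y + partialDeriv i (wordOp c m f) y := by
        simp only [partialDeriv]
        rw [fderiv_fun_add (hd1.differentiable (by simp) y) (hd2.differentiable (by simp) y)]
        rfl
      rw [wordDeriv_cons, h1, h3, h2, partialDeriv_clm_apply hb (contDiff_wordDeriv hf l)]
      simp only [wordOp, Fintype.sum_option, Fintype.sum_sum_type, Option.elim, Sum.elim_inl,
        Sum.elim_inr, Finset.sum_add_distrib, wordDeriv_cons]
      abel

end Words

section Adjoint

variable {n : ℕ} {V W : Type*} [NormedAddCommGroup V] [InnerProductSpace ℂ V]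
  [NormedAddCommGroup W] [InnerProductSpace ℂ W]

theorem integral_inner_partialDeriv {f g : Coord n → V} (hf : ContDiff ℝ ∞ f)
    (hfs : HasCompactSupport f) (hg : ContDiff ℝ ∞ g) (hgs : HasCompactSupport g) (i : Fin n) :
    ∫ y, inner ℂ (partialDeriv i f y) (g y) = -∫ y, inner ℂ (f y) (partialDeriv i g y) := by
  have h := SchwartzMap.integral_bilinear_lineDerivOp_right_eq_neg_left (μ := volume)
    (hfs.toSchwartzMap hf) (hgs.toSchwartzMap hg)
    ((isBoundedBilinearMap_inner (𝕜 := ℂ) (E := V)).toContinuousLinearMap)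
    (EuclideanSpace.single i (1 : ℝ))
  simp only [SchwartzMap.lineDerivOp_apply_eq_fderiv] at h
  have h' : ∫ y, inner ℂ (f y) (partialDeriv i g y) =
    -∫ y, inner ℂ (partialDeriv i f y) (g y) := h
  rw [h', neg_neg]

theorem integral_inner_wordDeriv {f g : Coord n → V} (hf : ContDiff ℝ ∞ f)
    (hfs : HasCompactSupport f) (hg : ContDiff ℝ ∞ g) (hgs : HasCompactSupport g)
    (l : List (Fin n)) :
    ∫ y, inner ℂ (wordDeriv l f y) (g y) =
      (-1) ^ l.length * ∫ y, inner ℂ (f y) (wordDeriv l.reverse g y) := by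
  induction l generalizing g with
  | nil => simp
  | cons i l ih =>
    rw [wordDeriv_cons, integral_inner_partialDeriv (contDiff_wordDeriv hf l)
      (hfs.mono' (subset_closure.trans (tsupport_wordDeriv_subset l f))) hg hgs,
      ih (contDiff_partialDeriv hg i)
        (hgs.mono' (subset_closure.trans (tsupport_partialDeriv_subset i g))),
      List.length_cons, List.reverse_cons, wordDeriv_append, pow_succ]
    simp

theorem integrable_inner_of_contDiff {f g : Coord n → V} (hf : ContDiff ℝ ∞ f)
    (hfs : HasCompactSupport f) (hg : ContDiff ℝ ∞ g) :
    Integrable (fun y => (inner ℂ (f y) (g y) : ℂ)) := by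
  refine (hf.continuous.inner hg.continuous).integrable_of_hasCompactSupport (hfs.mono ?_)
  intro y hy h0
  exact hy (by simp [h0])

variable [CompleteSpace V] [CompleteSpace W]

theorem contDiff_adjoint {b : Coord n → V →L[ℂ] W} (hb : ContDiff ℝ ∞ b) :
    ContDiff ℝ ∞ (fun y => ContinuousLinearMap.adjoint (b y)) :=
  ((AddMonoidHomClass.toAddMonoidHom
    (ContinuousLinearMap.adjoint (𝕜 := ℂ) (E := V) (F := W))).toRealLinearMap
      ContinuousLinearMap.adjoint.continuous).contDiff.comp hb

/-- Integration by parts: a differential operator has a formal adjoint, of the same weighted order,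
whose principal symbol is the adjoint of the principal symbol. -/
theorem exists_formalAdjoint (p d : ℕ) {ι : Type} [Fintype ι] {a : ι → Coord n → V →L[ℂ] W}
    (ha : ∀ t, ContDiff ℝ ∞ (a t)) {l : ι → List (Fin n)} (hl : ∀ t, wordWeight p (l t) ≤ d) :
    ∃ (κ : Type) (_ : Fintype κ) (b : κ → Coord n → W →L[ℂ] V) (m : κ → List (Fin n)),
      (∀ t, ContDiff ℝ ∞ (b t)) ∧ (∀ t, wordWeight p (m t) ≤ d) ∧
      (∀ (f : Coord n → V) (g : Coord n → W), ContDiff ℝ ∞ f → HasCompactSupport f →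
        ContDiff ℝ ∞ g → HasCompactSupport g →
        ∫ y, inner ℂ (wordOp a l f y) (g y) = ∫ y, inner ℂ (f y) (wordOp b m g y)) ∧
      ∀ y ξ, wordSymbol p d b m y ξ = ContinuousLinearMap.adjoint (wordSymbol p d a l y ξ) := by
  let a' : ι → Coord n → W →L[ℂ] V := fun t y => ContinuousLinearMap.adjoint (a t y)
  have ha' : ∀ t, ContDiff ℝ ∞ (a' t) := fun t => contDiff_adjoint (ha t)
  choose κ inst c m hc hcs hm h using fun t => exists_wordDeriv_clm_apply p (ha' t) (l t).reverse
  let s : ι → ℂ := fun t => (-1) ^ (l t).length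
  refine ⟨Σ t, Option (κ t), inferInstance,
    fun t => t.2.elim (s t.1 • a' t.1) (fun j => s t.1 • c t.1 j),
    fun t => t.2.elim (l t.1).reverse (m t.1), ?_, ?_, ?_, ?_⟩
  · rintro ⟨t, _ | j⟩
    · exact contDiff_const.smul (ha' t)
    · exact contDiff_const.smul (hc t j)
  · rintro ⟨t, _ | j⟩
    · simpa [wordWeight_reverse] using hl t
    · have := hm t j
      rw [wordWeight_reverse] at this
      exact this.le.trans (hl t)
  · intro f g hf hfs hg hgs
    have e1 : ∀ y, inner ℂ (wordOp a l f y) (g y) =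
        ∑ t, inner ℂ (wordDeriv (l t) f y) (a' t y (g y)) := by
      intro y
      rw [wordOp, sum_inner]
      exact Finset.sum_congr rfl fun t _ => by
        rw [ContinuousLinearMap.adjoint_inner_right]
    have hag : ∀ t, ContDiff ℝ ∞ (fun y => a' t y (g y)) := fun t =>
      contDiff_clm_apply_of_complex (ha' t) hg
    have hags : ∀ t, HasCompactSupport (fun y => a' t y (g y)) := fun t => by
      refine hgs.mono fun y hy h0 => hy ?_
      simp only
      rw [h0, map_zero]
    have e2 : ∀ y, inner ℂ (f y) (wordOp (fun t : Σ t, Option (κ t) =>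
          t.2.elim (s t.1 • a' t.1) (fun j => s t.1 • c t.1 j))
          (fun t => t.2.elim (l t.1).reverse (m t.1)) g y) =
        ∑ t, s t * inner ℂ (f y) (wordDeriv (l t).reverse (fun y => a' t y (g y)) y) := by
      intro y
      rw [wordOp, Fintype.sum_sigma, inner_sum]
      refine Finset.sum_congr rfl fun t _ => ?_
      rw [h t g hg y, wordOp, Fintype.sum_option, ← inner_smul_right, smul_add, Finset.smul_sum]
      rfl
    simp_rw [e1, e2]
    rw [integral_finsetSum _ fun t _ => ?_, integral_finsetSum _ fun t _ => ?_]
    · refine Finset.sum_congr rfl fun t _ => ?_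
      rw [integral_inner_wordDeriv hf hfs (hag t) (hags t), integral_const_mul]
    · exact (integrable_inner_of_contDiff hf hfs
        (contDiff_wordDeriv (hag t) (l t).reverse)).const_mul _
    · exact integrable_inner_of_contDiff (contDiff_wordDeriv hf (l t))
        (hfs.mono' (subset_closure.trans (tsupport_wordDeriv_subset _ f))) (hag t)
  · intro y ξ
    rw [wordSymbol, wordSymbol, Finset.sum_filter, Finset.sum_filter, Fintype.sum_sigma, map_sum]
    refine Finset.sum_congr rfl fun t _ => ?_
    rw [Fintype.sum_option]
    rw [Finset.sum_eq_zero (s := Finset.univ (α := κ t)) fun j _ => if_neg ?_, add_zero]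
    swap
    · have := hm t j
      rw [wordWeight_reverse] at this
      exact (this.trans_le (hl t)).ne
    simp only [Option.elim, wordWeight_reverse]
    split_ifs
    · rw [LinearIsometryEquiv.map_smulₛₗ, conj_wordMonomial, wordMonomial_reverse, Pi.smul_apply,
        smul_smul, mul_comm]
    · simp

end Adjoint

/-! ### Multiplication operators and the Fourier transform on `L²(ℝⁿ)` -/

open scoped FourierTransform

section MulLp

variable {n : ℕ} {V W Z : Type*} [NormedAddCommGroup V] [NormedSpace ℂ V]
  [NormedAddCommGroup W] [NormedSpace ℂ W] [NormedAddCommGroup Z] [NormedSpace ℂ Z]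

/-- The space `L²(ℝⁿ; V)`. -/
abbrev CoordL2 (n : ℕ) (V : Type*) [NormedAddCommGroup V] : Type _ :=
  Lp (α := Coord n) V 2 volume

-- Shortcuts, since instance search through `CoordL2` and `Lp` is slow.
instance : NormedAddCommGroup (CoordL2 n V) := Lp.instNormedAddCommGroup

instance : NormedSpace ℂ (CoordL2 n V) := Lp.instNormedSpace

instance : NormedAddCommGroup (CoordL2 n V →L[ℂ] CoordL2 n W) :=
  ContinuousLinearMap.toNormedAddCommGroup

instance : SeminormedAddCommGroup (CoordL2 n V →L[ℂ] CoordL2 n W) :=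
  ContinuousLinearMap.toSeminormedAddCommGroup

open Classical in
/-- Multiplication of `V`-valued `L²` functions by an essentially bounded function `m` with values
in the operators `V → W`; it is `0` by convention if `m` is not essentially bounded. -/
def mulLp (m : Coord n → V →L[ℂ] W) : CoordL2 n V →L[ℂ] CoordL2 n W :=
  if h : MemLp m ⊤ volume then
    (ContinuousLinearMap.id ℂ (V →L[ℂ] W)).holderL volume ⊤ 2 2 h.toLp
  else 0

theorem coeFn_mulLp {m : Coord n → V →L[ℂ] W} (hm : MemLp m ⊤ volume) (f : CoordL2 n V) :
    mulLp m f =ᵐ[volume] fun x => m x (f x) := by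
  rw [mulLp, dif_pos hm]
  have h1 := ContinuousLinearMap.coeFn_holder (r := 2)
    (ContinuousLinearMap.id ℂ (V →L[ℂ] W)) hm.toLp f
  filter_upwards [h1, hm.coeFn_toLp] with x hx hx2
  rw [← hx2]
  exact hx

theorem norm_mulLp_apply_le {m : Coord n → V →L[ℂ] W} (hm : MemLp m ⊤ volume) {C : ℝ}
    (h : ∀ x, ‖m x‖ ≤ C) (f : CoordL2 n V) : ‖mulLp m f‖ ≤ C * ‖f‖ := by
  refine Lp.norm_le_mul_norm_of_ae_le_mul ?_
  filter_upwards [coeFn_mulLp hm f] with x hx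
  rw [hx]
  exact (m x).le_of_opNorm_le (h x) _

theorem norm_mulLp_le {m : Coord n → V →L[ℂ] W} (hm : MemLp m ⊤ volume) {C : ℝ} (hC : 0 ≤ C)
    (h : ∀ x, ‖m x‖ ≤ C) : ‖mulLp m‖ ≤ C :=
  ContinuousLinearMap.opNorm_le_bound _ hC (norm_mulLp_apply_le hm h)

theorem mulLp_add {m m₁ m₂ : Coord n → V →L[ℂ] W} (hm : MemLp m ⊤ volume)
    (hm₁ : MemLp m₁ ⊤ volume) (hm₂ : MemLp m₂ ⊤ volume) (h : ∀ x, m x = m₁ x + m₂ x) :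
    mulLp m = mulLp m₁ + mulLp m₂ := by
  refine ContinuousLinearMap.ext fun f => ?_
  rw [add_apply]
  refine Lp.ext ?_
  filter_upwards [coeFn_mulLp hm f, coeFn_mulLp hm₁ f, coeFn_mulLp hm₂ f,
    Lp.coeFn_add (mulLp m₁ f) (mulLp m₂ f)] with x h1 h2 h3 h4
  rw [h4, Pi.add_apply, h1, h2, h3, h, add_apply]

theorem memLp_top_of_continuous {m : Coord n → V →L[ℂ] W} (hm : Continuous m) {C : ℝ}
    (h : ∀ x, ‖m x‖ ≤ C) : MemLp m ⊤ volume :=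
  memLp_top_of_bound hm.aestronglyMeasurable C (.of_forall h)

theorem memLp_top_of_hasCompactSupport {m : Coord n → V →L[ℂ] W} (hm : Continuous m)
    (hs : HasCompactSupport m) : MemLp m ⊤ volume := by
  obtain ⟨C, hC⟩ := hm.bounded_above_of_compact_support hs
  exact memLp_top_of_continuous hm hC

theorem mulLp_toLp {m : Coord n → V →L[ℂ] W} (hm : MemLp m ⊤ volume) {f : Coord n → V}
    (hf : MemLp f 2 volume) {g : Coord n → W} (hg : MemLp g 2 volume)
    (h : ∀ x, g x = m x (f x)) : mulLp m (hf.toLp f) = hg.toLp g := by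
  refine Lp.ext ?_
  filter_upwards [coeFn_mulLp hm (hf.toLp f), hf.coeFn_toLp, hg.coeFn_toLp] with x h1 h2 h3
  rw [h1, h2, h3, h]

end MulLp

section Fourier

variable {n : ℕ} {V W Z : Type*} [NormedAddCommGroup V] [InnerProductSpace ℂ V] [CompleteSpace V]
  [NormedAddCommGroup W] [InnerProductSpace ℂ W] [CompleteSpace W]
  [NormedAddCommGroup Z] [NormedSpace ℂ Z]

/-- Smooth functions with compact support are dense in `L²`. -/
theorem exists_smooth_near (f : CoordL2 n V) {ε : ℝ} (hε : 0 < ε) :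
    ∃ g : Coord n → V, ContDiff ℝ ∞ g ∧ HasCompactSupport g ∧
      ∃ hg : MemLp g 2 volume, ‖f - hg.toLp g‖ ≤ ε := by
  obtain ⟨g, h1, h2, h3⟩ := MemLp.exist_eLpNorm_sub_le (by simp) (by norm_num) (Lp.memLp f) hε
  have hg : MemLp g 2 volume := h2.continuous.memLp_of_hasCompactSupport h1
  refine ⟨g, h2, h1, hg, ?_⟩
  rw [Lp.norm_def]
  refine ENNReal.toReal_le_of_le_ofReal hε.le (le_trans (le_of_eq ?_) h3)
  refine eLpNorm_congr_ae ?_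
  filter_upwards [Lp.coeFn_sub f (hg.toLp g), hg.coeFn_toLp] with x hx hx2
  rw [hx, Pi.sub_apply, hx2, Pi.sub_apply]

/-- The norm of an operator on `L²` may be tested on smooth functions with compact support. -/
theorem opNorm_le_of_smooth (T : CoordL2 n V →L[ℂ] Z) {C : ℝ} (hC : 0 ≤ C)
    (h : ∀ g : Coord n → V, ContDiff ℝ ∞ g → HasCompactSupport g →
      ∀ hg : MemLp g 2 volume, ‖T (hg.toLp g)‖ ≤ C * ‖hg.toLp g‖) : ‖T‖ ≤ C := by
  refine ContinuousLinearMap.opNorm_le_bound _ hC fun f => ?_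
  have hcl : IsClosed {f | ‖T f‖ ≤ C * ‖f‖} :=
    isClosed_le T.continuous.norm (continuous_const.mul continuous_norm)
  refine (hcl.closure_subset_iff (s := {f | ∃ g : Coord n → V, ContDiff ℝ ∞ g ∧
    HasCompactSupport g ∧ ∃ hg : MemLp g 2 volume, hg.toLp g = f})).2 ?_ ?_
  · rintro _ ⟨g, h1, h2, hg, rfl⟩
    exact h g h1 h2 hg
  · refine Metric.mem_closure_iff.2 fun ε hε => ?_
    obtain ⟨g, h1, h2, hg, h3⟩ := exists_smooth_near f (half_pos hε)
    exact ⟨_, ⟨g, h1, h2, hg, rfl⟩, by rw [dist_eq_norm]; linarith⟩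

variable (n V) in
/-- The inverse Fourier transform on `L²(ℝⁿ; V)`. -/
def invFourier : CoordL2 n V ≃L[ℂ] CoordL2 n V :=
  (Lp.fourierTransformₗᵢ (Coord n) V).symm.toContinuousLinearEquiv

theorem norm_invFourier_apply (f : CoordL2 n V) : ‖invFourier n V f‖ = ‖f‖ :=
  (Lp.fourierTransformₗᵢ (Coord n) V).symm.norm_map f

theorem norm_invFourier_symm_apply (f : CoordL2 n V) : ‖(invFourier n V).symm f‖ = ‖f‖ :=
  (Lp.fourierTransformₗᵢ (Coord n) V).norm_map f

theorem norm_invFourier_comp_le (T : CoordL2 n W →L[ℂ] CoordL2 n V) :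
    ‖(invFourier n V : CoordL2 n V →L[ℂ] CoordL2 n V) ∘L T‖ ≤ ‖T‖ := by
  refine ContinuousLinearMap.opNorm_le_bound _ (norm_nonneg _) fun f => ?_
  change ‖invFourier n V (T f)‖ ≤ _
  rw [norm_invFourier_apply]
  exact T.le_opNorm f

/-- The frequency `2πξ` of the character `x ↦ exp (2πi⟨x, ξ⟩)`. -/
def freq (ξ : Coord n) : Fin n → ℝ := fun i => 2 * Real.pi * ξ i

theorem freq_ne_zero {ξ : Coord n} (h : ξ ≠ 0) : freq ξ ≠ 0 := by
  intro h0
  apply h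
  ext i
  have := congrFun h0 i
  simpa [freq, Real.pi_ne_zero] using this

theorem contDiff_freq : ContDiff ℝ ∞ (freq : Coord n → Fin n → ℝ) := by
  unfold freq
  fun_prop

theorem contDiff_wordMonomial_freq (l : List (Fin n)) :
    ContDiff ℝ ∞ (fun ξ : Coord n => wordMonomial l (freq ξ)) := by
  induction l with
  | nil => exact contDiff_const
  | cons i l ih =>
    simp only [wordMonomial_cons]
    refine ContDiff.mul (contDiff_const.mul ?_) ih
    exact Complex.ofRealCLM.contDiff.comp ((contDiff_pi.1 contDiff_freq) i)

theorem contDiff_fourierInv {g : Coord n → V} (hg : ContDiff ℝ ∞ g) (hgs : HasCompactSupport g) :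
    ContDiff ℝ ∞ (𝓕⁻ g) := by
  have := (𝓕⁻ (hgs.toSchwartzMap hg)).smooth ⊤
  rwa [SchwartzMap.fourierInv_coe] at this

theorem memLp_fourierInv {g : Coord n → V} (hg : ContDiff ℝ ∞ g) (hgs : HasCompactSupport g) :
    MemLp (𝓕⁻ g) 2 volume := by
  have := (𝓕⁻ (hgs.toSchwartzMap hg)).memLp 2 volume
  rwa [SchwartzMap.fourierInv_coe] at this

theorem toLp_fourierInv {g : Coord n → V} (hg : ContDiff ℝ ∞ g) (hgs : HasCompactSupport g)
    (h1 : MemLp g 2 volume) (h2 : MemLp (𝓕⁻ g) 2 volume) :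
    h2.toLp (𝓕⁻ g) = invFourier n V (h1.toLp g) := by
  have h := SchwartzMap.toLp_fourierInv_eq (hgs.toSchwartzMap hg)
  have h3 : (𝓕⁻ (hgs.toSchwartzMap hg)).toLp 2 volume = h2.toLp (𝓕⁻ g) := by
    refine MemLp.toLp_congr _ _ (.of_forall fun x => ?_)
    rw [SchwartzMap.fourierInv_coe]
    rfl
  rw [← h3, ← h]
  rfl

theorem hasCompactSupport_wordMonomial_smul {g : Coord n → V} (hgs : HasCompactSupport g)
    (l : List (Fin n)) : HasCompactSupport (fun ξ => wordMonomial l (freq ξ) • g ξ) :=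
  hgs.mono fun ξ hξ h0 => hξ (by simp only; rw [h0, smul_zero])

theorem contDiff_wordMonomial_smul {g : Coord n → V} (hg : ContDiff ℝ ∞ g) (l : List (Fin n)) :
    ContDiff ℝ ∞ (fun ξ => wordMonomial l (freq ξ) • g ξ) :=
  (contDiff_wordMonomial_freq l).smul hg

theorem partialDeriv_fourierInv {g : Coord n → V} (hg : ContDiff ℝ ∞ g) (hgs : HasCompactSupport g)
    (i : Fin n) : partialDeriv i (𝓕⁻ g) = 𝓕⁻ (fun ξ => (Complex.I * (freq ξ i : ℂ)) • g ξ) := by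
  funext y
  have h := SchwartzMap.lineDerivOp_fourierInv_eq (hgs.toSchwartzMap hg)
    (EuclideanSpace.single i (1 : ℝ))
  have h1 := congrArg (fun f : SchwartzMap (Coord n) V => f y) h
  simp only [SchwartzMap.lineDerivOp_apply_eq_fderiv, SchwartzMap.fourierInv_coe] at h1
  refine h1.trans (congrFun (congrArg _ ?_) y)
  funext ξ
  have ht : (fun ξ : Coord n =>
      inner ℝ ξ (EuclideanSpace.single i (1 : ℝ))).HasTemperateGrowth := by
    fun_prop
  rw [smul_apply, SchwartzMap.smulLeftCLM_apply_apply ht]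
  simp only [EuclideanSpace.inner_single_right, freq]
  change _ • _ • g ξ = _
  rw [← Complex.coe_smul, smul_smul]
  congr 1
  simp
  ring

theorem wordDeriv_fourierInv {g : Coord n → V} (hg : ContDiff ℝ ∞ g) (hgs : HasCompactSupport g)
    (l : List (Fin n)) :
    wordDeriv l (𝓕⁻ g) = 𝓕⁻ (fun ξ => wordMonomial l (freq ξ) • g ξ) := by
  induction l with
  | nil => simp
  | cons i l ih =>
    rw [wordDeriv_cons, ih, partialDeriv_fourierInv (contDiff_wordMonomial_smul hg l)
      (hasCompactSupport_wordMonomial_smul hgs l)]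
    simp only [wordMonomial_cons, smul_smul]

end Fourier

/-! ### Approximability of localized Fourier multipliers -/

section Evaluation

variable {n : ℕ} {V W Z : Type*} [NormedAddCommGroup V] [NormedSpace ℂ V]
  [FiniteDimensional ℂ V] [NormedAddCommGroup W] [NormedSpace ℂ W]
  [NormedAddCommGroup Z] [NormedSpace ℂ Z]

theorem norm_exp_sub_exp_le (a b : ℝ) :
    ‖Complex.exp (a * Complex.I) - Complex.exp (b * Complex.I)‖ ≤ |a - b| := by
  have h : Complex.exp (a * Complex.I) - Complex.exp (b * Complex.I) =
      Complex.exp (b * Complex.I) * (Complex.exp (Complex.I * ((a - b : ℝ) : ℂ)) - 1) := by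
    rw [mul_sub, ← Complex.exp_add, mul_one]
    congr 2
    push_cast
    ring
  rw [h, norm_mul, Complex.norm_exp_ofReal_mul_I, one_mul]
  exact Real.norm_exp_I_mul_ofReal_sub_one_le

/-- The inverse Fourier transform of `m • g`, at the point `x`, as a functional of `g ∈ L²`; here
`m` is smooth with compact support. It depends on `x` in a Lipschitz manner. -/
theorem exists_fourierInv_eval {m : Coord n → Z →L[ℂ] V} (hm : ContDiff ℝ ∞ m)
    (hms : HasCompactSupport m) : ∃ (J : Coord n → CoordL2 n Z →L[ℂ] V) (C : ℝ),
      0 ≤ C ∧ (∀ x y g, ‖J x g - J y g‖ ≤ C * ‖x - y‖ * ‖g‖) ∧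
      ∀ (g : Coord n → Z) (hg : MemLp g 2 volume) (x : Coord n),
        𝓕⁻ (fun ξ => m ξ (g ξ)) x = J x (hg.toLp g) := by
  let e : Coord n → Coord n → ℂ := fun x ξ =>
    Complex.exp (((2 * Real.pi * inner ℝ ξ x : ℝ) : ℂ) * Complex.I)
  have he : ∀ x, Continuous (e x) := fun x =>
    Complex.continuous_exp.comp ((Complex.continuous_ofReal.comp
      (continuous_const.mul (continuous_id.inner continuous_const))).mul continuous_const)
  have hem : ∀ x, MemLp (fun ξ => e x ξ • m ξ) 2 volume := fun x =>
    ((he x).smul hm.continuous).memLp_of_hasCompactSupport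
      (hms.mono fun ξ hξ h0 => hξ (by rw [Pi.smul_apply', h0, smul_zero]))
  have hm2 : MemLp m 2 volume := hm.continuous.memLp_of_hasCompactSupport hms
  let B := ContinuousLinearMap.lpPairing (volume : Measure (Coord n)) 2 2
    (ContinuousLinearMap.id ℂ (Z →L[ℂ] V))
  let J : Coord n → CoordL2 n Z →L[ℂ] V := fun x => B (hem x).toLp
  obtain ⟨R, hR⟩ := hms.isCompact.isBounded.exists_norm_le
  let R' := max R 0
  have hdiff : ∀ x y, ‖(hem x).toLp - (hem y).toLp‖ ≤
      (2 * Real.pi * R' * ‖x - y‖) * ‖hm2.toLp‖ := by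
    intro x y
    refine Lp.norm_le_mul_norm_of_ae_le_mul ?_
    filter_upwards [(hem x).coeFn_toLp, (hem y).coeFn_toLp, hm2.coeFn_toLp,
      Lp.coeFn_sub (hem x).toLp (hem y).toLp] with ξ h1 h2 h3 h4
    rw [h4, Pi.sub_apply, h1, h2, h3, ← sub_smul, norm_smul]
    by_cases h0 : m ξ = 0
    · simp [h0]
    have hξ : ‖ξ‖ ≤ R' := (hR ξ (subset_closure h0)).trans (le_max_left _ _)
    refine mul_le_mul_of_nonneg_right ((norm_exp_sub_exp_le _ _).trans ?_) (norm_nonneg _)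
    rw [← mul_sub, ← inner_sub_right, abs_mul, abs_of_pos (by positivity : 0 < 2 * Real.pi),
      mul_assoc (2 * Real.pi)]
    refine mul_le_mul_of_nonneg_left ((abs_real_inner_le_norm _ _).trans ?_) (by positivity)
    exact mul_le_mul_of_nonneg_right hξ (norm_nonneg _)
  refine ⟨J, ‖B‖ * (2 * Real.pi * R' * ‖hm2.toLp‖), ?_, ?_, ?_⟩
  · have : 0 ≤ R' := le_max_right _ _
    positivity
  · intro x y g
    have h1 : J x g - J y g = B ((hem x).toLp - (hem y).toLp) g := by
      rw [map_sub]; rfl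
    rw [h1]
    refine ((B _).le_opNorm g).trans ?_
    refine mul_le_mul_of_nonneg_right ?_ (norm_nonneg _)
    calc ‖B ((hem x).toLp - (hem y).toLp)‖ ≤ ‖B‖ * ‖(hem x).toLp - (hem y).toLp‖ :=
          B.le_opNorm _
      _ ≤ ‖B‖ * ((2 * Real.pi * R' * ‖x - y‖) * ‖hm2.toLp‖) := by
          gcongr; exact hdiff x y
      _ = _ := by ring
  · intro g hg x
    rw [Real.fourierInv_eq']
    have h1 : J x (hg.toLp g) = ∫ ξ, ((hem x).toLp (fun ξ => e x ξ • m ξ) ξ) (hg.toLp g ξ) :=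
      ContinuousLinearMap.lpPairing_eq_integral (ContinuousLinearMap.id ℂ (Z →L[ℂ] V))
        (hem x).toLp (hg.toLp g)
    rw [h1]
    refine integral_congr_ae ?_
    filter_upwards [(hem x).coeFn_toLp, hg.coeFn_toLp] with ξ h1 h2
    rw [h1, h2]
    rfl

theorem exists_clm_ae_eq {c : Coord n → V →L[ℂ] W}
    (hc : ∀ v, MemLp (fun x => c x v) 2 volume) :
    ∃ B : V →L[ℂ] CoordL2 n W, ∀ v, B v =ᵐ[volume] fun x => c x v :=
  ⟨LinearMap.toContinuousLinearMap
    { toFun := fun v => (hc v).toLp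
      map_add' := fun v w => by
        rw [← MemLp.toLp_add]
        exact MemLp.toLp_congr _ _ (.of_forall fun x => map_add (c x) v w)
      map_smul' := fun s v => by
        rw [RingHom.id_apply, ← MemLp.toLp_const_smul]
        exact MemLp.toLp_congr _ _ (.of_forall fun x => map_smul (c x) s v) },
    fun v => (hc v).coeFn_toLp⟩

end Evaluation

section Compactness

variable {n : ℕ} {V W Z : Type*} [NormedAddCommGroup V] [InnerProductSpace ℂ V]
  [FiniteDimensional ℂ V] [NormedAddCommGroup W] [InnerProductSpace ℂ W] [FiniteDimensional ℂ W]
  [NormedAddCommGroup Z] [InnerProductSpace ℂ Z] [FiniteDimensional ℂ Z]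

/-- `f ↦ c (F⁻¹ (m f))` is approximable if `c` is bounded with bounded support and `m` is smooth
with compact support: its kernel depends on the position `x` in a Lipschitz manner, so that it may
be replaced by a kernel which is constant in `x` on each of finitely many small cells. -/
theorem isApproximable_of_hasCompactSupport {c : Coord n → V →L[ℂ] W} (hc : MemLp c ⊤ volume)
    {C ρ : ℝ} (hC : ∀ x, ‖c x‖ ≤ C) (hρ : ∀ x, ρ < ‖x‖ → c x = 0) {m : Coord n → Z →L[ℂ] V}
    (hm : ContDiff ℝ ∞ m) (hms : HasCompactSupport m) :
    IsApproximable (mulLp c ∘L (invFourier n V : CoordL2 n V →L[ℂ] CoordL2 n V) ∘L mulLp m) := by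
  obtain ⟨J, D, hD, hJ, hJF⟩ := exists_fourierInv_eval hm hms
  have hC0 : 0 ≤ C := (norm_nonneg _).trans (hC 0)
  have hμ : volume (Metric.closedBall (0 : Coord n) ρ) ≠ ⊤ := measure_closedBall_lt_top.ne
  let χ : CoordL2 n ℝ := indicatorConstLp 2 (Metric.isClosed_closedBall.measurableSet) hμ (1 : ℝ)
  intro ε hε
  obtain ⟨δ, hδ, hδε⟩ : ∃ δ > 0, C * (D * δ) * ‖χ‖ ≤ ε := by
    refine ⟨ε / (C * D * ‖χ‖ + 1), by positivity, ?_⟩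
    rw [show C * (D * (ε / (C * D * ‖χ‖ + 1))) * ‖χ‖ = (C * D * ‖χ‖) / (C * D * ‖χ‖ + 1) * ε by
      field_simp]
    refine mul_le_of_le_one_left hε.le ((div_le_one (by positivity)).2 (by linarith))
  -- disjoint cells of radius `δ`, finitely many of which cover the support of `c`
  let x₀ : ℕ → Coord n := TopologicalSpace.denseSeq (Coord n)
  let A : ℕ → Set (Coord n) := disjointed fun k => Metric.ball (x₀ k) δ
  have hAm : ∀ k, MeasurableSet (A k) := fun k =>
    MeasurableSet.disjointed (fun k => measurableSet_ball) k
  have hAd := disjoint_disjointed fun k => Metric.ball (x₀ k) δ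
  obtain ⟨N, hN⟩ : ∃ N, Metric.closedBall (0 : Coord n) ρ ⊆ ⋃ k ∈ Finset.range N, A k := by
    obtain ⟨t, ht⟩ := (isCompact_closedBall (0 : Coord n) ρ).elim_finite_subcover
      (fun k => Metric.ball (x₀ k) δ) (fun k => Metric.isOpen_ball) (fun x _ => by
        obtain ⟨k, hk⟩ := (TopologicalSpace.denseRange_denseSeq (Coord n)).exists_dist_lt x hδ
        exact mem_iUnion.2 ⟨k, hk⟩)
    refine ⟨t.sup id + 1, fun x hx => ?_⟩
    obtain ⟨k, hk, hxk⟩ := mem_iUnion₂.1 (ht hx)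
    have h1 : x ∈ partialSups (fun k => Metric.ball (x₀ k) δ) k :=
      le_partialSups (fun k => Metric.ball (x₀ k) δ) k hxk
    rw [← partialSups_disjointed, partialSups_eq_biUnion_range] at h1
    obtain ⟨j, hj, hxj⟩ := mem_iUnion₂.1 h1
    refine mem_iUnion₂.2 ⟨j, ?_, hxj⟩
    have : k ≤ t.sup id := Finset.le_sup (f := id) hk
    simp only [Finset.mem_range] at hj ⊢
    omega
  -- on the cell `A k` the kernel is replaced by its value at the centre `x₀ k`
  have hcA : ∀ k v, MemLp (fun x => (A k).indicator c x v) 2 volume := by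
    intro k v
    have h1 : (fun x => (A k).indicator c x v) =
        (Metric.closedBall (0 : Coord n) ρ).indicator ((A k).indicator fun x => c x v) := by
      funext x
      by_cases hx : x ∈ Metric.closedBall (0 : Coord n) ρ
      · rw [indicator_of_mem hx]
        by_cases hxk : x ∈ A k <;> simp [hxk]
      · have hcx : c x = 0 := hρ x (by simpa using hx)
        rw [indicator_of_notMem hx]
        by_cases hxk : x ∈ A k <;> simp [hxk, hcx]
    rw [h1, memLp_indicator_iff_restrict Metric.isClosed_closedBall.measurableSet]
    have : IsFiniteMeasure (volume.restrict (Metric.closedBall (0 : Coord n) ρ)) :=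
      isFiniteMeasure_restrict.2 hμ
    refine MemLp.indicator (hAm k) (MemLp.of_bound ?_ (C * ‖v‖) (.of_forall fun x =>
      (c x).le_of_opNorm_le (hC x) v))
    exact (hc.1.apply_continuousLinearMap v).restrict
  choose B hB using fun k => exists_clm_ae_eq (hcA k)
  refine ⟨∑ k ∈ Finset.range N, B k ∘L J (x₀ k), ?_, ?_⟩
  · refine Submodule.finiteDimensional_of_le
      (S₂ := (Finset.range N).sup fun k => LinearMap.range (B k : V →ₗ[ℂ] CoordL2 n W)) ?_
    rintro _ ⟨g, rfl⟩
    have h1 : ((∑ k ∈ Finset.range N, B k ∘L J (x₀ k) : CoordL2 n Z →L[ℂ] CoordL2 n W) :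
        CoordL2 n Z →ₗ[ℂ] CoordL2 n W) g = ∑ k ∈ Finset.range N, B k (J (x₀ k) g) := by
      simp
    rw [h1]
    exact Submodule.sum_mem _ fun k hk =>
      Finset.le_sup (f := fun k => LinearMap.range (B k : V →ₗ[ℂ] CoordL2 n W)) hk ⟨_, rfl⟩
  · refine opNorm_le_of_smooth _ hε.le fun g hg hgs hg2 => ?_
    have hmg : ContDiff ℝ ∞ (fun ξ => m ξ (g ξ)) := contDiff_clm_apply_of_complex hm hg
    have hmgs : HasCompactSupport (fun ξ => m ξ (g ξ)) :=
      hgs.mono fun ξ hξ h0 => hξ (by simp only; rw [h0, map_zero])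
    have hmg2 : MemLp (fun ξ => m ξ (g ξ)) 2 volume :=
      hmg.continuous.memLp_of_hasCompactSupport hmgs
    have hF := memLp_fourierInv hmg hmgs
    have e1 : (invFourier n V : CoordL2 n V →L[ℂ] CoordL2 n V) (mulLp m (hg2.toLp g)) =
        hF.toLp _ := by
      rw [mulLp_toLp (memLp_top_of_hasCompactSupport hm.continuous hms) hg2 hmg2 fun _ => rfl]
      exact (toLp_fourierInv hmg hmgs hmg2 hF).symm
    refine le_trans (b := (C * (D * δ) * ‖hg2.toLp g‖) * ‖χ‖) ?_ ?_
    · refine Lp.norm_le_mul_norm_of_ae_le_mul ?_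
      have e2 : (mulLp c ∘L (invFourier n V : CoordL2 n V →L[ℂ] CoordL2 n V) ∘L mulLp m -
          ∑ k ∈ Finset.range N, B k ∘L J (x₀ k)) (hg2.toLp g) =
          mulLp c (hF.toLp _) - ∑ k ∈ Finset.range N, B k (J (x₀ k) (hg2.toLp g)) := by
        rw [← e1]
        simp
      rw [e2]
      have hBall : ∀ᵐ x ∂(volume : Measure (Coord n)), ∀ k,
          B k (J (x₀ k) (hg2.toLp g)) x = (A k).indicator c x (J (x₀ k) (hg2.toLp g)) :=
        ae_all_iff.2 fun k => hB k _
      filter_upwards [Lp.coeFn_sub (mulLp c (hF.toLp _))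
        (∑ k ∈ Finset.range N, B k (J (x₀ k) (hg2.toLp g))),
        Lp.coeFn_finsetSum (Finset.range N) fun k => B k (J (x₀ k) (hg2.toLp g)),
        coeFn_mulLp hc (hF.toLp _), hF.coeFn_toLp, hBall,
        indicatorConstLp_coeFn (p := 2) (hs := Metric.isClosed_closedBall.measurableSet)
          (hμs := hμ) (c := (1 : ℝ))] with x h1 h2 h3 h4 h5 h6
      rw [h1, Pi.sub_apply, h2, h3, h4, hJF g hg2 x, h6]
      simp only [Finset.sum_apply, h5]
      by_cases hx : x ∈ Metric.closedBall (0 : Coord n) ρ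
      · obtain ⟨k, hk, hxk⟩ := mem_iUnion₂.1 (hN hx)
        rw [Finset.sum_eq_single_of_mem k hk fun j _ hj => ?_, indicator_of_mem hxk, ← map_sub,
          indicator_of_mem hx, norm_one, mul_one]
        · refine ((c x).le_of_opNorm_le (hC x) _).trans ?_
          have hxk' : ‖x - x₀ k‖ ≤ δ := by
            have := disjointed_subset (fun k => Metric.ball (x₀ k) δ) k hxk
            rw [← dist_eq_norm]
            exact (Metric.mem_ball.1 this).le
          calc C * ‖J x (hg2.toLp g) - J (x₀ k) (hg2.toLp g)‖
              ≤ C * (D * ‖x - x₀ k‖ * ‖hg2.toLp g‖) := by gcongr; exact hJ _ _ _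
            _ ≤ C * (D * δ * ‖hg2.toLp g‖) := by gcongr
            _ = _ := by ring
        · have : x ∉ A j := fun hxj => (Set.disjoint_left.1 (hAd hj) hxj) hxk
          rw [indicator_of_notMem this]
          rfl
      · have hcx : c x = 0 := hρ x (by simpa using hx)
        have : ∀ k, (A k).indicator c x = 0 := fun k => by
          by_cases h : x ∈ A k <;> simp [h, hcx]
        simp [this, hcx, indicator_of_notMem hx]
    · calc (C * (D * δ) * ‖hg2.toLp g‖) * ‖χ‖ = (C * (D * δ) * ‖χ‖) * ‖hg2.toLp g‖ := by ring
        _ ≤ ε * ‖hg2.toLp g‖ := by gcongr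

/-- `f ↦ c (F⁻¹ (m f))` is approximable if `c` is bounded with bounded support and `m` is smooth
and tends to `0` at infinity. -/
theorem isApproximable_of_tendsto_zero {c : Coord n → V →L[ℂ] W} (hc : MemLp c ⊤ volume)
    {C ρ : ℝ} (hC : ∀ x, ‖c x‖ ≤ C) (hρ : ∀ x, ρ < ‖x‖ → c x = 0) {m : Coord n → Z →L[ℂ] V}
    (hm : ContDiff ℝ ∞ m) (hm0 : ∀ ε > 0, ∃ R, ∀ ξ, R ≤ ‖ξ‖ → ‖m ξ‖ ≤ ε) :
    IsApproximable (mulLp c ∘L (invFourier n V : CoordL2 n V →L[ℂ] CoordL2 n V) ∘L mulLp m) := by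
  refine IsApproximable.of_forall_approximable fun ε hε => ?_
  have hC0 : 0 ≤ C := (norm_nonneg _).trans (hC 0)
  obtain ⟨R, hR⟩ := hm0 (ε / (C + 1)) (by positivity)
  let η : ContDiffBump (0 : Coord n) := ⟨max R 0 + 1, max R 0 + 2, by positivity, by linarith⟩
  let m₁ : Coord n → Z →L[ℂ] V := fun ξ => η ξ • m ξ
  let m₂ : Coord n → Z →L[ℂ] V := fun ξ => (1 - η ξ) • m ξ
  have hm₁ : ContDiff ℝ ∞ m₁ := η.contDiff.smul hm
  have hm₁s : HasCompactSupport m₁ := η.hasCompactSupport.smul_right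
  have hm₂ : ContDiff ℝ ∞ m₂ := (contDiff_const.sub η.contDiff).smul hm
  have hm₂b : ∀ ξ, ‖m₂ ξ‖ ≤ ε / (C + 1) := by
    intro ξ
    by_cases h : R ≤ ‖ξ‖
    · rw [norm_smul, Real.norm_of_nonneg (by linarith [η.le_one (x := ξ)])]
      refine (mul_le_of_le_one_left (norm_nonneg _) ?_).trans (hR ξ h)
      linarith [η.nonneg (x := ξ)]
    · have h1 : η ξ = 1 := η.one_of_mem_closedBall (by
        simp only [Metric.mem_closedBall, dist_zero_right, η]
        linarith [le_max_left R 0, not_le.1 h])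
      simp only [m₂, h1, sub_self, zero_smul, norm_zero]
      positivity
  have ht₁ := memLp_top_of_hasCompactSupport hm₁.continuous hm₁s
  have ht₂ := memLp_top_of_continuous hm₂.continuous hm₂b
  refine ⟨_, isApproximable_of_hasCompactSupport hc hC hρ hm₁ hm₁s, ?_⟩
  have hsum : ∀ ξ, m ξ = m₁ ξ + m₂ ξ := fun ξ => by simp [m₁, m₂, ← add_smul]
  obtain ⟨C₁, hC₁⟩ := hm₁.continuous.bounded_above_of_compact_support hm₁s
  have ht : MemLp m ⊤ volume := memLp_top_of_continuous hm.continuous (C := C₁ + ε / (C + 1))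
    fun ξ => by rw [hsum]; exact norm_add_le_of_le (hC₁ ξ) (hm₂b ξ)
  have h1 : mulLp c ∘L (invFourier n V : CoordL2 n V →L[ℂ] CoordL2 n V) ∘L mulLp m -
      mulLp c ∘L (invFourier n V : CoordL2 n V →L[ℂ] CoordL2 n V) ∘L mulLp m₁ =
      mulLp c ∘L ((invFourier n V : CoordL2 n V →L[ℂ] CoordL2 n V) ∘L mulLp m₂) := by
    rw [mulLp_add ht ht₁ ht₂ hsum, ContinuousLinearMap.comp_add, ContinuousLinearMap.comp_add,
      add_sub_cancel_left]
  rw [h1]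
  calc _ ≤ ‖mulLp c‖ * ‖(invFourier n V : CoordL2 n V →L[ℂ] CoordL2 n V) ∘L mulLp m₂‖ :=
        ContinuousLinearMap.opNorm_comp_le _ _
    _ ≤ C * (ε / (C + 1)) := by
        gcongr
        · exact norm_mulLp_le hc hC0 hC
        · exact (norm_invFourier_comp_le _).trans (norm_mulLp_le ht₂ (by positivity) hm₂b)
    _ ≤ ε := by
        rw [mul_div_assoc', div_le_iff₀ (by positivity)]
        nlinarith

end Compactness

/-! ### The inverse of an invertible weighted symbol -/

section Symbol

variable {n : ℕ}

/-- The square of a norm on `ℝⁿ` which is homogeneous for the dilations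
`(ξ', ξ'') ↦ (s ξ', s² ξ'')` of the weighted calculus. -/
def weightNormSq (p : ℕ) (ξ : Fin n → ℝ) : ℝ :=
  ∑ i, if i.val < p then ξ i ^ 2 else |ξ i|

/-- The dilation `(ξ', ξ'') ↦ (s ξ', s² ξ'')`. -/
def dilation (p : ℕ) (s : ℝ) (ξ : Fin n → ℝ) : Fin n → ℝ :=
  fun i => (if i.val < p then s else s ^ 2) * ξ i

theorem weightNormSq_term_nonneg (p : ℕ) (ξ : Fin n → ℝ) (i : Fin n) :
    0 ≤ if i.val < p then ξ i ^ 2 else |ξ i| := by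
  split_ifs <;> positivity

theorem weightNormSq_nonneg (p : ℕ) (ξ : Fin n → ℝ) : 0 ≤ weightNormSq p ξ :=
  Finset.sum_nonneg fun i _ => weightNormSq_term_nonneg p ξ i

theorem weightNormSq_term_le (p : ℕ) (ξ : Fin n → ℝ) (i : Fin n) :
    (if i.val < p then ξ i ^ 2 else |ξ i|) ≤ weightNormSq p ξ :=
  Finset.single_le_sum (f := fun i : Fin n => if i.val < p then ξ i ^ 2 else |ξ i|)
    (fun i _ => weightNormSq_term_nonneg p ξ i) (Finset.mem_univ i)

theorem weightNormSq_pos (p : ℕ) {ξ : Fin n → ℝ} (h : ξ ≠ 0) : 0 < weightNormSq p ξ := by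
  obtain ⟨i, hi⟩ := Function.ne_iff.1 h
  refine lt_of_lt_of_le ?_ (weightNormSq_term_le p ξ i)
  simp only [Pi.zero_apply] at hi
  split_ifs <;> positivity

theorem continuous_weightNormSq (p : ℕ) : Continuous (weightNormSq p : (Fin n → ℝ) → ℝ) := by
  unfold weightNormSq
  refine continuous_finsetSum _ fun i _ => ?_
  split_ifs <;> fun_prop

theorem weightNormSq_dilation (p : ℕ) (s : ℝ) (ξ : Fin n → ℝ) :
    weightNormSq p (dilation p s ξ) = s ^ 2 * weightNormSq p ξ := by
  rw [weightNormSq, weightNormSq, Finset.mul_sum]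
  refine Finset.sum_congr rfl fun i _ => ?_
  simp only [dilation]
  split_ifs
  · ring
  · rw [abs_mul, abs_of_nonneg (by positivity)]

theorem dilation_dilation (p : ℕ) (s t : ℝ) (ξ : Fin n → ℝ) :
    dilation p s (dilation p t ξ) = dilation p (s * t) ξ := by
  funext i
  simp only [dilation]
  split_ifs <;> ring

theorem dilation_one (p : ℕ) (ξ : Fin n → ℝ) : dilation p 1 ξ = ξ := by
  funext i
  simp [dilation]

theorem wordMonomial_dilation (p : ℕ) (s : ℝ) (l : List (Fin n)) (ξ : Fin n → ℝ) :
    wordMonomial l (dilation p s ξ) = (s : ℂ) ^ wordWeight p l * wordMonomial l ξ := by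
  induction l with
  | nil => simp
  | cons i l ih =>
    rw [wordMonomial_cons, wordMonomial_cons, wordWeight_cons, ih, pow_add, dilation]
    split_ifs <;> push_cast <;> ring

theorem abs_le_one_of_weightNormSq_eq_one {p : ℕ} {ξ : Fin n → ℝ} (h : weightNormSq p ξ = 1)
    (i : Fin n) : |ξ i| ≤ 1 := by
  have := weightNormSq_term_le p ξ i
  rw [h] at this
  split_ifs at this
  · exact (sq_le_one_iff_abs_le_one _).1 this
  · exact this

theorem norm_wordMonomial_le_one (l : List (Fin n)) {ξ : Fin n → ℝ} (h : ∀ i, |ξ i| ≤ 1) :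
    ‖wordMonomial l ξ‖ ≤ 1 := by
  induction l with
  | nil => simp
  | cons i l ih =>
    rw [wordMonomial_cons, norm_mul, norm_mul, Complex.norm_I, one_mul, Complex.norm_real,
      Real.norm_eq_abs]
    exact mul_le_one₀ (h i) (norm_nonneg _) ih

theorem isCompact_weightNormSq_eq_one (p : ℕ) :
    IsCompact {ξ : Fin n → ℝ | weightNormSq p ξ = 1} := by
  refine (isCompact_closedBall (0 : Fin n → ℝ) 1).of_isClosed_subset
    (isClosed_singleton.preimage (continuous_weightNormSq p)) fun ξ hξ => ?_
  rw [mem_closedBall_zero_iff]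
  exact (pi_norm_le_iff_of_nonneg zero_le_one).2 fun i => abs_le_one_of_weightNormSq_eq_one hξ i

theorem norm_le_of_weightNormSq_freq_le (p : ℕ) {ξ : Coord n} {s : ℝ} (hs : 1 ≤ s)
    (h : weightNormSq p (freq ξ) ≤ s ^ 2) : ‖ξ‖ ≤ (n + 1) * s ^ 2 := by
  have hi : ∀ i, ‖ξ i‖ ≤ s ^ 2 := by
    intro i
    have h1 : |freq ξ i| ≤ s ^ 2 := by
      have := (weightNormSq_term_le p (freq ξ) i).trans h
      split_ifs at this
      · exact (abs_le_of_sq_le_sq this (by linarith)).trans (by nlinarith)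
      · exact this
    refine le_trans ?_ h1
    rw [freq, abs_mul, abs_of_pos (by positivity : 0 < 2 * Real.pi), Real.norm_eq_abs]
    exact le_mul_of_one_le_left (abs_nonneg _) (by linarith [Real.pi_gt_three])
  rw [EuclideanSpace.norm_eq]
  refine Real.sqrt_le_iff.2 ⟨by positivity, ?_⟩
  calc ∑ i, ‖ξ i‖ ^ 2 ≤ ∑ _i : Fin n, (s ^ 2) ^ 2 :=
        Finset.sum_le_sum fun i _ => pow_le_pow_left₀ (norm_nonneg _) (hi i) 2
    _ = n * (s ^ 2) ^ 2 := by simp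
    _ ≤ ((n + 1) * s ^ 2) ^ 2 := by
        rw [mul_pow]
        refine mul_le_mul_of_nonneg_right ?_ (by positivity)
        have : (0 : ℝ) ≤ n := by positivity
        nlinarith

variable {V W : Type*} [NormedAddCommGroup V] [NormedSpace ℂ V] [CompleteSpace V]
  [NormedAddCommGroup W] [NormedSpace ℂ W] {ι : Type*} [Fintype ι]

theorem contDiff_wordSymbol (p d : ℕ) (a : ι → Coord n → V →L[ℂ] W) (l : ι → List (Fin n))
    (y : Coord n) : ContDiff ℝ ∞ (fun ξ => wordSymbol p d a l y (freq ξ)) :=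
  ContDiff.sum fun t _ => (contDiff_wordMonomial_freq (l t)).smul contDiff_const

theorem continuous_wordMonomial (l : List (Fin n)) : Continuous (wordMonomial l) := by
  induction l with
  | nil => exact continuous_const
  | cons i l ih =>
    change Continuous fun ξ => wordMonomial (i :: l) ξ
    simp only [wordMonomial_cons]
    fun_prop

theorem continuous_wordSymbol (p d : ℕ) (a : ι → Coord n → V →L[ℂ] W) (l : ι → List (Fin n))
    (y : Coord n) : Continuous (wordSymbol p d a l y) :=
  continuous_finsetSum _ fun t _ => (continuous_wordMonomial (l t)).smul continuous_const

theorem wordSymbol_dilation (p d : ℕ) (a : ι → Coord n → V →L[ℂ] W) (l : ι → List (Fin n))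
    (y : Coord n) (s : ℝ) (ξ : Fin n → ℝ) :
    wordSymbol p d a l y (dilation p s ξ) = ((s : ℂ) ^ d) • wordSymbol p d a l y ξ := by
  rw [wordSymbol, wordSymbol, Finset.smul_sum]
  refine Finset.sum_congr rfl fun t ht => ?_
  rw [wordMonomial_dilation, (Finset.mem_filter.1 ht).2, mul_smul]

theorem norm_inverse_smul_le {f : V →L[ℂ] W} (hf : f.IsInvertible) {c : ℂ} (hc : c ≠ 0) :
    ‖(c • f).inverse‖ ≤ ‖c‖⁻¹ * ‖f.inverse‖ := by
  have hcf : (c • f).inverse = c⁻¹ • f.inverse := by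
    have h1 : (c • f) ∘L (c⁻¹ • f.inverse) = .id ℂ W := by
      rw [ContinuousLinearMap.smul_comp, ContinuousLinearMap.comp_smul, hf.self_comp_inverse,
        smul_smul, mul_inv_cancel₀ hc, one_smul]
    have h2 : (c⁻¹ • f.inverse) ∘L (c • f) = .id ℂ V := by
      rw [ContinuousLinearMap.smul_comp, ContinuousLinearMap.comp_smul, hf.inverse_comp_self,
        smul_smul, inv_mul_cancel₀ hc, one_smul]
    exact ContinuousLinearMap.inverse_eq h1 h2
  rw [hcf, norm_smul, norm_inv]

/-- The weighted homogeneity of the symbol, and compactness of the weighted unit sphere, give the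
expected decay of the inverse of the symbol. -/
theorem exists_bound_inverse_wordSymbol (p d : ℕ) (a : ι → Coord n → V →L[ℂ] W)
    (l : ι → List (Fin n)) (y : Coord n)
    (h : ∀ ξ : Fin n → ℝ, ξ ≠ 0 → (wordSymbol p d a l y ξ).IsInvertible) :
    ∃ C : ℝ, 0 ≤ C ∧ ∀ (k : List (Fin n)) (ξ : Fin n → ℝ), ξ ≠ 0 →
      ‖wordMonomial k ξ‖ * ‖(wordSymbol p d a l y ξ).inverse‖ ≤
        C * (√(weightNormSq p ξ) ^ wordWeight p k / √(weightNormSq p ξ) ^ d) := by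
  have hne : ∀ ξ : Fin n → ℝ, weightNormSq p ξ = 1 → ξ ≠ 0 := by
    rintro ξ hξ rfl
    simp [weightNormSq] at hξ
  obtain ⟨C, hC⟩ := (isCompact_weightNormSq_eq_one (n := n) p).exists_bound_of_continuousOn
    (f := fun ξ => (wordSymbol p d a l y ξ).inverse) (fun ξ hξ => by
      obtain ⟨e, he⟩ := h ξ (hne ξ hξ)
      refine ContinuousAt.continuousWithinAt ?_
      have h1 : ContinuousAt ContinuousLinearMap.inverse (wordSymbol p d a l y ξ) := by
        rw [← he]
        exact (contDiffAt_map_inverse (n := 0) e).continuousAt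
      exact h1.comp (f := wordSymbol p d a l y) (continuous_wordSymbol p d a l y).continuousAt)
  refine ⟨max C 0, le_max_right _ _, fun k ξ hξ => ?_⟩
  set s := √(weightNormSq p ξ) with hs
  have hs0 : 0 < s := Real.sqrt_pos.2 (weightNormSq_pos p hξ)
  set θ := dilation p s⁻¹ ξ with hθ
  have hθ1 : weightNormSq p θ = 1 := by
    rw [hθ, weightNormSq_dilation, hs, inv_pow,
      Real.sq_sqrt (weightNormSq_nonneg p ξ), inv_mul_cancel₀ (weightNormSq_pos p hξ).ne']
  have hξθ : ξ = dilation p s θ := by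
    rw [hθ, dilation_dilation, mul_inv_cancel₀ hs0.ne', dilation_one]
  have hsn : ∀ k : ℕ, ‖(s : ℂ) ^ k‖ = s ^ k := fun k => by
    rw [norm_pow, Complex.norm_real, Real.norm_of_nonneg hs0.le]
  have h1 : ‖wordMonomial k ξ‖ ≤ s ^ wordWeight p k := by
    rw [hξθ, wordMonomial_dilation, norm_mul, hsn]
    exact mul_le_of_le_one_right (by positivity)
      (norm_wordMonomial_le_one k fun i => abs_le_one_of_weightNormSq_eq_one hθ1 i)
  have h2 : ‖(wordSymbol p d a l y ξ).inverse‖ ≤ (s ^ d)⁻¹ * max C 0 := by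
    rw [hξθ, wordSymbol_dilation]
    refine (norm_inverse_smul_le (h θ (hne θ hθ1)) (pow_ne_zero d
      (Complex.ofReal_ne_zero.2 hs0.ne'))).trans ?_
    rw [hsn]
    gcongr
    exact (hC θ hθ1).trans (le_max_left _ _)
  calc _ ≤ s ^ wordWeight p k * ((s ^ d)⁻¹ * max C 0) := by gcongr
    _ = _ := by ring

/-- A smooth approximate inverse `q` of an invertible weighted symbol: it agrees with the inverse
of the symbol at high frequencies, and is cut off at low frequencies by means of `η`. The larger
`s` is, the more low frequencies are cut off, and the smaller are the products of `q` with
monomials of weight less than `d`. -/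
theorem exists_approximate_inverse_symbol (p d : ℕ) (a : ι → Coord n → V →L[ℂ] W)
    (l : ι → List (Fin n)) (y : Coord n)
    (h : ∀ ξ : Fin n → ℝ, ξ ≠ 0 → (wordSymbol p d a l y ξ).IsInvertible) :
    ∃ C : ℝ, 0 ≤ C ∧ ∀ s : ℝ, 1 ≤ s → ∃ (q : Coord n → W →L[ℂ] V) (η : Coord n → ℝ),
      ContDiff ℝ ∞ q ∧ ContDiff ℝ ∞ η ∧ HasCompactSupport η ∧
      (∀ ξ, wordSymbol p d a l y (freq ξ) ∘L q ξ = (1 - η ξ) • ContinuousLinearMap.id ℂ W) ∧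
      (∀ k, wordWeight p k ≤ d → ∀ ξ, ‖wordMonomial k (freq ξ) • q ξ‖ ≤ C) ∧
      (∀ k, wordWeight p k < d → ∀ ξ, ‖wordMonomial k (freq ξ) • q ξ‖ ≤ C / s) ∧
      (∀ k, wordWeight p k < d → ∀ ε > 0, ∃ R, ∀ ξ : Coord n, R ≤ ‖ξ‖ →
        ‖wordMonomial k (freq ξ) • q ξ‖ ≤ ε) := by
  obtain ⟨C, hC0, hC⟩ := exists_bound_inverse_wordSymbol p d a l y h
  refine ⟨C, hC0, fun s hs => ?_⟩
  let η : ContDiffBump (0 : Coord n) := ⟨(n + 1) * s ^ 2, (n + 1) * s ^ 2 + 1, by positivity,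
    by linarith⟩
  let q : Coord n → W →L[ℂ] V := fun ξ => (1 - η ξ) • (wordSymbol p d a l y (freq ξ)).inverse
  have hlow : ∀ ξ : Coord n, ‖ξ‖ ≤ (n + 1) * s ^ 2 → η ξ = 1 := fun ξ hξ =>
    η.one_of_mem_closedBall (by simpa [η] using hξ)
  have hbound : ∀ (k : List (Fin n)) (t : ℝ), 1 ≤ t → ∀ ξ : Coord n, η ξ ≠ 1 →
      t ^ 2 ≤ weightNormSq p (freq ξ) → ∀ j, wordWeight p k + j ≤ d →
      ‖wordMonomial k (freq ξ) • q ξ‖ ≤ C / t ^ j := by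
    intro k t ht ξ hη htξ j hj
    have hξ : ξ ≠ 0 := by
      rintro rfl
      exact hη (hlow 0 (by rw [norm_zero]; positivity))
    set N := √(weightNormSq p (freq ξ))
    have hN : t ≤ N := Real.le_sqrt_of_sq_le htξ
    have hN0 : 0 < N := by linarith
    rw [norm_smul, norm_smul, Real.norm_of_nonneg (by linarith [η.le_one (x := ξ)])]
    calc ‖wordMonomial k (freq ξ)‖ * ((1 - η ξ) * ‖(wordSymbol p d a l y (freq ξ)).inverse‖)
        ≤ ‖wordMonomial k (freq ξ)‖ * ‖(wordSymbol p d a l y (freq ξ)).inverse‖ := by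
          gcongr
          exact mul_le_of_le_one_left (norm_nonneg _) (by linarith [η.nonneg (x := ξ)])
      _ ≤ C * (N ^ wordWeight p k / N ^ d) := hC k _ (freq_ne_zero hξ)
      _ ≤ C * (1 / t ^ j) := by
          refine mul_le_mul_of_nonneg_left ?_ hC0
          rw [div_le_div_iff₀ (by positivity) (by positivity), one_mul]
          calc N ^ wordWeight p k * t ^ j ≤ N ^ wordWeight p k * N ^ j := by gcongr
            _ = N ^ (wordWeight p k + j) := (pow_add _ _ _).symm
            _ ≤ N ^ d := pow_le_pow_right₀ (by linarith) hj
      _ = C / t ^ j := by ring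
  have hzero : ∀ (k : List (Fin n)) (ξ : Coord n), η ξ = 1 →
      ‖wordMonomial k (freq ξ) • q ξ‖ = 0 := fun k ξ hη => by simp [q, hη]
  have hhigh : ∀ ξ : Coord n, η ξ ≠ 1 → s ^ 2 ≤ weightNormSq p (freq ξ) := by
    intro ξ hη
    by_contra hlt
    exact hη (hlow ξ (norm_le_of_weightNormSq_freq_le p hs (not_le.1 hlt).le))
  refine ⟨q, η, ?_, η.contDiff, η.hasCompactSupport, ?_, ?_, ?_, ?_⟩
  · refine contDiff_iff_contDiffAt.2 fun ξ => ?_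
    by_cases hξ : ξ = 0
    · have h1 : q =ᶠ[𝓝 ξ] fun _ => 0 := by
        have h2 : Metric.ball (0 : Coord n) ((n + 1) * s ^ 2) ∈ 𝓝 ξ := by
          rw [hξ]; exact Metric.ball_mem_nhds _ (by positivity)
        filter_upwards [h2] with ζ hζ
        simp [q, hlow ζ (by simpa using (Metric.mem_ball.1 hζ).le)]
      exact contDiffAt_const.congr_of_eventuallyEq h1
    · refine (contDiff_const.sub η.contDiff).contDiffAt.smul ?_
      obtain ⟨e, he⟩ := h (freq ξ) (freq_ne_zero hξ)
      have h1 : ContDiffAt ℝ ∞ ContinuousLinearMap.inverse (wordSymbol p d a l y (freq ξ)) := by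
        rw [← he]
        exact (contDiffAt_map_inverse e).restrict_scalars ℝ
      exact h1.comp ξ (contDiff_wordSymbol p d a l y).contDiffAt
  · intro ξ
    by_cases hξ : ξ = 0
    · have : η ξ = 1 := hlow ξ (by rw [hξ, norm_zero]; positivity)
      simp [q, this]
    · simp only [q]
      rw [ContinuousLinearMap.comp_smul, (h _ (freq_ne_zero hξ)).self_comp_inverse]
  · intro k hk ξ
    by_cases hη : η ξ = 1
    · rw [hzero k ξ hη]; exact hC0
    · simpa using hbound k s hs ξ hη (hhigh ξ hη) 0 (by omega)
  · intro k hk ξ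
    by_cases hη : η ξ = 1
    · rw [hzero k ξ hη]; positivity
    · simpa using hbound k s hs ξ hη (hhigh ξ hη) 1 (by omega)
  · intro k hk ε hε
    set t := max 1 (C / ε)
    refine ⟨(n + 1) * t ^ 2 + 1, fun ξ hR => ?_⟩
    by_cases hη : η ξ = 1
    · rw [hzero k ξ hη]; exact hε.le
    · have ht : t ^ 2 ≤ weightNormSq p (freq ξ) := by
        by_contra hlt
        have := norm_le_of_weightNormSq_freq_le p (le_max_left 1 (C / ε)) (not_le.1 hlt).le
        linarith
      refine (hbound k t (le_max_left _ _) ξ hη ht 1 (by omega)).trans ?_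
      have h0 : 0 < t := lt_of_lt_of_le one_pos (le_max_left _ _)
      rw [pow_one, div_le_iff₀ h0, ← div_le_iff₀' hε]
      exact le_max_right _ _

end Symbol

/-! ### The local right parametrix -/

section Commutator

variable {n : ℕ} {V W : Type*} [NormedAddCommGroup V] [NormedSpace ℂ V]
  [NormedAddCommGroup W] [NormedSpace ℂ W]

variable (V) in
/-- A real function, as a function with values in the multiples of the identity of `V`. -/
def smulId (φ : Coord n → ℝ) (x : Coord n) : V →L[ℂ] V := φ x • ContinuousLinearMap.id ℂ V

@[simp] theorem smulId_apply (φ : Coord n → ℝ) (x : Coord n) (v : V) :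
    smulId V φ x v = φ x • v := rfl

theorem contDiff_smulId {φ : Coord n → ℝ} (hφ : ContDiff ℝ ∞ φ) : ContDiff ℝ ∞ (smulId V φ) :=
  hφ.smul contDiff_const

theorem tsupport_smulId_subset (φ : Coord n → ℝ) : tsupport (smulId V φ) ⊆ tsupport φ :=
  closure_mono fun x hx h0 => hx (by simp [smulId, h0])

theorem hasCompactSupport_smulId {φ : Coord n → ℝ} (hφ : HasCompactSupport φ) :
    HasCompactSupport (smulId V φ) :=
  hφ.mono' (subset_closure.trans (tsupport_smulId_subset φ))

/-- The commutator of a differential operator with a cutoff `φ` is a differential operator of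
smaller weighted order, with coefficients supported in the support of `φ`. -/
theorem exists_wordOp_smul (p d : ℕ) {ι : Type} [Fintype ι] {a : ι → Coord n → V →L[ℂ] W}
    (ha : ∀ t, ContDiff ℝ ∞ (a t)) {l : ι → List (Fin n)} (hl : ∀ t, wordWeight p (l t) ≤ d)
    {φ : Coord n → ℝ} (hφ : ContDiff ℝ ∞ φ) :
    ∃ (κ : Type) (_ : Fintype κ) (c : κ → Coord n → V →L[ℂ] W) (m : κ → List (Fin n)),
      (∀ t, ContDiff ℝ ∞ (c t)) ∧ (∀ t, tsupport (c t) ⊆ tsupport φ) ∧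
      (∀ t, wordWeight p (m t) < d) ∧ ∀ f : Coord n → V, ContDiff ℝ ∞ f → ∀ y,
        wordOp a l (fun y => φ y • f y) y = φ y • wordOp a l f y + wordOp c m f y := by
  choose κ inst c m hc hcs hm h using
    fun t => exists_wordDeriv_clm_apply p (contDiff_smulId (V := V) hφ) (l t)
  refine ⟨Σ t, κ t, inferInstance, fun t y => a t.1 y ∘L c t.1 t.2 y, fun t => m t.1 t.2,
    ?_, ?_, ?_, ?_⟩
  · rintro ⟨t, j⟩
    exact (ContinuousLinearMap.compL ℂ V V W).isBoundedBilinearMap.contDiff.restrict_scalars ℝ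
      |>.comp ((ha t).prodMk (hc t j))
  · rintro ⟨t, j⟩
    have h1 : Function.support (fun y => a t y ∘L c t j y) ⊆ Function.support (c t j) :=
      fun y hy h0 => hy (by simp only [h0, ContinuousLinearMap.comp_zero])
    exact (closure_mono h1).trans ((hcs t j).trans (tsupport_smulId_subset φ))
  · rintro ⟨t, j⟩
    exact (hm t j).trans_le (hl t)
  · intro f hf y
    simp only [wordOp, Fintype.sum_sigma, Finset.smul_sum]
    rw [← Finset.sum_add_distrib]
    refine Finset.sum_congr rfl fun t _ => ?_
    have h1 : wordDeriv (l t) (fun y => φ y • f y) y =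
      φ y • wordDeriv (l t) f y + wordOp (c t) (m t) f y := h t f hf y
    rw [h1, map_add, wordOp, map_sum]
    congr 1
    rw [← Complex.coe_smul, ← Complex.coe_smul, map_smul]

end Commutator

section Parametrix

variable {n : ℕ} {V W : Type*} [NormedAddCommGroup V] [InnerProductSpace ℂ V]
  [FiniteDimensional ℂ V] [NormedAddCommGroup W] [InnerProductSpace ℂ W] [FiniteDimensional ℂ W]

/-- On the Fourier side, `∂^k q(D)` is multiplication by `(iξ)^k q(ξ)`. -/
theorem invFourier_mulLp_ae_eq {q : Coord n → W →L[ℂ] V} (hq : ContDiff ℝ ∞ q)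
    (k : List (Fin n)) {C : ℝ} (hC : ∀ ξ, ‖wordMonomial k (freq ξ) • q ξ‖ ≤ C)
    {g : Coord n → W} (hg : ContDiff ℝ ∞ g) (hgs : HasCompactSupport g)
    (hg2 : MemLp g 2 volume) :
    invFourier n V (mulLp (fun ξ => wordMonomial k (freq ξ) • q ξ) (hg2.toLp g))
      =ᵐ[volume] wordDeriv k (𝓕⁻ (fun ξ => q ξ (g ξ))) := by
  have h1 : ContDiff ℝ ∞ (fun ξ => q ξ (g ξ)) := contDiff_clm_apply_of_complex hq hg
  have h2 : HasCompactSupport (fun ξ => q ξ (g ξ)) :=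
    hgs.mono fun ξ hξ h0 => hξ (by simp only; rw [h0, map_zero])
  have h3 := contDiff_wordMonomial_smul h1 k
  have h4 := hasCompactSupport_wordMonomial_smul h2 k
  have h5 : MemLp (fun ξ => wordMonomial k (freq ξ) • q ξ (g ξ)) 2 volume :=
    h3.continuous.memLp_of_hasCompactSupport h4
  have h6 := memLp_fourierInv h3 h4
  have h7 : Continuous (fun ξ => wordMonomial k (freq ξ) • q ξ) :=
    ((contDiff_wordMonomial_freq k).smul hq).continuous
  rw [wordDeriv_fourierInv h1 h2,
    mulLp_toLp (memLp_top_of_continuous h7 hC) hg2 h5 fun ξ => rfl, ← toLp_fourierInv h3 h4 h5 h6]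
  exact h6.coeFn_toLp

/-- Inverse Fourier transforms of smooth functions with compact support commute with linear maps
and finite sums. -/
theorem fourierInv_sum_clm {ι : Type*} (s : Finset ι) (a : ι → V →L[ℂ] W)
    {g : ι → Coord n → V} (hg : ∀ t, Continuous (g t)) (hgs : ∀ t, HasCompactSupport (g t))
    (x : Coord n) :
    𝓕⁻ (fun ξ => ∑ t ∈ s, a t (g t ξ)) x = ∑ t ∈ s, a t (𝓕⁻ (g t) x) := by
  have hint : ∀ t, Integrable (fun ξ => Complex.exp
      (((2 * Real.pi * inner ℝ ξ x : ℝ) : ℂ) * Complex.I) • g t ξ) := by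
    intro t
    refine Continuous.integrable_of_hasCompactSupport (Continuous.smul ?_ (hg t))
      ((hgs t).mono fun ξ hξ h0 => hξ (by simp only; rw [h0, smul_zero]))
    exact Complex.continuous_exp.comp ((Complex.continuous_ofReal.comp
      (continuous_const.mul (continuous_id.inner continuous_const))).mul continuous_const)
  simp only [Real.fourierInv_eq']
  have h1 : ∀ t, a t (∫ ξ, Complex.exp
      (((2 * Real.pi * inner ℝ ξ x : ℝ) : ℂ) * Complex.I) • g t ξ) =
      ∫ ξ, a t (Complex.exp
      (((2 * Real.pi * inner ℝ ξ x : ℝ) : ℂ) * Complex.I) • g t ξ) := fun t =>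
    ((a t).integral_comp_comm (hint t)).symm
  simp only [h1]
  rw [← integral_finsetSum s fun t _ => (a t).integrable_comp (hint t)]
  refine integral_congr_ae (.of_forall fun ξ => ?_)
  simp only [Finset.smul_sum, map_smul]

/-- The frozen operator `∑ₜ aₜ(y) ∂^{lₜ}`, `lₜ` of weight `d`, applied to the inverse Fourier
transform of `q g`, where `q` is an approximate inverse of its symbol. -/
theorem invFourier_sub_ae_eq {ι : Type} [Fintype ι] {p d : ℕ} {a : ι → Coord n → V →L[ℂ] W}
    {l : ι → List (Fin n)} {y : Coord n} {q : Coord n → W →L[ℂ] V} (hq : ContDiff ℝ ∞ q)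
    {η : Coord n → ℝ} (hη : ContDiff ℝ ∞ η) (hηs : HasCompactSupport η)
    (hqη : ∀ ξ, wordSymbol p d a l y (freq ξ) ∘L q ξ = (1 - η ξ) • ContinuousLinearMap.id ℂ W)
    {g : Coord n → W} (hg : ContDiff ℝ ∞ g) (hgs : HasCompactSupport g)
    (hg2 : MemLp g 2 volume) :
    invFourier n W (hg2.toLp g - mulLp (smulId W η) (hg2.toLp g)) =ᵐ[volume] fun x =>
      ∑ t with wordWeight p (l t) = d, a t y (wordDeriv (l t) (𝓕⁻ (fun ξ => q ξ (g ξ))) x) := by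
  have h1 : ContDiff ℝ ∞ (fun ξ => q ξ (g ξ)) := contDiff_clm_apply_of_complex hq hg
  have h2 : HasCompactSupport (fun ξ => q ξ (g ξ)) :=
    hgs.mono fun ξ hξ h0 => hξ (by simp only; rw [h0, map_zero])
  let g₁ : Coord n → W := fun ξ => (1 - η ξ) • g ξ
  have h3 : ContDiff ℝ ∞ g₁ := (contDiff_const.sub hη).smul hg
  have h4 : HasCompactSupport g₁ := hgs.smul_left
  have h5 : MemLp g₁ 2 volume := h3.continuous.memLp_of_hasCompactSupport h4
  have h6 := memLp_fourierInv h3 h4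
  have e1 : hg2.toLp g - mulLp (smulId W η) (hg2.toLp g) = h5.toLp g₁ := by
    have h7 : MemLp (fun ξ => η ξ • g ξ) 2 volume :=
      (hη.smul hg).continuous.memLp_of_hasCompactSupport hgs.smul_left
    rw [mulLp_toLp (memLp_top_of_hasCompactSupport (contDiff_smulId hη).continuous
      (hasCompactSupport_smulId hηs)) hg2 h7 fun ξ => rfl, ← MemLp.toLp_sub]
    refine MemLp.toLp_congr _ _ (.of_forall fun ξ => ?_)
    simp [g₁, sub_smul]
  have e2 : g₁ = fun ξ => ∑ t with wordWeight p (l t) = d,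
      a t y (wordMonomial (l t) (freq ξ) • q ξ (g ξ)) := by
    funext ξ
    have := congrArg (fun T : W →L[ℂ] W => T (g ξ)) (hqη ξ)
    simp only [ContinuousLinearMap.comp_apply, wordSymbol, sum_apply, smul_apply] at this
    simp only [map_smul]
    exact this.symm
  rw [e1, ← toLp_fourierInv h3 h4 h5 h6]
  filter_upwards [h6.coeFn_toLp] with x hx
  rw [hx, e2, fourierInv_sum_clm _ (fun t => a t y)
    (fun t => (contDiff_wordMonomial_smul h1 (l t)).continuous)
    (fun t => hasCompactSupport_wordMonomial_smul h2 (l t))]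
  exact Finset.sum_congr rfl fun t _ => by rw [wordDeriv_fourierInv h1 h2]

/-- The Neumann series for a perturbation of the inverse Fourier transform. -/
theorem exists_equiv_add_of_norm_le {S : CoordL2 n W →L[ℂ] CoordL2 n W} (hS : ‖S‖ ≤ 1 / 2) :
    ∃ e : CoordL2 n W ≃L[ℂ] CoordL2 n W, ∀ g, e g = invFourier n W g + S g := by
  let S' : CoordL2 n W →L[ℂ] CoordL2 n W :=
    ((invFourier n W).symm : CoordL2 n W →L[ℂ] CoordL2 n W) ∘L S
  have hS' : ‖-S'‖ < 1 := by
    rw [norm_neg]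
    refine lt_of_le_of_lt (ContinuousLinearMap.opNorm_le_bound _ (by norm_num : (0 : ℝ) ≤ 1 / 2)
      fun g => ?_) (by norm_num : (1 / 2 : ℝ) < 1)
    change ‖(invFourier n W).symm (S g)‖ ≤ _
    rw [norm_invFourier_symm_apply]
    exact S.le_of_opNorm_le hS g
  let e₁ : CoordL2 n W ≃L[ℂ] CoordL2 n W := ContinuousLinearEquiv.ofUnit (Units.oneSub (-S') hS')
  refine ⟨e₁.trans (invFourier n W), fun g => ?_⟩
  have h1 : e₁ g = g + S' g := by
    change (1 - -S') g = _
    rw [sub_neg_eq_add, add_apply]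
    rfl
  rw [ContinuousLinearEquiv.trans_apply, h1, map_add]
  congr 1
  exact (invFourier n W).apply_symm_apply (S g)

variable {ι : Type} [Fintype ι]

/-- The coefficients of the difference, on the ball of radius `r` about `y`, of `∑ₜ aₜ ∂^{lₜ}` and
its principal part frozen at `y`. -/
def frozenError (p d : ℕ) (a : ι → Coord n → V →L[ℂ] W) (l : ι → List (Fin n)) (y : Coord n)
    (r : ℝ) (t : ι) : Coord n → V →L[ℂ] W :=
  (Metric.closedBall y r).indicator
    fun x => a t x - if wordWeight p (l t) = d then a t y else 0

/-- On a small ball, the coefficients of the difference are bounded, and the leading ones are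
small by continuity. -/
theorem exists_norm_frozenError_le (p d : ℕ) {a : ι → Coord n → V →L[ℂ] W}
    (ha : ∀ t, ContDiff ℝ ∞ (a t)) (l : ι → List (Fin n)) (y : Coord n) {δ : ℝ} (hδ : 0 < δ) :
    ∃ r > 0, ∃ C, 0 ≤ C ∧ (∀ t x, ‖frozenError p d a l y r t x‖ ≤ C) ∧
      ∀ t, wordWeight p (l t) = d → ∀ x, ‖frozenError p d a l y r t x‖ ≤ δ := by
  have h1 : ∀ᶠ x in 𝓝 y, ∀ t, ‖a t x - a t y‖ ≤ δ := by
    rw [Filter.eventually_all]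
    intro t
    have h := (ha t).continuous.tendsto y
    filter_upwards [h (Metric.closedBall_mem_nhds _ hδ)] with x hx
    simpa [dist_eq_norm] using hx
  obtain ⟨r, hr, h2⟩ := Metric.nhds_basis_closedBall.mem_iff.1 h1
  have h3 : ∀ t, ∃ C, ∀ x ∈ Metric.closedBall y r,
      ‖a t x - if wordWeight p (l t) = d then a t y else 0‖ ≤ C := fun t =>
    (isCompact_closedBall y r).exists_bound_of_continuousOn
      ((ha t).continuous.sub continuous_const).continuousOn
  choose C hC using h3
  refine ⟨r, hr, ∑ t, |C t|, by positivity, fun t x => ?_, fun t ht x => ?_⟩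
  · by_cases hx : x ∈ Metric.closedBall y r
    · rw [frozenError, indicator_of_mem hx]
      exact (hC t x hx).trans ((le_abs_self _).trans
        (Finset.single_le_sum (f := fun t => |C t|) (fun _ _ => abs_nonneg _) (Finset.mem_univ t)))
    · rw [frozenError, indicator_of_notMem hx, norm_zero]
      positivity
  · by_cases hx : x ∈ Metric.closedBall y r
    · rw [frozenError, indicator_of_mem hx, if_pos ht]
      exact h2 hx t
    · rw [frozenError, indicator_of_notMem hx, norm_zero]
      exact hδ.le

theorem memLp_frozenError {p d : ℕ} {a : ι → Coord n → V →L[ℂ] W}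
    (ha : ∀ t, ContDiff ℝ ∞ (a t)) (l : ι → List (Fin n)) (y : Coord n) (r : ℝ) {C : ℝ} {t : ι}
    (hC : ∀ x, ‖frozenError p d a l y r t x‖ ≤ C) :
    MemLp (frozenError p d a l y r t) ⊤ volume :=
  memLp_top_of_bound (((ha t).continuous.sub continuous_const).aestronglyMeasurable.indicator
    Metric.isClosed_closedBall.measurableSet) C (.of_forall hC)

/-- The composition `∂^k q(D)`, where `q(D)` is the Fourier multiplier with symbol `q`, preceded by
the Fourier transform: it acts on the Fourier side. -/
def multiplierOp (q : Coord n → W →L[ℂ] V) (k : List (Fin n)) : CoordL2 n W →L[ℂ] CoordL2 n V :=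
  (invFourier n V : CoordL2 n V →L[ℂ] CoordL2 n V) ∘L
    mulLp (fun ξ => wordMonomial k (freq ξ) • q ξ)

theorem norm_multiplierOp_le {q : Coord n → W →L[ℂ] V} (hq : ContDiff ℝ ∞ q) (k : List (Fin n))
    {D : ℝ} (hD : 0 ≤ D) (h : ∀ ξ, ‖wordMonomial k (freq ξ) • q ξ‖ ≤ D) :
    ‖multiplierOp q k‖ ≤ D := by
  have hc : Continuous (fun ξ => wordMonomial k (freq ξ) • q ξ) :=
    ((contDiff_wordMonomial_freq k).smul hq).continuous
  exact (norm_invFourier_comp_le _).trans (norm_mulLp_le (memLp_top_of_continuous hc h) hD h)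

/-- The error `∑ₜ bₜ ∂^{lₜ} q(D)` made by freezing `∑ₜ aₜ ∂^{lₜ}` at `y`. -/
def errorOp (p d : ℕ) (a : ι → Coord n → V →L[ℂ] W) (l : ι → List (Fin n)) (y : Coord n) (r : ℝ)
    (q : Coord n → W →L[ℂ] V) : CoordL2 n W →L[ℂ] CoordL2 n W :=
  ∑ t, mulLp (frozenError p d a l y r t) ∘L multiplierOp q (l t)

/-- The terms of top weight are small since their coefficients are (`B' * C`), the others since `q`
decays faster than they grow (`B * C'`). -/
theorem norm_errorOp_le {p d : ℕ} {a : ι → Coord n → V →L[ℂ] W} (ha : ∀ t, ContDiff ℝ ∞ (a t))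
    {l : ι → List (Fin n)} (hl : ∀ t, wordWeight p (l t) ≤ d) {y : Coord n} {r : ℝ}
    {q : Coord n → W →L[ℂ] V} (hq : ContDiff ℝ ∞ q) {B C δ B' C' : ℝ} (hB0 : 0 ≤ B) (hC0 : 0 ≤ C)
    (hB0' : 0 ≤ B') (hC0' : 0 ≤ C')
    (hB : ∀ t x, ‖frozenError p d a l y r t x‖ ≤ B)
    (hB' : ∀ t, wordWeight p (l t) = d → ∀ x, ‖frozenError p d a l y r t x‖ ≤ B')
    (hC : ∀ k, wordWeight p k ≤ d → ∀ ξ, ‖wordMonomial k (freq ξ) • q ξ‖ ≤ C)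
    (hC' : ∀ k, wordWeight p k < d → ∀ ξ, ‖wordMonomial k (freq ξ) • q ξ‖ ≤ C')
    (h1 : B' * C ≤ δ) (h2 : B * C' ≤ δ) :
    ‖errorOp p d a l y r q‖ ≤ Fintype.card ι * δ := by
  have hb : ∀ t, MemLp (frozenError p d a l y r t) ⊤ volume := fun t =>
    memLp_frozenError ha l y r (hB t)
  have hterm : ∀ t, ‖mulLp (frozenError p d a l y r t) ∘L multiplierOp q (l t)‖ ≤ δ := by
    intro t
    refine (ContinuousLinearMap.opNorm_comp_le _ _).trans ?_
    by_cases ht : wordWeight p (l t) = d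
    · exact (mul_le_mul (norm_mulLp_le (hb t) hB0' (hB' t ht))
        (norm_multiplierOp_le hq _ hC0 (hC _ (hl t))) (norm_nonneg _) hB0').trans h1
    · exact (mul_le_mul (norm_mulLp_le (hb t) hB0 (hB t))
        (norm_multiplierOp_le hq _ hC0' (hC' _ (lt_of_le_of_ne (hl t) ht))) (norm_nonneg _)
        hB0).trans h2
  refine (norm_sum_le _ _).trans ((Finset.sum_le_sum fun t _ => hterm t).trans ?_)
  rw [Finset.sum_const, Finset.card_univ, nsmul_eq_mul]

/-- The contributions of the commutator `∑ₜ cₜ ∂^{mₜ}` and of the low frequencies to the remainder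
of the parametrix. -/
def remainderOp {κ : Type} [Fintype κ] (c : κ → Coord n → V →L[ℂ] W) (m : κ → List (Fin n))
    (φ η : Coord n → ℝ) (q : Coord n → W →L[ℂ] V) : CoordL2 n W →L[ℂ] CoordL2 n W :=
  ∑ t, mulLp (c t) ∘L multiplierOp q (m t) + -(mulLp (smulId W φ) ∘L
      (invFourier n W : CoordL2 n W →L[ℂ] CoordL2 n W) ∘L mulLp (smulId W η))

theorem exists_bound_of_hasCompactSupport {c : Coord n → V →L[ℂ] W} (hc : Continuous c)
    (hcs : HasCompactSupport c) : ∃ D ρ, (∀ x, ‖c x‖ ≤ D) ∧ ∀ x, ρ < ‖x‖ → c x = 0 := by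
  obtain ⟨D, hD⟩ := hc.bounded_above_of_compact_support hcs
  obtain ⟨ρ, hρ⟩ := hcs.isCompact.isBounded.exists_norm_le
  refine ⟨D, ρ, hD, fun x hx => ?_⟩
  by_contra h
  exact (hρ x (subset_closure h)).not_gt hx

theorem isApproximable_remainderOp {κ : Type} [Fintype κ] {c : κ → Coord n → V →L[ℂ] W}
    (hc : ∀ t, ContDiff ℝ ∞ (c t)) (hcs : ∀ t, HasCompactSupport (c t)) {m : κ → List (Fin n)}
    {φ η : Coord n → ℝ} (hφ : ContDiff ℝ ∞ φ) (hφs : HasCompactSupport φ) (hη : ContDiff ℝ ∞ η)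
    (hηs : HasCompactSupport η) {q : Coord n → W →L[ℂ] V} (hq : ContDiff ℝ ∞ q)
    (hq0 : ∀ t, ∀ ε > 0, ∃ R, ∀ ξ : Coord n, R ≤ ‖ξ‖ →
        ‖wordMonomial (m t) (freq ξ) • q ξ‖ ≤ ε) :
    IsApproximable (remainderOp c m φ η q) := by
  refine (IsApproximable.sum _ fun t _ => ?_).add (IsApproximable.neg ?_)
  · obtain ⟨D, ρ, hD, hρ⟩ := exists_bound_of_hasCompactSupport (hc t).continuous (hcs t)
    exact isApproximable_of_tendsto_zero
      (memLp_top_of_hasCompactSupport (hc t).continuous (hcs t)) hD hρ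
      ((contDiff_wordMonomial_freq (m t)).smul hq) (hq0 t)
  · obtain ⟨D, ρ, hD, hρ⟩ := exists_bound_of_hasCompactSupport
      (contDiff_smulId (V := W) hφ).continuous (hasCompactSupport_smulId hφs)
    exact isApproximable_of_hasCompactSupport
      (memLp_top_of_hasCompactSupport (contDiff_smulId hφ).continuous
        (hasCompactSupport_smulId hφs)) hD hρ (contDiff_smulId hη)
      (hasCompactSupport_smulId hηs)

theorem mulLp_comp_multiplierOp_ae_eq {Z : Type*} [NormedAddCommGroup Z] [NormedSpace ℂ Z]
    {c : Coord n → V →L[ℂ] Z} (hc : MemLp c ⊤ volume)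
    {q : Coord n → W →L[ℂ] V} (hq : ContDiff ℝ ∞ q) (k : List (Fin n)) {C : ℝ}
    (hC : ∀ ξ, ‖wordMonomial k (freq ξ) • q ξ‖ ≤ C) {g : Coord n → W} (hg : ContDiff ℝ ∞ g)
    (hgs : HasCompactSupport g) (hg2 : MemLp g 2 volume) :
    mulLp c (multiplierOp q k (hg2.toLp g)) =ᵐ[volume] fun x =>
      c x (wordDeriv k (𝓕⁻ (fun ξ => q ξ (g ξ))) x) := by
  filter_upwards [coeFn_mulLp hc (multiplierOp q k (hg2.toLp g)),
    invFourier_mulLp_ae_eq hq k hC hg hgs hg2] with x h1 h2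
  rw [h1, ← h2]
  rfl

/-- The operator `A = ∑ₜ aₜ ∂^{lₜ}`, applied to `φ q(D)` on the Fourier side. -/
theorem toLp_wordOp_smul {p d : ℕ} {a : ι → Coord n → V →L[ℂ] W} (ha : ∀ t, ContDiff ℝ ∞ (a t))
    {l : ι → List (Fin n)} (hl : ∀ t, wordWeight p (l t) ≤ d) {y : Coord n} {r B C : ℝ}
    (hB : ∀ t x, ‖frozenError p d a l y r t x‖ ≤ B) {q : Coord n → W →L[ℂ] V}
    (hq : ContDiff ℝ ∞ q) {η : Coord n → ℝ} (hη : ContDiff ℝ ∞ η) (hηs : HasCompactSupport η)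
    (hqη : ∀ ξ, wordSymbol p d a l y (freq ξ) ∘L q ξ = (1 - η ξ) • ContinuousLinearMap.id ℂ W)
    (hC : ∀ k, wordWeight p k ≤ d → ∀ ξ, ‖wordMonomial k (freq ξ) • q ξ‖ ≤ C)
    {φ : Coord n → ℝ} (hφ : ContDiff ℝ ∞ φ) (hφr : tsupport φ ⊆ Metric.closedBall y r)
    (hφs : HasCompactSupport φ)
    {κ : Type} [Fintype κ] {c : κ → Coord n → V →L[ℂ] W} {m : κ → List (Fin n)}
    (hc : ∀ t, MemLp (c t) ⊤ volume) (hm : ∀ t, wordWeight p (m t) < d)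
    {g : Coord n → W} (hg : ContDiff ℝ ∞ g) (hgs : HasCompactSupport g) (hg2 : MemLp g 2 volume)
    {w : Coord n → W} (hw2 : MemLp w 2 volume)
    (hw : ∀ x, w x = φ x • wordOp a l (𝓕⁻ (fun ξ => q ξ (g ξ))) x +
      wordOp c m (𝓕⁻ (fun ξ => q ξ (g ξ))) x) :
    hw2.toLp w = mulLp (smulId W φ) (invFourier n W (hg2.toLp g) +
      errorOp p d a l y r q (hg2.toLp g)) + remainderOp c m φ η q (hg2.toLp g) := by
  set G := hg2.toLp g with hG
  set u := 𝓕⁻ (fun ξ => q ξ (g ξ)) with hu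
  have hφW : MemLp (smulId W φ) ⊤ volume :=
    memLp_top_of_hasCompactSupport (contDiff_smulId hφ).continuous (hasCompactSupport_smulId hφs)
  have hb_ae : ∀ᵐ x ∂(volume : Measure (Coord n)), ∀ t,
      mulLp (frozenError p d a l y r t) (multiplierOp q (l t) G) x =
        frozenError p d a l y r t x (wordDeriv (l t) u x) := ae_all_iff.2 fun t =>
    mulLp_comp_multiplierOp_ae_eq (memLp_frozenError ha l y r (hB t)) hq (l t) (hC _ (hl t))
      hg hgs hg2
  have hc_ae : ∀ᵐ x ∂(volume : Measure (Coord n)), ∀ t,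
      mulLp (c t) (multiplierOp q (m t) G) x = c t x (wordDeriv (m t) u x) := ae_all_iff.2 fun t =>
    mulLp_comp_multiplierOp_ae_eq (hc t) hq (m t) (hC _ (hm t).le) hg hgs hg2
  set X := invFourier n W (G - mulLp (smulId W η) G) with hX
  set Y := ∑ t, mulLp (frozenError p d a l y r t) (multiplierOp q (l t) G) with hY
  set Z := ∑ t, mulLp (c t) (multiplierOp q (m t) G) with hZ
  have e1 : errorOp p d a l y r q G = Y := by simp [errorOp, hY]
  have e2 : remainderOp c m φ η q G =
      Z - mulLp (smulId W φ) (invFourier n W (mulLp (smulId W η) G)) := by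
    simp [remainderOp, hZ, sub_eq_add_neg]
  have hdecomp : mulLp (smulId W φ) (invFourier n W G + errorOp p d a l y r q G) +
      remainderOp c m φ η q G = mulLp (smulId W φ) (X + Y) + Z := by
    rw [e1, e2, hX, map_sub, map_add, map_add, map_sub]
    abel
  rw [hdecomp]
  refine Lp.ext ?_
  filter_upwards [hw2.coeFn_toLp, hb_ae, hc_ae,
    invFourier_sub_ae_eq hq hη hηs hqη hg hgs hg2, Lp.coeFn_add X Y,
    Lp.coeFn_add (mulLp (smulId W φ) (X + Y)) Z, coeFn_mulLp hφW (X + Y),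
    Lp.coeFn_finsetSum Finset.univ fun t =>
      mulLp (frozenError p d a l y r t) (multiplierOp q (l t) G),
    Lp.coeFn_finsetSum Finset.univ fun t => mulLp (c t) (multiplierOp q (m t) G)]
    with x x1 x2 x3 x4 x5 x6 x7 x8 x9
  rw [x1, x6, Pi.add_apply, x7, x5, Pi.add_apply, hY, hZ, x8, x9, Finset.sum_apply,
    Finset.sum_apply, x4, hw x]
  simp only [x2, x3, smulId_apply]
  refine congrArg₂ (· + ·) ?_ rfl
  by_cases hx : x ∈ Metric.closedBall y r
  · congr 1
    rw [Finset.sum_filter, ← Finset.sum_add_distrib]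
    refine Finset.sum_congr rfl fun t _ => ?_
    simp only [frozenError, indicator_of_mem hx]
    split_ifs with ht
    · rw [sub_apply]; abel
    · rw [sub_zero, zero_add]
  · have hx0 : φ x = 0 := image_eq_zero_of_notMem_tsupport fun h => hx (hφr h)
    rw [hx0, zero_smul, zero_smul]

theorem toLp_smul_fourierInv {q : Coord n → W →L[ℂ] V} (hq : ContDiff ℝ ∞ q) {C : ℝ}
    (hC : ∀ ξ, ‖wordMonomial [] (freq ξ) • q ξ‖ ≤ C)
    {φ : Coord n → ℝ} (hφ : ContDiff ℝ ∞ φ) (hφs : HasCompactSupport φ)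
    {g : Coord n → W} (hg : ContDiff ℝ ∞ g) (hgs : HasCompactSupport g) (hg2 : MemLp g 2 volume)
    {w : Coord n → V} (hw2 : MemLp w 2 volume)
    (hw : ∀ x, w x = φ x • 𝓕⁻ (fun ξ => q ξ (g ξ)) x) :
    hw2.toLp w = mulLp (smulId V φ) (multiplierOp q [] (hg2.toLp g)) := by
  refine Lp.ext ?_
  filter_upwards [hw2.coeFn_toLp, mulLp_comp_multiplierOp_ae_eq (memLp_top_of_hasCompactSupport
    (contDiff_smulId (V := V) hφ).continuous (hasCompactSupport_smulId hφs)) hq [] hC hg hgs hg2]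
    with x hx1 hx2
  rw [hx1, hw, hx2]
  rfl

theorem norm_apply_sub_le {X Y : Type*} [NormedAddCommGroup X] [NormedSpace ℂ X]
    [NormedAddCommGroup Y] [NormedSpace ℂ Y] (T : X →L[ℂ] Y) {N ε : ℝ}
    (hT : ‖T‖ ≤ N) (hN : 0 < N) {f g : X} (h : ‖f - g‖ ≤ ε / N) : ‖T g - T f‖ ≤ ε := by
  rw [norm_sub_rev, ← map_sub]
  refine (T.le_of_opNorm_le_of_le hT h).trans (le_of_eq ?_)
  field_simp

/-- Near a point where the weighted symbol of `A = ∑ₜ aₜ ∂^{lₜ}` is invertible, `A` has a right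
parametrix: there are a bounded operator `Q` and an approximable `K` with `A Q f = φ f + K f` for
`f ∈ L²`, in the sense of the closure of `A` on smooth functions supported in the support of the
cutoff `φ`. The parametrix of the operator frozen at `y` is corrected by a Neumann series, which
absorbs the variation of the leading coefficients and, at high frequencies, the lower order terms;
the low frequencies and the commutator of `A` with `φ` make up `K`. -/
theorem exists_local_parametrix (p d : ℕ) {a : ι → Coord n → V →L[ℂ] W}
    (ha : ∀ t, ContDiff ℝ ∞ (a t)) {l : ι → List (Fin n)} (hl : ∀ t, wordWeight p (l t) ≤ d)
    (y : Coord n) (hσ : ∀ ξ : Fin n → ℝ, ξ ≠ 0 → (wordSymbol p d a l y ξ).IsInvertible) :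
    ∃ r > 0, ∀ φ : Coord n → ℝ, ContDiff ℝ ∞ φ → tsupport φ ⊆ Metric.closedBall y r →
      ∃ (Q : CoordL2 n W →L[ℂ] CoordL2 n V) (K : CoordL2 n W →L[ℂ] CoordL2 n W),
        IsApproximable K ∧ ∀ f, ∀ ε > 0, ∃ w : Coord n → V, ContDiff ℝ ∞ w ∧
          tsupport w ⊆ tsupport φ ∧ ∃ (h₁ : MemLp w 2 volume) (h₂ : MemLp (wordOp a l w) 2 volume),
            ‖h₁.toLp w - Q f‖ ≤ ε ∧
              ‖h₂.toLp (wordOp a l w) - (mulLp (smulId W φ) f + K f)‖ ≤ ε := by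
  obtain ⟨C, hC0, hC⟩ := exists_approximate_inverse_symbol p d a l y hσ
  -- each of the terms of the error is to have norm at most `δ`
  set δ : ℝ := 1 / (2 * (Fintype.card ι + 1)) with hδ
  have hδ0 : 0 < δ := by positivity
  obtain ⟨r, hr, B, hB0, hB, hBtop⟩ := exists_norm_frozenError_le p d ha l y
    (δ := δ / (C + 1)) (by positivity)
  set s := max 1 (B * C / δ) with hs
  obtain ⟨q, η, hq, hη, hηs, hqη, hqb, hqs, hq0⟩ := hC s (le_max_left _ _)
  have hs0 : 0 < s := lt_of_lt_of_le one_pos (le_max_left _ _)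
  have hS : ‖errorOp p d a l y r q‖ ≤ 1 / 2 := by
    refine (norm_errorOp_le ha hl hq hB0 hC0 (by positivity) (by positivity) hB hBtop hqb hqs
      (δ := δ) ?_ ?_).trans ?_
    · rw [div_mul_eq_mul_div, div_le_iff₀ (by positivity)]
      nlinarith
    · rw [mul_div_assoc', div_le_iff₀ hs0, ← div_le_iff₀' hδ0]
      exact le_max_right _ _
    · rw [hδ, mul_one_div, div_le_div_iff₀ (by positivity) (by positivity)]
      linarith
  obtain ⟨e, he⟩ := exists_equiv_add_of_norm_le hS
  refine ⟨r, hr, fun φ hφ hφr => ?_⟩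
  have hφs : HasCompactSupport φ :=
    (isCompact_closedBall y r).of_isClosed_subset isClosed_closure hφr
  obtain ⟨κ, _, c, m, hc, hcs, hm, hcm⟩ := exists_wordOp_smul p d ha hl hφ
  have hcs' : ∀ t, HasCompactSupport (c t) := fun t =>
    hφs.isCompact.of_isClosed_subset isClosed_closure (hcs t)
  let K₀ := remainderOp c m φ η q
  have hK₀ : IsApproximable K₀ :=
    isApproximable_remainderOp hc hcs' hφ hφs hη hηs hq fun t => hq0 _ (hm t)
  let Q₀ : CoordL2 n W →L[ℂ] CoordL2 n V := mulLp (smulId V φ) ∘L multiplierOp q []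
  let T₀ : CoordL2 n W →L[ℂ] CoordL2 n W :=
    mulLp (smulId W φ) ∘L (e : CoordL2 n W →L[ℂ] CoordL2 n W) + K₀
  let e' : CoordL2 n W →L[ℂ] CoordL2 n W := e.symm
  refine ⟨Q₀ ∘L e', K₀ ∘L e', hK₀.comp_right _, fun f ε hε => ?_⟩
  -- approximate `e.symm f` by a smooth function `g` with compact support
  have hN : 0 < ‖Q₀‖ + ‖T₀‖ + 1 := by positivity
  obtain ⟨g, hg, hgs, hg2, hgε⟩ := exists_smooth_near (e' f)
    (ε := ε / (‖Q₀‖ + ‖T₀‖ + 1)) (by positivity)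
  let u : Coord n → V := 𝓕⁻ (fun ξ => q ξ (g ξ))
  have hu : ContDiff ℝ ∞ u := contDiff_fourierInv (contDiff_clm_apply_of_complex hq hg)
    (hgs.mono fun ξ hξ h0 => hξ (by simp only; rw [h0, map_zero]))
  let w : Coord n → V := fun x => φ x • u x
  have hw : ContDiff ℝ ∞ w := hφ.smul hu
  have hwφ : tsupport w ⊆ tsupport φ := tsupport_smul_subset_left φ u
  have hws : HasCompactSupport w := hφs.smul_right
  have hAw := contDiff_wordOp ha l hw
  have hAws : HasCompactSupport (wordOp a l w) :=
    hws.mono' (subset_closure.trans (tsupport_wordOp_subset a l w))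
  have h₁ : MemLp w 2 volume := hw.continuous.memLp_of_hasCompactSupport hws
  have h₂ : MemLp (wordOp a l w) 2 volume := hAw.continuous.memLp_of_hasCompactSupport hAws
  have eQ : h₁.toLp w = Q₀ (hg2.toLp g) :=
    toLp_smul_fourierInv hq (hqb [] (by simp)) hφ hφs hg hgs hg2 h₁ fun _ => rfl
  have eT : h₂.toLp (wordOp a l w) = T₀ (hg2.toLp g) := by
    rw [toLp_wordOp_smul ha hl hB hq hη hηs hqη hqb hφ hφr hφs
      (fun t => memLp_top_of_hasCompactSupport (hc t).continuous (hcs' t)) hm hg hgs hg2 h₂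
      (hcm u hu), ← he]
    rfl
  have hTf : mulLp (smulId W φ) f + (K₀ ∘L e') f = T₀ (e' f) := by
    have h1 : (e : CoordL2 n W →L[ℂ] CoordL2 n W) (e' f) = f := e.apply_symm_apply f
    rw [add_apply, ContinuousLinearMap.comp_apply (mulLp (smulId W φ)), h1]
    rfl
  refine ⟨w, hw, hwφ, h₁, h₂, ?_, ?_⟩
  · rw [eQ]
    exact norm_apply_sub_le Q₀ (by linarith [norm_nonneg T₀]) hN hgε
  · rw [eT, hTf]
    exact norm_apply_sub_le T₀ (by linarith [norm_nonneg Q₀]) hN hgε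

end Parametrix

/-! ### Comparison of densities and metrics with their coordinate expressions -/

section Comparison

variable {n : ℕ} {M : Type*} [TopologicalSpace M] [ChartedSpace (EuclideanSpace ℝ (Fin n)) M]

/-- The part of the manifold which corresponds to a set `K` of coordinates. -/
def region (φ : OpenPartialHomeomorph M (Coord n)) (K : Set (Coord n)) : Set M :=
  φ.source ∩ φ ⁻¹' K

theorem region_eq_image {φ : OpenPartialHomeomorph M (Coord n)} {K : Set (Coord n)}
    (hK : K ⊆ φ.target) : region φ K = φ.symm '' K :=
  (φ.symm_image_eq_source_inter_preimage hK).symm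

theorem isCompact_region {φ : OpenPartialHomeomorph M (Coord n)} {K : Set (Coord n)}
    (hKφ : K ⊆ φ.target) (hK : IsCompact K) : IsCompact (region φ K) := by
  rw [region_eq_image hKφ]
  exact hK.image_of_continuousOn (φ.continuousOn_symm.mono hKφ)

section Measure

variable [MeasurableSpace M] [BorelSpace M]

theorem aemeasurable_chart_restrict [T2Space M] (ν : Measure M)
    {φ : OpenPartialHomeomorph M (Coord n)}
    {K : Set (Coord n)} (hKφ : K ⊆ φ.target) (hK : IsCompact K) :
    AEMeasurable φ (ν.restrict (region φ K)) :=
  (φ.continuousOn.mono inter_subset_left).aemeasurable (isCompact_region hKφ hK).measurableSet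

theorem aemeasurable_chart_symm_restrict {φ : OpenPartialHomeomorph M (Coord n)}
    {K : Set (Coord n)} (hKφ : K ⊆ φ.target) (hK : IsCompact K) :
    AEMeasurable φ.symm ((volume : Measure (Coord n)).restrict K) :=
  (φ.continuousOn_symm.mono hKφ).aemeasurable hK.measurableSet

/-- Over a compact set of coordinates, a smooth density and Lebesgue measure bound each other. -/
theorem SmoothDensity.exists_map_restrict_le (μ : SmoothDensity n M)
    {φ : OpenPartialHomeomorph M (Coord n)} (hφ : φ ∈ IsManifold.maximalAtlas (𝓡 n) ∞ M)
    {K : Set (Coord n)} (hKφ : K ⊆ φ.target) (hK : IsCompact K) :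
    ∃ C : ℝ≥0∞, C ≠ ⊤ ∧
      (μ.measure.restrict (region φ K)).map φ ≤ C • (volume : Measure (Coord n)).restrict K ∧
      (volume : Measure (Coord n)).restrict K ≤ C • (μ.measure.restrict (region φ K)).map φ := by
  obtain ⟨ρ, hρ, hpos, h⟩ := μ.smooth φ hφ
  have hm : AEMeasurable φ (μ.measure.restrict φ.source) :=
    φ.continuousOn.aemeasurable φ.open_source.measurableSet
  have hKm := hK.measurableSet
  have e : (μ.measure.restrict (region φ K)).map φ =
      ((volume : Measure (Coord n)).restrict K).withDensity fun y => ENNReal.ofReal (ρ y) := by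
    have h1 : ((volume.restrict φ.target).withDensity (fun y => ENNReal.ofReal (ρ y))).restrict K =
        ((volume : Measure (Coord n)).restrict K).withDensity fun y => ENNReal.ofReal (ρ y) := by
      rw [restrict_withDensity hKm, Measure.restrict_restrict hKm, inter_eq_left.2 hKφ]
    rw [← h1, ← h, Measure.restrict_map_of_aemeasurable hm hKm,
      Measure.restrict_restrict' φ.open_source.measurableSet, region, inter_comm]
  have hc : ContinuousOn ρ K := hρ.continuousOn.mono hKφ
  obtain ⟨A, hA⟩ := hK.bddAbove_image hc
  obtain ⟨B, hB⟩ := hK.bddAbove_image (f := fun y => (ρ y)⁻¹)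
    (hc.inv₀ fun y hy => (hpos y (hKφ hy)).ne')
  refine ⟨ENNReal.ofReal (max A B), ENNReal.ofReal_ne_top, ?_, ?_⟩
  · rw [e, ← withDensity_const]
    refine withDensity_mono ?_
    filter_upwards [ae_restrict_mem hKm] with y hy
    exact ENNReal.ofReal_le_ofReal ((hA (mem_image_of_mem _ hy)).trans (le_max_left _ _))
  · rw [e, ← withDensity_smul' _ _ ENNReal.ofReal_ne_top]
    conv_lhs => rw [← withDensity_one (μ := volume.restrict K)]
    refine withDensity_mono ?_
    filter_upwards [ae_restrict_mem hKm] with y hy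
    have h0 := hpos y (hKφ hy)
    have h1 : (ρ y)⁻¹ ≤ max A B := (hB (mem_image_of_mem _ hy)).trans (le_max_right _ _)
    simp only [Pi.one_apply, Pi.smul_apply, smul_eq_mul]
    rw [← ENNReal.ofReal_mul ((inv_pos.2 h0).le.trans h1), ← ENNReal.ofReal_one]
    refine ENNReal.ofReal_le_ofReal ?_
    calc (1 : ℝ) = (ρ y)⁻¹ * ρ y := (inv_mul_cancel₀ h0.ne').symm
      _ ≤ _ := by gcongr

theorem map_symm_map_restrict [T2Space M] (ν : Measure M)
    {φ : OpenPartialHomeomorph M (Coord n)}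
    {K : Set (Coord n)} (hKφ : K ⊆ φ.target) (hK : IsCompact K)
    (h : AEMeasurable φ.symm ((ν.restrict (region φ K)).map φ)) :
    ((ν.restrict (region φ K)).map φ).map φ.symm = ν.restrict (region φ K) := by
  rw [AEMeasurable.map_map_of_aemeasurable h (aemeasurable_chart_restrict ν hKφ hK)]
  have : φ.symm ∘ φ =ᵐ[ν.restrict (region φ K)] id := by
    filter_upwards [ae_restrict_mem (isCompact_region hKφ hK).measurableSet] with x hx
    exact φ.left_inv hx.1
  rw [Measure.map_congr this, Measure.map_id]

/-- A version of `SmoothDensity.exists_map_restrict_le` for the inverse of the chart. -/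
theorem SmoothDensity.exists_map_symm_restrict_le [T2Space M] (μ : SmoothDensity n M)
    {φ : OpenPartialHomeomorph M (Coord n)} (hφ : φ ∈ IsManifold.maximalAtlas (𝓡 n) ∞ M)
    {K : Set (Coord n)} (hKφ : K ⊆ φ.target) (hK : IsCompact K) :
    ∃ C : ℝ≥0∞, C ≠ ⊤ ∧
      ((volume : Measure (Coord n)).restrict K).map φ.symm ≤
        C • μ.measure.restrict (region φ K) := by
  obtain ⟨C, hC, h1, h2⟩ := μ.exists_map_restrict_le hφ hKφ hK
  have h3 : AEMeasurable φ.symm ((μ.measure.restrict (region φ K)).map φ) :=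
    ((aemeasurable_chart_symm_restrict hKφ hK).smul_measure C).mono_measure h1
  refine ⟨C, hC, ?_⟩
  have h4 := Measure.map_mono_of_aemeasurable h2 (h3.smul_measure C)
  rwa [Measure.map_smul, map_symm_map_restrict μ.measure hKφ hK h3] at h4

end Measure

theorem integrable_comp_and_integral_le {α β : Type*} [MeasurableSpace α] [MeasurableSpace β]
    {ν : Measure α} {lam : Measure β} {f : α → β} (hf : AEMeasurable f ν) {C : ℝ≥0∞} (hC : C ≠ ⊤)
    (h : ν.map f ≤ C • lam) {G : β → ℝ} (hG : Integrable G lam) (h0 : ∀ y, 0 ≤ G y) :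
    Integrable (fun x => G (f x)) ν ∧ ∫ x, G (f x) ∂ν ≤ C.toReal * ∫ y, G y ∂lam := by
  have h1 : Integrable G (C • lam) := hG.smul_measure hC
  have h2 : Integrable G (ν.map f) := h1.mono_measure h
  refine ⟨h2.comp_aemeasurable hf, ?_⟩
  rw [← integral_map hf h2.1]
  refine (integral_mono_measure h (.of_forall h0) h1).trans (le_of_eq ?_)
  rw [integral_smul_measure, smul_eq_mul]

section Fibre

variable [CompactSpace M] [MeasurableSpace M] [BorelSpace M]
  {F : Type*} [NormedAddCommGroup F] [NormedSpace ℂ F] [FiniteDimensional ℂ F]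
  {E : M → Type*} [∀ x, AddCommGroup (E x)] [∀ x, Module ℂ (E x)]
  [TopologicalSpace (TotalSpace F E)] [∀ x, TopologicalSpace (E x)]
  [FiberBundle F E] [VectorBundle ℂ F E]

/-- A Hermitian metric is continuous in the trivialization `e`. Its smoothness is given in terms of
the preferred trivializations, so that a change of trivialization is made near each point. -/
theorem HermitianMetric.continuousOn_inner_symm (h : HermitianMetric (n := n) F E)
    (e : Trivialization F (π F E)) :
    ContinuousOn (fun z : M × F => (h.inner z.1 (e.symm z.1 z.2) (e.symm z.1 z.2)).re)
      (e.baseSet ×ˢ univ) := by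
  rintro ⟨x₀, w₀⟩ ⟨hx₀, -⟩
  refine ContinuousAt.continuousWithinAt ?_
  set e' := trivializationAt F E x₀ with he'
  let b := Module.finBasis ℂ F
  have hL : ∀ i, Continuous (fun v : F => b.repr v i) := fun i =>
    ((b.coord i).continuous_of_finiteDimensional)
  set U : Set (M × F) := (e.baseSet ∩ e'.baseSet) ×ˢ univ with hU
  have hUo : IsOpen U := (e.open_baseSet.inter e'.open_baseSet).prod isOpen_univ
  have hmem : (x₀, w₀) ∈ U := ⟨⟨hx₀, mem_baseSet_trivializationAt F E x₀⟩, mem_univ _⟩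
  have hsub : U ⊆ e.baseSet ×ˢ univ := prod_mono_left inter_subset_left
  have hc : ContinuousOn (fun z : M × F => (e' ⟨z.1, e.symm z.1 z.2⟩).2) U := by
    have h1 : ContinuousOn (fun z : M × F => (⟨z.1, e.symm z.1 z.2⟩ : TotalSpace F E)) U :=
      e.continuousOn_symm.mono hsub
    refine continuous_snd.comp_continuousOn (e'.continuousOn.comp h1 fun z hz => ?_)
    exact e'.mem_source.2 hz.1.2
  have key : ContinuousOn (fun z : M × F => (∑ i, ∑ j,
      conj (b.repr (e' ⟨z.1, e.symm z.1 z.2⟩).2 i) * (b.repr (e' ⟨z.1, e.symm z.1 z.2⟩).2 j *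
        h.inner z.1 (e'.symm z.1 (b i)) (e'.symm z.1 (b j)))).re) U := by
    refine Complex.continuous_re.comp_continuousOn ?_
    refine continuousOn_finsetSum _ fun i _ => continuousOn_finsetSum _ fun j _ => ?_
    refine ContinuousOn.mul ?_ (ContinuousOn.mul ?_ ?_)
    · exact (Complex.continuous_conj.comp (hL i)).comp_continuousOn hc
    · exact (hL j).comp_continuousOn hc
    · exact (h.smooth x₀ (b i) (b j)).continuousOn.comp continuousOn_fst fun z hz => hz.1.2
  refine (key.continuousAt (hUo.mem_nhds hmem)).congr ?_
  filter_upwards [hUo.mem_nhds hmem] with z hz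
  rw [← h.inner_eq_sum x₀ hz.1.2 b]

/-- Over a compact set, a Hermitian metric is equivalent to the norm of a trivialization. -/
theorem HermitianMetric.exists_norm_sq_le (h : HermitianMetric (n := n) F E)
    (e : Trivialization F (π F E)) [MemTrivializationAtlas e] {K : Set M} (hK : IsCompact K)
    (hKe : K ⊆ e.baseSet) :
    ∃ C : ℝ, 0 ≤ C ∧ ∀ x ∈ K, ∀ v : E x, ‖(e ⟨x, v⟩).2‖ ^ 2 ≤ C * (h.inner x v v).re ∧
      (h.inner x v v).re ≤ C * ‖(e ⟨x, v⟩).2‖ ^ 2 := by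
  have : ProperSpace F := FiniteDimensional.proper ℂ F
  have hS : IsCompact (K ×ˢ Metric.sphere (0 : F) 1) := hK.prod (isCompact_sphere 0 1)
  have hc := (h.continuousOn_inner_symm e).mono
    (prod_mono hKe (subset_univ (Metric.sphere (0 : F) 1)))
  have hpos : ∀ z ∈ K ×ˢ Metric.sphere (0 : F) 1,
      0 < (h.inner z.1 (e.symm z.1 z.2) (e.symm z.1 z.2)).re := by
    rintro ⟨x, w⟩ ⟨hx, hw⟩
    refine h.pos x _ fun h0 => ?_
    have h1 : (e ⟨x, e.symm x w⟩).2 = w := congrArg Prod.snd (e.apply_mk_symm (hKe hx) w)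
    simp only at h0
    have h2 : (e ⟨x, (0 : E x)⟩).2 = 0 := (e.linear ℂ (hKe hx)).map_zero
    rw [h0, h2] at h1
    simp [← h1] at hw
  obtain ⟨A, hA⟩ := hS.bddAbove_image hc
  obtain ⟨B, hB⟩ := hS.bddAbove_image (hc.inv₀ fun z hz => (hpos z hz).ne')
  refine ⟨max 0 (max A B), le_max_left _ _, fun x hx v => ?_⟩
  set w := (e ⟨x, v⟩).2 with hw
  have hv : e.symm x w = v := e.symm_apply_apply_mk (hKe hx) v
  rcases eq_or_ne w 0 with hw0 | hw0
  · have hv0 : v = 0 := by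
      rw [← hv, hw0, ← e.symmₗ_apply (R := ℂ) (hKe hx), map_zero]
    rw [hw0, hv0]
    simp
  have hn : 0 < ‖w‖ := norm_pos_iff.2 hw0
  -- `v` is rescaled to norm one in the trivialization
  set w' : F := ((‖w‖⁻¹ : ℝ) : ℂ) • w with hw'
  have hw's : (x, w') ∈ K ×ˢ Metric.sphere (0 : F) 1 := by
    refine ⟨hx, ?_⟩
    rw [mem_sphere_zero_iff_norm, hw', norm_smul, Complex.norm_real, norm_inv, norm_norm,
      inv_mul_cancel₀ hn.ne']
  have hsymm : e.symm x w' = ((‖w‖⁻¹ : ℝ) : ℂ) • v := by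
    rw [← hv, hw', ← e.symmₗ_apply (R := ℂ) (hKe hx), ← e.symmₗ_apply (R := ℂ) (hKe hx), map_smul]
  have hN : (h.inner x (e.symm x w') (e.symm x w')).re = ‖w‖⁻¹ ^ 2 * (h.inner x v v).re := by
    rw [hsymm]
    simp only [map_smulₛₗ, LinearMap.smul_apply, smul_eq_mul, RingHom.id_apply,
      Complex.conj_ofReal, ← mul_assoc, ← Complex.ofReal_mul, Complex.re_ofReal_mul]
    ring
  have h0 := hpos _ hw's
  have h1 : (h.inner x (e.symm x w') (e.symm x w')).re ≤ max 0 (max A B) :=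
    (hA (mem_image_of_mem _ hw's)).trans ((le_max_left _ _).trans (le_max_right _ _))
  have h2 : (h.inner x (e.symm x w') (e.symm x w')).re⁻¹ ≤ max 0 (max A B) :=
    (hB (mem_image_of_mem _ hw's)).trans ((le_max_right _ _).trans (le_max_right _ _))
  simp only at h0
  rw [hN] at h0 h1 h2
  rw [inv_pow] at h0 h1 h2
  constructor
  · rw [mul_inv, inv_inv] at h2
    have hH : 0 < (h.inner x v v).re := by
      by_contra hneg
      exact absurd h0 (not_lt.2 (mul_nonpos_of_nonneg_of_nonpos (by positivity) (not_lt.1 hneg)))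
    rwa [← div_eq_mul_inv, div_le_iff₀ hH] at h2
  · rwa [inv_mul_le_iff₀ (by positivity), mul_comm] at h1

end Fibre

end Comparison

/-! ### Sections in a coordinate patch -/

section Patch

variable {n : ℕ} {M : Type*} [TopologicalSpace M] [ChartedSpace (EuclideanSpace ℝ (Fin n)) M]
  {F : Type*} [NormedAddCommGroup F] [NormedSpace ℂ F]
  {E : M → Type*} [∀ x, AddCommGroup (E x)] [∀ x, Module ℂ (E x)]
  [TopologicalSpace (TotalSpace F E)] [∀ x, TopologicalSpace (E x)]
  [FiberBundle F E] [VectorBundle ℂ F E]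
  {V : Type*} [NormedAddCommGroup V] [InnerProductSpace ℂ V]

variable (n F E V) in
/-- A compact coordinate patch of the bundle `E`: a chart, a local trivialization, an identification
of the model fibre with the inner product space `V`, and a compact set `K` of coordinates over which
all of this is defined. -/
structure BundlePatch where
  chart : OpenPartialHomeomorph M (Coord n)
  chart_mem : chart ∈ IsManifold.maximalAtlas (𝓡 n) ∞ M
  triv : Trivialization F (π F E)
  triv_mem : MemTrivializationAtlas triv
  fiberEquiv : F ≃L[ℂ] V
  K : Set (Coord n)
  isCompact : IsCompact K
  subset_target : K ⊆ chart.target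
  mem_baseSet : ∀ y ∈ K, chart.symm y ∈ triv.baseSet

attribute [instance] BundlePatch.triv_mem

namespace BundlePatch

variable (c : BundlePatch n F E V)

/-- The part of the manifold covered by the patch. -/
def carrier : Set M := region c.chart c.K

theorem isCompact_carrier : IsCompact c.carrier := isCompact_region c.subset_target c.isCompact

theorem carrier_subset_baseSet : c.carrier ⊆ c.triv.baseSet := fun x hx => by
  have := c.mem_baseSet _ hx.2
  rwa [c.chart.left_inv hx.1] at this

theorem symm_mem_carrier {y : Coord n} (hy : y ∈ c.K) : c.chart.symm y ∈ c.carrier := by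
  have := c.subset_target hy
  exact ⟨c.chart.map_target this, by rwa [mem_preimage, c.chart.right_inv this]⟩

/-- The expression of a section in the coordinates of the patch. -/
def coord (s : ∀ x, E x) (y : Coord n) : V :=
  c.fiberEquiv (c.triv ⟨c.chart.symm y, s (c.chart.symm y)⟩).2

open scoped Classical in
/-- The section over the patch with a given coordinate expression, extended by zero. -/
def ext (f : Coord n → V) (x : M) : E x :=
  if x ∈ c.carrier then c.triv.symm x (c.fiberEquiv.symm (f (c.chart x))) else 0

theorem ext_of_mem (f : Coord n → V) {x : M} (hx : x ∈ c.carrier) :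
    c.ext f x = c.triv.symm x (c.fiberEquiv.symm (f (c.chart x))) := if_pos hx

theorem ext_of_notMem (f : Coord n → V) {x : M} (hx : x ∉ c.carrier) : c.ext f x = 0 := if_neg hx

theorem triv_ext (f : Coord n → V) {x : M} (hx : x ∈ c.carrier) :
    (c.triv ⟨x, c.ext f x⟩).2 = c.fiberEquiv.symm (f (c.chart x)) := by
  rw [c.ext_of_mem f hx]
  exact congrArg Prod.snd (c.triv.apply_mk_symm (c.carrier_subset_baseSet hx) _)

theorem ext_coord (s : ∀ x, E x) {x : M} (hx : x ∈ c.carrier) : c.ext (c.coord s) x = s x := by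
  have hx' : c.chart.symm (c.chart x) = x := c.chart.left_inv hx.1
  rw [c.ext_of_mem _ hx, coord, ContinuousLinearEquiv.symm_apply_apply, hx']
  exact c.triv.symm_apply_apply_mk (c.carrier_subset_baseSet hx) _

theorem ext_add (f g : Coord n → V) : c.ext (f + g) = c.ext f + c.ext g := by
  funext x
  by_cases hx : x ∈ c.carrier
  · have hb := c.carrier_subset_baseSet hx
    simp only [Pi.add_apply, c.ext_of_mem _ hx, ← c.triv.symmₗ_apply (R := ℂ) hb, map_add]
  · simp [c.ext_of_notMem _ hx]

theorem ext_smul (z : ℂ) (f : Coord n → V) : c.ext (z • f) = z • c.ext f := by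
  funext x
  by_cases hx : x ∈ c.carrier
  · have hb := c.carrier_subset_baseSet hx
    simp only [Pi.smul_apply, c.ext_of_mem _ hx, ← c.triv.symmₗ_apply (R := ℂ) hb, map_smul]
  · simp [c.ext_of_notMem _ hx]

theorem coord_add (s t : ∀ x, E x) {y : Coord n} (hy : c.chart.symm y ∈ c.triv.baseSet) :
    c.coord (s + t) y = c.coord s y + c.coord t y := by
  rw [coord, coord, coord, ← map_add]
  exact congrArg _ ((c.triv.linear ℂ hy).map_add _ _)

theorem coord_smul (z : ℂ) (s : ∀ x, E x) {y : Coord n}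
    (hy : c.chart.symm y ∈ c.triv.baseSet) : c.coord (z • s) y = z • c.coord s y := by
  rw [coord, coord, ← map_smul]
  exact congrArg _ ((c.triv.linear ℂ hy).map_smul _ _)

end BundlePatch

/-! ### Localization and extension by zero as operators on `L²` -/

section Operators

variable [CompactSpace M] [MeasurableSpace M] [BorelSpace M] [FiniteDimensional ℂ F]

theorem exists_finite_baseSet_cover : ∃ t : Finset M,
    (⋃ i : t, (trivializationAt F E i.1).baseSet) = univ := by
  obtain ⟨t, ht⟩ := isCompact_univ.elim_finite_subcover
    (fun x₀ : M => (trivializationAt F E x₀).baseSet)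
    (fun x₀ => (trivializationAt F E x₀).open_baseSet)
    (fun x _ => mem_iUnion.2 ⟨x, mem_baseSet_trivializationAt F E x⟩)
  refine ⟨t, eq_univ_iff_forall.2 fun x => ?_⟩
  obtain ⟨i, hi, hx⟩ := mem_iUnion₂.1 (ht (mem_univ x))
  exact mem_iUnion.2 ⟨⟨i, hi⟩, hx⟩

/-- Measurability of a section does not depend on the trivialization in which it is expressed. -/
theorem aestronglyMeasurable_coordChange {ν : Measure M} {e e' : Trivialization F (π F E)}
    [MemTrivializationAtlas e] [MemTrivializationAtlas e'] {A : Set M} (hA : MeasurableSet A)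
    (hAe : A ⊆ e.baseSet) (hAe' : A ⊆ e'.baseSet) {s : ∀ x, E x}
    (hs : AEStronglyMeasurable (fun x => (e ⟨x, s x⟩).2) (ν.restrict A)) :
    AEStronglyMeasurable (fun x => (e' ⟨x, s x⟩).2) (ν.restrict A) := by
  have h1 : AEStronglyMeasurable (fun x => (e.coordChangeL ℂ e' x : F →L[ℂ] F))
      (ν.restrict A) :=
    ((continuousOn_coordChange ℂ e e').mono fun x hx => ⟨hAe hx, hAe' hx⟩).aestronglyMeasurable hA
  refine ((ContinuousLinearMap.id ℂ (F →L[ℂ] F)).aestronglyMeasurable_comp₂ h1 hs).congr ?_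
  filter_upwards [ae_restrict_mem hA] with x hx
  change e.coordChangeL ℂ e' x (e ⟨x, s x⟩).2 = _
  rw [e.coordChangeL_apply e' ⟨hAe hx, hAe' hx⟩]
  have h2 := e.symm_apply_apply_mk (hAe hx) (s x)
  rw [h2]

theorem IsMeasurableSection.aestronglyMeasurable_triv {ν : Measure M} {s : ∀ x, E x}
    (hs : IsMeasurableSection F ν s) (e : Trivialization F (π F E)) [MemTrivializationAtlas e] :
    AEStronglyMeasurable (fun x => (e ⟨x, s x⟩).2) (ν.restrict e.baseSet) := by
  obtain ⟨t, ht⟩ := exists_finite_baseSet_cover (F := F) (E := E)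
  rw [← univ_inter e.baseSet, ← ht, iUnion_inter, aestronglyMeasurable_iUnion_iff]
  intro i
  refine aestronglyMeasurable_coordChange (e := trivializationAt F E i.1)
    ((trivializationAt F E i.1).open_baseSet.inter e.open_baseSet).measurableSet
    inter_subset_left inter_subset_right ((hs i.1).mono_measure ?_)
  exact Measure.restrict_mono inter_subset_left le_rfl

variable (h : HermitianMetric (n := n) F E)

/-- A square integrable section, as an element of the space which carries the `L²` seminorm. -/
def L2Section.of {ν : Measure M} {s : ∀ x, E x} (hs : s ∈ squareIntegrable h ν) :
    L2Section h ν := (⟨s, hs⟩ : squareIntegrable h ν)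

theorem L2Section.norm_sq {ν : Measure M} (s : L2Section h ν) :
    ‖s‖ ^ 2 = ∫ x, (h.inner x (s.1 x) (s.1 x)).re ∂ν := by
  have h1 : ‖s‖ ^ 2 = RCLike.re (inner ℂ s s) := InnerProductSpace.norm_sq_eq_re_inner s
  have h2 : RCLike.re (∫ x, h.inner x (s.1 x) (s.1 x) ∂ν) =
    ∫ x, (h.inner x (s.1 x) (s.1 x)).re ∂ν := (integral_re (s.integrable_inner h ν s)).symm
  exact h1.trans h2

theorem L2.mk_eq_mk_of_ae {ν : Measure M} {s t : L2Section h ν} (hst : ∀ᵐ x ∂ν, s.1 x = t.1 x) :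
    (SeparationQuotient.mk s : L2 h ν) = SeparationQuotient.mk t := by
  rw [SeparationQuotient.mk_eq_mk, Metric.inseparable_iff, dist_eq_norm, ← sq_eq_zero_iff,
    L2Section.norm_sq]
  refine integral_eq_zero_of_ae ?_
  filter_upwards [hst] with x hx
  have : (s - t).1 x = 0 := (congrArg (· - t.1 x) hx).trans (sub_self _)
  simp [this]

theorem norm_toLp_sq {α : Type*} [MeasurableSpace α] {ν : Measure α} {f : α → V}
    (hf : MemLp f 2 ν) : ‖hf.toLp f‖ ^ 2 = ∫ x, ‖f x‖ ^ 2 ∂ν := by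
  have h1 : ‖hf.toLp f‖ ^ 2 = RCLike.re (inner ℂ (hf.toLp f) (hf.toLp f)) :=
    InnerProductSpace.norm_sq_eq_re_inner _
  rw [h1, MeasureTheory.L2.inner_def, ← integral_re (MeasureTheory.L2.integrable_inner _ _)]
  refine integral_congr_ae ?_
  filter_upwards [hf.coeFn_toLp] with x hx
  rw [hx, InnerProductSpace.norm_sq_eq_re_inner (𝕜 := ℂ)]

namespace BundlePatch

variable (c : BundlePatch n F E V) [T2Space M] (μ : SmoothDensity n M)

theorem ae_map_chart {P : Coord n → Prop} (hP : ∀ᵐ y, P y) :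
    ∀ᵐ x ∂μ.measure, x ∈ c.carrier → P (c.chart x) := by
  obtain ⟨C, hC, h1, -⟩ := μ.exists_map_restrict_le c.chart_mem c.subset_target c.isCompact
  rw [← ae_restrict_iff' c.isCompact_carrier.measurableSet]
  refine ae_of_ae_map (aemeasurable_chart_restrict μ.measure c.subset_target c.isCompact) ?_
  have h2 : (μ.measure.restrict (region c.chart c.K)).map c.chart ≪ volume :=
    (Measure.absolutelyContinuous_of_le_smul h1).trans
      Measure.restrict_le_self.absolutelyContinuous
  exact h2.ae_le hP

/-- Localization to the patch is bounded on `L²`: over the compact patch, the metric and the density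
are comparable with those of the coordinate space. -/
theorem exists_localize_bound : ∃ C : ℝ, ∀ s : L2Section h μ.measure,
    ∃ hs : MemLp (c.K.indicator (c.coord s.1)) 2 volume, ‖hs.toLp _‖ ≤ C * ‖s‖ := by
  obtain ⟨C₁, hC₁, h1⟩ := h.exists_norm_sq_le c.triv c.isCompact_carrier c.carrier_subset_baseSet
  obtain ⟨C₂, hC₂, h2⟩ := μ.exists_map_symm_restrict_le c.chart_mem c.subset_target c.isCompact
  have hKm := c.isCompact.measurableSet
  have hae := aemeasurable_chart_symm_restrict c.subset_target c.isCompact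
  set D : ℝ := ‖(c.fiberEquiv : F →L[ℂ] V)‖ ^ 2 * C₁ * C₂.toReal with hD
  have hD0 : 0 ≤ D := by positivity
  refine ⟨√D, fun s => ?_⟩
  have hmeas : AEStronglyMeasurable (c.coord s.1) ((volume : Measure (Coord n)).restrict c.K) := by
    have m1 := (s.2.1.aestronglyMeasurable_triv c.triv).mono_measure
      (Measure.restrict_mono c.carrier_subset_baseSet le_rfl)
    have m2 := ((m1.smul_measure C₂).mono_measure h2).comp_aemeasurable hae
    exact c.fiberEquiv.continuous.comp_aestronglyMeasurable m2
  obtain ⟨i1, i2⟩ := integrable_comp_and_integral_le hae hC₂ h2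
    (s.2.2.mono_measure Measure.restrict_le_self) fun x => h.self_re_nonneg x _
  have hle : ∀ᵐ y ∂(volume : Measure (Coord n)).restrict c.K, ‖c.coord s.1 y‖ ^ 2 ≤
      ‖(c.fiberEquiv : F →L[ℂ] V)‖ ^ 2 * C₁ *
        (h.inner (c.chart.symm y) (s.1 (c.chart.symm y)) (s.1 (c.chart.symm y))).re := by
    filter_upwards [ae_restrict_mem hKm] with y hy
    have h3 := (h1 _ (c.symm_mem_carrier hy) (s.1 (c.chart.symm y))).1
    have h4 : ‖c.coord s.1 y‖ ≤ ‖(c.fiberEquiv : F →L[ℂ] V)‖ *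
        ‖(c.triv ⟨c.chart.symm y, s.1 (c.chart.symm y)⟩).2‖ :=
      (c.fiberEquiv : F →L[ℂ] V).le_opNorm _
    calc _ ≤ (‖(c.fiberEquiv : F →L[ℂ] V)‖ *
        ‖(c.triv ⟨c.chart.symm y, s.1 (c.chart.symm y)⟩).2‖) ^ 2 := by gcongr
      _ ≤ _ := by rw [mul_pow, mul_assoc]; gcongr
  have hint : Integrable (fun y => ‖c.coord s.1 y‖ ^ 2)
      ((volume : Measure (Coord n)).restrict c.K) :=
    (i1.const_mul _).mono' (hmeas.norm.pow 2) (by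
      filter_upwards [hle] with y hy
      rwa [Real.norm_of_nonneg (by positivity)])
  have hs : MemLp (c.K.indicator (c.coord s.1)) 2 volume :=
    (memLp_indicator_iff_restrict hKm).2 ((memLp_two_iff_integrable_sq_norm hmeas).2 hint)
  refine ⟨hs, ?_⟩
  refine le_of_sq_le_sq ?_ (by positivity)
  rw [mul_pow, Real.sq_sqrt hD0, norm_toLp_sq, L2Section.norm_sq]
  have e1 : (fun y => ‖c.K.indicator (c.coord s.1) y‖ ^ 2) =
      c.K.indicator (fun y => ‖c.coord s.1 y‖ ^ 2) := by
    funext y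
    by_cases hy : y ∈ c.K <;> simp [hy]
  rw [e1, integral_indicator hKm]
  refine (integral_mono_ae hint (i1.const_mul _) hle).trans ?_
  rw [integral_const_mul, hD, mul_assoc _ C₂.toReal]
  refine mul_le_mul_of_nonneg_left (i2.trans ?_) (by positivity)
  refine mul_le_mul_of_nonneg_left ?_ ENNReal.toReal_nonneg
  exact integral_mono_measure Measure.restrict_le_self
    (.of_forall fun x => h.self_re_nonneg x _) s.2.2

theorem isMeasurableSection_ext {f : Coord n → V} (hf : AEStronglyMeasurable f volume) :
    IsMeasurableSection F μ.measure (c.ext f) := by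
  intro x₀
  set e := trivializationAt F E x₀
  have hcm := c.isCompact_carrier.measurableSet
  have hAm : MeasurableSet (c.carrier ∩ e.baseSet) := hcm.inter e.open_baseSet.measurableSet
  obtain ⟨C, hC, h1, -⟩ := μ.exists_map_restrict_le c.chart_mem c.subset_target c.isCompact
  have m1 : AEStronglyMeasurable (fun x => (c.triv ⟨x, c.ext f x⟩).2)
      (μ.measure.restrict c.carrier) := by
    have m2 := ((hf.mono_measure (Measure.restrict_le_self (s := c.K))).smul_measure C).mono_measure
      h1 |>.comp_aemeasurable (aemeasurable_chart_restrict μ.measure c.subset_target c.isCompact)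
    refine (c.fiberEquiv.symm.continuous.comp_aestronglyMeasurable m2).congr ?_
    filter_upwards [ae_restrict_mem hcm] with x hx
    exact (c.triv_ext f hx).symm
  have m3 : AEStronglyMeasurable (fun x => (e ⟨x, c.ext f x⟩).2)
      (μ.measure.restrict (c.carrier ∩ e.baseSet)) :=
    aestronglyMeasurable_coordChange hAm (inter_subset_left.trans c.carrier_subset_baseSet)
      inter_subset_right (m1.mono_measure (Measure.restrict_mono inter_subset_left le_rfl))
  rw [← Measure.restrict_restrict hcm] at m3
  refine ((aestronglyMeasurable_indicator_iff hcm).2 m3).congr ?_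
  filter_upwards [ae_restrict_mem e.open_baseSet.measurableSet] with x hx
  by_cases hxc : x ∈ c.carrier
  · rw [indicator_of_mem hxc]
  · rw [indicator_of_notMem hxc, c.ext_of_notMem f hxc]
    exact ((e.linear ℂ hx).map_zero).symm

/-- Extension by zero from the patch is bounded on `L²`, for the same reason as localization. -/
theorem exists_extend_bound : ∃ C : ℝ, ∀ (f : Coord n → V) (hf : MemLp f 2 volume),
    ∃ hs : c.ext f ∈ squareIntegrable h μ.measure,
      ‖L2Section.of h hs‖ ≤ C * ‖hf.toLp f‖ := by
  obtain ⟨C₁, hC₁, h1⟩ := h.exists_norm_sq_le c.triv c.isCompact_carrier c.carrier_subset_baseSet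
  obtain ⟨C₂, hC₂, h2, -⟩ := μ.exists_map_restrict_le c.chart_mem c.subset_target c.isCompact
  have hcm := c.isCompact_carrier.measurableSet
  have hae := aemeasurable_chart_restrict μ.measure c.subset_target c.isCompact
  set N := ‖(c.fiberEquiv.symm : V →L[ℂ] F)‖ with hN
  set D : ℝ := C₁ * N ^ 2 * C₂.toReal with hD
  have hD0 : 0 ≤ D := by positivity
  refine ⟨√D, fun f hf => ?_⟩
  have hsm := c.isMeasurableSection_ext μ hf.1
  have hf2 : Integrable (fun y => ‖f y‖ ^ 2) volume := hf.integrable_norm_pow two_ne_zero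
  obtain ⟨i1, i2⟩ := integrable_comp_and_integral_le hae hC₂ h2
    (hf2.mono_measure Measure.restrict_le_self) fun y => by positivity
  have hle : ∀ x, (h.inner x (c.ext f x) (c.ext f x)).re ≤
      c.carrier.indicator (fun x => C₁ * N ^ 2 * ‖f (c.chart x)‖ ^ 2) x := by
    intro x
    by_cases hx : x ∈ c.carrier
    · rw [indicator_of_mem hx]
      refine (h1 x hx _).2.trans ?_
      rw [c.triv_ext f hx, mul_assoc, ← mul_pow]
      gcongr
      exact (c.fiberEquiv.symm : V →L[ℂ] F).le_opNorm _
    · rw [indicator_of_notMem hx, c.ext_of_notMem f hx]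
      simp
  have i3 : Integrable (c.carrier.indicator fun x => C₁ * N ^ 2 * ‖f (c.chart x)‖ ^ 2) μ.measure :=
    (integrable_indicator_iff hcm).2 (i1.const_mul _)
  have hs : c.ext f ∈ squareIntegrable h μ.measure := by
    refine ⟨hsm, i3.mono' (h.aestronglyMeasurable_inner hsm hsm).re (.of_forall fun x => ?_)⟩
    rw [Real.norm_of_nonneg (h.self_re_nonneg x _)]
    exact hle x
  refine ⟨hs, le_of_sq_le_sq ?_ (by positivity)⟩
  rw [mul_pow, Real.sq_sqrt hD0, norm_toLp_sq, L2Section.norm_sq]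
  refine (integral_mono hs.2 i3 hle).trans ?_
  rw [integral_indicator hcm, integral_const_mul, hD, mul_assoc _ C₂.toReal]
  refine mul_le_mul_of_nonneg_left (i2.trans ?_) (by positivity)
  exact mul_le_mul_of_nonneg_left (setIntegral_le_integral hf2 (.of_forall fun y => by positivity))
    ENNReal.toReal_nonneg

/-- The localization of square integrable sections to the patch. -/
def localize : L2 h μ.measure →L[ℂ] CoordL2 n V :=
  let T : L2Section h μ.measure →L[ℂ] CoordL2 n V := LinearMap.mkContinuous
    { toFun := fun s => ((c.exists_localize_bound h μ).choose_spec s).choose.toLp _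
      map_add' := fun s t => by
        rw [← MemLp.toLp_add]
        refine MemLp.toLp_congr _ _ (.of_forall fun y => ?_)
        by_cases hy : y ∈ c.K
        · simp only [Pi.add_apply, indicator_of_mem hy]
          exact c.coord_add s.1 t.1 (c.mem_baseSet y hy)
        · simp [hy]
      map_smul' := fun z s => by
        rw [RingHom.id_apply, ← MemLp.toLp_const_smul]
        refine MemLp.toLp_congr _ _ (.of_forall fun y => ?_)
        by_cases hy : y ∈ c.K
        · simp only [Pi.smul_apply, indicator_of_mem hy]
          exact c.coord_smul z s.1 (c.mem_baseSet y hy)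
        · simp [hy] }
    (c.exists_localize_bound h μ).choose
    fun s => ((c.exists_localize_bound h μ).choose_spec s).choose_spec
  SeparationQuotient.liftCLM T fun _ _ hst => (hst.map T.continuous).eq

theorem localize_mk (s : L2Section h μ.measure) :
    ∃ hs : MemLp (c.K.indicator (c.coord s.1)) 2 volume,
      c.localize h μ (SeparationQuotient.mk s) = hs.toLp _ :=
  ⟨((c.exists_localize_bound h μ).choose_spec s).choose, rfl⟩

theorem ext_ae_eq {f g : Coord n → V} (hfg : f =ᵐ[volume] g) :
    ∀ᵐ x ∂μ.measure, c.ext f x = c.ext g x := by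
  filter_upwards [c.ae_map_chart μ hfg] with x hx
  by_cases hxc : x ∈ c.carrier
  · rw [c.ext_of_mem _ hxc, c.ext_of_mem _ hxc, hx hxc]
  · rw [c.ext_of_notMem _ hxc, c.ext_of_notMem _ hxc]

/-- Extension by zero from the patch, for square integrable sections. -/
def extend : CoordL2 n V →L[ℂ] L2 h μ.measure :=
  LinearMap.mkContinuous
    { toFun := fun f => SeparationQuotient.mk
        (L2Section.of h ((c.exists_extend_bound h μ).choose_spec f (Lp.memLp f)).choose)
      map_add' := fun f g => by
        rw [← SeparationQuotient.mk_add]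
        refine L2.mk_eq_mk_of_ae h ?_
        filter_upwards [c.ext_ae_eq μ (Lp.coeFn_add f g)] with x hx
        exact hx.trans (congrFun (c.ext_add f g) x)
      map_smul' := fun z f => by
        rw [RingHom.id_apply, ← SeparationQuotient.mk_smul]
        refine L2.mk_eq_mk_of_ae h ?_
        filter_upwards [c.ext_ae_eq μ (Lp.coeFn_smul z f)] with x hx
        exact hx.trans (congrFun (c.ext_smul z f) x) }
    (c.exists_extend_bound h μ).choose
    fun f => by
      have := ((c.exists_extend_bound h μ).choose_spec f (Lp.memLp f)).choose_spec
      exact this.trans_eq (by rw [Lp.toLp_coeFn])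

theorem extend_eq_mk (f : CoordL2 n V) {g : Coord n → V} (hfg : f =ᵐ[volume] g)
    (s : L2Section h μ.measure) (hs : ∀ᵐ x ∂μ.measure, s.1 x = c.ext g x) :
    c.extend h μ f = SeparationQuotient.mk s := by
  refine L2.mk_eq_mk_of_ae h ?_
  filter_upwards [hs, c.ext_ae_eq μ hfg] with x h1 h2
  exact h2.trans h1.symm

theorem exists_extend_eq_mk (f : CoordL2 n V) : ∃ s : L2Section h μ.measure,
    c.extend h μ f = SeparationQuotient.mk s ∧ s.1 = c.ext f :=
  ⟨_, rfl, rfl⟩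

end BundlePatch

end Operators

end Patch

/-! ### Smooth sections and differential operators in a coordinate patch -/

section SmoothSections

variable {n : ℕ} {M : Type*} [TopologicalSpace M] [ChartedSpace (EuclideanSpace ℝ (Fin n)) M]
  [IsManifold (𝓡 n) ∞ M]
  {F : Type*} [NormedAddCommGroup F] [NormedSpace ℂ F]
  {E : M → Type*} [∀ x, AddCommGroup (E x)] [∀ x, Module ℂ (E x)]
  [TopologicalSpace (TotalSpace F E)] [∀ x, TopologicalSpace (E x)]
  [FiberBundle F E] [VectorBundle ℂ F E] [ContMDiffVectorBundle ∞ F E (𝓡 n)]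
  {V : Type*} [NormedAddCommGroup V] [InnerProductSpace ℂ V]

theorem contDiff_of_forall_contDiffAt_of_tsupport {G : Type*} [NormedAddCommGroup G]
    [NormedSpace ℝ G] {f : Coord n → G} (h : ∀ y ∈ tsupport f, ContDiffAt ℝ ∞ f y) :
    ContDiff ℝ ∞ f := by
  refine contDiff_iff_contDiffAt.2 fun y => ?_
  by_cases hy : y ∈ tsupport f
  · exact h y hy
  · refine contDiffAt_const (c := (0 : G)) |>.congr_of_eventuallyEq ?_
    exact notMem_tsupport_iff_eventuallyEq.1 hy

theorem exists_smooth_cutoff (y : Coord n) {r R : ℝ} (hr : 0 < r) (hR : r < R) :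
    ∃ χ : Coord n → ℝ, ContDiff ℝ ∞ χ ∧ (∀ z ∈ Metric.closedBall y r, χ z = 1) ∧
      tsupport χ ⊆ Metric.closedBall y R := by
  let χ : ContDiffBump y := ⟨r, R, hr, hR⟩
  exact ⟨χ, χ.contDiff, fun z hz => χ.one_of_mem_closedBall hz, χ.tsupport_eq.le⟩

namespace BundlePatch

variable (c : BundlePatch n F E V)

theorem contDiffAt_coord (u : smoothSections (n := n) F E) {y : Coord n}
    (hy : y ∈ c.chart.target) (hb : c.chart.symm y ∈ c.triv.baseSet) :
    ContDiffAt ℝ ∞ (c.coord u.1) y := by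
  have h1 : ContMDiffAt (𝓡 n) 𝓘(ℝ, F) ∞ (fun x => (c.triv ⟨x, u.1 x⟩).2) (c.chart.symm y) :=
    (c.triv.contMDiffAt_section_iff hb).1 (u.2 _)
  have h2 : ContMDiffAt (𝓡 n) (𝓡 n) ∞ c.chart.symm y :=
    contMDiffAt_symm_of_mem_maximalAtlas c.chart_mem hy
  have h3 : ContDiffAt ℝ ∞ (fun z => (c.triv ⟨c.chart.symm z, u.1 (c.chart.symm z)⟩).2) y :=
    contMDiffAt_iff_contDiffAt.1 (h1.comp y h2)
  exact ((c.fiberEquiv : F →L[ℂ] V).restrictScalars ℝ).contDiff.contDiffAt.comp y h3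

/-- A smooth function of the coordinates, supported in the patch, defines a smooth section. -/
def extSection [T2Space M] {w : Coord n → V} (hw : ContDiff ℝ ∞ w) (hws : tsupport w ⊆ c.K) :
    smoothSections (n := n) F E := by
  refine ⟨c.ext w, fun x => ?_⟩
  by_cases hx : x ∈ c.carrier
  · have hb := c.carrier_subset_baseSet hx
    refine (c.triv.contMDiffAt_section_iff hb).2 ?_
    have h1 : ContMDiffAt (𝓡 n) 𝓘(ℝ, F) ∞ (fun x => c.fiberEquiv.symm (w (c.chart x))) x := by
      have h2 : ContDiff ℝ ∞ fun y => c.fiberEquiv.symm (w y) :=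
        ((c.fiberEquiv.symm : V →L[ℂ] F).restrictScalars ℝ).contDiff.comp hw
      exact h2.contMDiff.contMDiffAt.comp x (contMDiffAt_of_mem_maximalAtlas c.chart_mem hx.1)
    refine h1.congr_of_eventuallyEq ?_
    filter_upwards [c.chart.open_source.mem_nhds hx.1, c.triv.open_baseSet.mem_nhds hb]
      with z hz hzb
    by_cases hzc : z ∈ c.carrier
    · exact c.triv_ext w hzc
    · have h0 : w (c.chart z) = 0 :=
        image_eq_zero_of_notMem_tsupport fun h => hzc ⟨hz, hws h⟩
      rw [c.ext_of_notMem w hzc, h0, map_zero]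
      exact (c.triv.linear ℂ hzb).map_zero
  · refine (contMDiff_zeroSection ℝ E x).congr_of_eventuallyEq ?_
    filter_upwards [c.isCompact_carrier.isClosed.isOpen_compl.mem_nhds hx] with z hz
    rw [c.ext_of_notMem w hz]
    rfl

variable [CompactSpace M] [MeasurableSpace M] [BorelSpace M] [FiniteDimensional ℂ F]
  (h : HermitianMetric (n := n) F E) (μ : SmoothDensity n M) [T2Space M]

theorem extend_toLp {w : Coord n → V} (hw2 : MemLp w 2 volume)
    {u : smoothSections (n := n) F E} (hu : u.1 = c.ext w) :
    c.extend h μ (hw2.toLp w) = toL2 h μ u :=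
  c.extend_eq_mk h μ _ hw2.coeFn_toLp _ (.of_forall fun x => congrFun hu x)

theorem localize_toL2 (u : smoothSections (n := n) F E) :
    c.localize h μ (toL2 h μ u) =ᵐ[volume] c.K.indicator (c.coord u.1) := by
  obtain ⟨hs, e⟩ := c.localize_mk h μ
    (Submodule.inclusion (smoothSections_le_squareIntegrable h μ) u)
  have e' : c.localize h μ (toL2 h μ u) = hs.toLp _ := e
  rw [e']
  exact hs.coeFn_toLp

end BundlePatch

end SmoothSections

section LocalModel

variable {n p : ℕ} {M : Type*} [TopologicalSpace M] [ChartedSpace (EuclideanSpace ℝ (Fin n)) M]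
  [IsManifold (𝓡 n) ∞ M]
  {fol : Foliation n M p}
  {F : Type*} [NormedAddCommGroup F] [NormedSpace ℂ F]
  {E : M → Type*} [∀ x, AddCommGroup (E x)] [∀ x, Module ℂ (E x)]
  [TopologicalSpace (TotalSpace F E)] [∀ x, TopologicalSpace (E x)]
  [FiberBundle F E] [VectorBundle ℂ F E]
  {F' : Type*} [NormedAddCommGroup F'] [NormedSpace ℂ F']
  {E' : M → Type*} [∀ x, AddCommGroup (E' x)] [∀ x, Module ℂ (E' x)]
  [TopologicalSpace (TotalSpace F' E')] [∀ x, TopologicalSpace (E' x)]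
  [FiberBundle F' E'] [VectorBundle ℂ F' E']
  {V : Type*} [NormedAddCommGroup V] [InnerProductSpace ℂ V]
  {W : Type*} [NormedAddCommGroup W] [InnerProductSpace ℂ W]
  {d : ℕ} {P : smoothSections (n := n) F E →ₗ[ℂ] smoothSections (n := n) F' E'}

theorem wordDeriv_comp_equiv {G H : Type*} [NormedAddCommGroup G] [NormedSpace ℂ G]
    [NormedAddCommGroup H] [NormedSpace ℂ H] (T : G ≃L[ℂ] H) (l : List (Fin n)) (f : Coord n → G) :
    wordDeriv l (fun y => T (f y)) = fun y => T (wordDeriv l f y) := by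
  induction l with
  | nil => rfl
  | cons i l ih =>
    change partialDeriv i (wordDeriv l fun y => T (f y)) = _
    rw [ih]
    funext y
    let T' : G ≃L[ℝ] H :=
      ⟨T.toLinearEquiv.restrictScalars ℝ, T.continuous, T.symm.continuous⟩
    have := T'.comp_fderiv (f := wordDeriv l f) (x := y)
    exact congrArg (fun A => A (EuclideanSpace.single i 1)) this

theorem LocalFrame.isOpen_domain (c : LocalFrame fol F E F' E') : IsOpen c.domain :=
  (c.chart.open_source.inter c.triv.open_baseSet).inter c.triv'.open_baseSet

theorem LocalFrame.isOpen_image_domain (c : LocalFrame fol F E F' E') :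
    IsOpen (c.chart '' c.domain) :=
  c.chart.isOpen_image_of_subset_source c.isOpen_domain fun _ hx => hx.1.1

theorem LocalFrame.symm_mem_domain (c : LocalFrame fol F E F' E') {y : Coord n}
    (hy : y ∈ c.chart '' c.domain) : y ∈ c.chart.target ∧ c.chart.symm y ∈ c.domain := by
  obtain ⟨x, hx, rfl⟩ := hy
  exact ⟨c.chart.map_source hx.1.1, by rwa [c.chart.left_inv hx.1.1]⟩

/-- Differential operators are local: they do not increase supports. -/
theorem IsWeightedDiffOp.apply_eq_zero (hP : IsWeightedDiffOp fol d P)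
    (u : smoothSections (n := n) F E) {x : M} (hu : ∀ᶠ z in 𝓝 x, u.1 z = 0) :
    (P u).1 x = 0 := by
  obtain ⟨c, hx, a, -, ha⟩ := hP x
  have hxs := hx.1.1
  have hxt := c.chart.map_source hxs
  have h1 : c.localSection u.1 =ᶠ[𝓝 (c.chart x)] fun _ => 0 := by
    have h2 : Filter.Tendsto c.chart.symm (𝓝 (c.chart x)) (𝓝 x) := by
      have := c.chart.continuousAt_symm hxt
      rwa [ContinuousAt, c.chart.left_inv hxs] at this
    filter_upwards [h2.eventually hu, h2.eventually (c.triv.open_baseSet.mem_nhds hx.1.2)]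
      with y hy hyb
    have := c.triv_mem
    rw [LocalFrame.localSection, hy]
    exact (c.triv.linear ℂ hyb).map_zero
  have h3 : (c.triv' ⟨x, (P u).1 x⟩).2 = 0 := by
    rw [ha u x hx]
    refine Finset.sum_eq_zero fun α _ => ?_
    have h4 : wordDeriv (multiWord α) (fun _ : Coord n => (0 : F)) (c.chart x) = 0 :=
      wordDeriv_eq_zero (by simp [tsupport, Function.support]) _
    rw [multiDeriv_eq_wordDeriv, (wordDeriv_congr h1 _).eq_of_nhds, h4, map_zero]
  have := c.triv'_mem
  rw [← c.triv'.symm_apply_apply_mk hx.2 ((P u).1 x), h3, ← c.triv'.symmₗ_apply (R := ℂ) hx.2,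
    map_zero]

/-- Near every point, `P` is a differential operator whose coefficients are smooth functions on the
whole coordinate space, with values in the linear maps between the given fibres `V` and `W`. -/
theorem exists_local_model (hP : IsWeightedDiffOp fol d P)
    (hσ : HasInvertibleWeightedSymbol fol d P) (ι₁ : F ≃L[ℂ] V) (ι₂ : F' ≃L[ℂ] W) (x : M) :
    ∃ (c : LocalFrame fol F E F' E') (R : ℝ) (a : multiIndices n p d → Coord n → V →L[ℂ] W),
      x ∈ c.domain ∧ 0 < R ∧ Metric.closedBall (c.chart x) R ⊆ c.chart '' c.domain ∧
      (∀ t, ContDiff ℝ ∞ (a t)) ∧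
      (∀ ξ : Fin n → ℝ, ξ ≠ 0 →
        (wordSymbol p d a (fun t => multiWord t.1) (c.chart x) ξ).IsInvertible) ∧
      ∀ u, ∀ y ∈ Metric.closedBall (c.chart x) R,
        ι₂ (c.triv' ⟨c.chart.symm y, (P u).1 (c.chart.symm y)⟩).2 =
          wordOp a (fun t => multiWord t.1)
            (fun z => ι₁ (c.triv ⟨c.chart.symm z, u.1 (c.chart.symm z)⟩).2) y := by
  obtain ⟨c, hx, a, hac, ha⟩ := hP x
  obtain ⟨R, hR, hRc⟩ := Metric.nhds_basis_closedBall.mem_iff.1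
    (c.isOpen_image_domain.mem_nhds (mem_image_of_mem _ hx))
  obtain ⟨χ, hχ, hχ1, hχs⟩ := exists_smooth_cutoff (c.chart x) (half_pos hR) (half_lt_self hR)
  let T : (F →L[ℂ] F') →L[ℂ] (V →L[ℂ] W) :=
    (ContinuousLinearMap.compL ℂ V F' W (ι₂ : F' →L[ℂ] W)) ∘L
      (ContinuousLinearMap.compL ℂ V F F').flip (ι₁.symm : V →L[ℂ] F)
  have hT : ∀ A v, T A v = ι₂ (A (ι₁.symm v)) := fun A v => rfl
  let b : multiIndices n p d → Coord n → V →L[ℂ] W := fun t y => χ y • T (a t.1 y)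
  have hb1 : ∀ y ∈ Metric.closedBall (c.chart x) (R / 2), ∀ t, b t y = T (a t.1 y) :=
    fun y hy t => by simp only [b, hχ1 y hy, one_smul]
  refine ⟨c, R / 2, b, hx, half_pos hR,
    (Metric.closedBall_subset_closedBall (half_le_self hR.le)).trans hRc, fun t => ?_,
    fun ξ hξ => ?_, fun u y hy => ?_⟩
  · refine contDiff_of_forall_contDiffAt_of_tsupport fun y hy => ?_
    have hs : Function.support (b t) ⊆ Function.support χ :=
      fun z hz h0 => hz (by simp only [b, h0, zero_smul])
    have hy' : y ∈ c.chart '' c.domain := hRc (hχs (closure_mono hs hy))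
    have h1 : ContDiffAt ℝ ∞ (a t.1) y :=
      (hac t.1 t.2).contDiffAt (c.isOpen_image_domain.mem_nhds hy')
    exact hχ.contDiffAt.smul ((T.restrictScalars ℝ).contDiff.contDiffAt.comp y h1)
  · have h1 := hσ c a ⟨hac, ha⟩ x hx ξ hξ
    have h2 : wordSymbol p d b (fun t => multiWord t.1) (c.chart x) ξ =
        T (weightedSymbol p d a (c.chart x) ξ) := by
      simp only [wordSymbol, weightedSymbol, map_sum, map_smul, wordWeight_multiWord,
        wordMonomial_multiWord, hb1 _ (Metric.mem_closedBall_self (half_pos hR).le)]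
      rw [Finset.sum_filter, Finset.sum_filter]
      exact Finset.sum_coe_sort (multiIndices n p d) fun α => if weightedDegree p α = d then
        (∏ i, (Complex.I * (ξ i : ℂ)) ^ α i) • T (a α (c.chart x)) else 0
    obtain ⟨S, hS⟩ := h1
    refine ⟨(ι₁.symm.trans S).trans ι₂, ?_⟩
    rw [h2, ← hS]
    rfl
  · have hyc := c.symm_mem_domain (hRc (Metric.closedBall_subset_closedBall
      (half_le_self hR.le) hy))
    have h1 := ha u _ hyc.2
    rw [c.chart.right_inv hyc.1] at h1
    rw [h1, map_sum, wordOp]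
    simp only [hb1 y hy, hT, multiDeriv_eq_wordDeriv]
    rw [← Finset.sum_coe_sort (multiIndices n p d)]
    refine Finset.sum_congr rfl fun t _ => ?_
    rw [wordDeriv_comp_equiv ι₁, ContinuousLinearEquiv.symm_apply_apply]
    rfl

end LocalModel

/-! ### Local consequences of the invertibility of the symbol -/

section MulSelfAdjoint

variable {n : ℕ} {V : Type*} [NormedAddCommGroup V] [InnerProductSpace ℂ V] [CompleteSpace V]

theorem inner_mulLp_smulId {φ : Coord n → ℝ} (hφ : MemLp (smulId V φ) ⊤ volume)
    (f g : CoordL2 n V) :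
    inner ℂ (mulLp (smulId V φ) f) g = inner ℂ f (mulLp (smulId V φ) g) := by
  rw [MeasureTheory.L2.inner_def, MeasureTheory.L2.inner_def]
  refine integral_congr_ae ?_
  filter_upwards [coeFn_mulLp hφ f, coeFn_mulLp hφ g] with y h1 h2
  rw [h1, h2, smulId_apply, smulId_apply, ← Complex.coe_smul, ← Complex.coe_smul, inner_smul_left,
    inner_smul_right, Complex.conj_ofReal]

end MulSelfAdjoint

section LocalForm

variable {n p : ℕ} {M : Type*} [TopologicalSpace M] [ChartedSpace (EuclideanSpace ℝ (Fin n)) M]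
  [IsManifold (𝓡 n) ∞ M] [T2Space M]
  {fol : Foliation n M p}
  {F : Type*} [NormedAddCommGroup F] [NormedSpace ℂ F]
  {E : M → Type*} [∀ x, AddCommGroup (E x)] [∀ x, Module ℂ (E x)]
  [TopologicalSpace (TotalSpace F E)] [∀ x, TopologicalSpace (E x)]
  [FiberBundle F E] [VectorBundle ℂ F E] [ContMDiffVectorBundle ∞ F E (𝓡 n)]
  {F' : Type*} [NormedAddCommGroup F'] [NormedSpace ℂ F']
  {E' : M → Type*} [∀ x, AddCommGroup (E' x)] [∀ x, Module ℂ (E' x)]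
  [TopologicalSpace (TotalSpace F' E')] [∀ x, TopologicalSpace (E' x)]
  [FiberBundle F' E'] [VectorBundle ℂ F' E'] [ContMDiffVectorBundle ∞ F' E' (𝓡 n)]
  {V : Type*} [NormedAddCommGroup V] [InnerProductSpace ℂ V]
  {W : Type*} [NormedAddCommGroup W] [InnerProductSpace ℂ W]
  {d : ℕ} {P : smoothSections (n := n) F E →ₗ[ℂ] smoothSections (n := n) F' E'}
  {ι : Type} [Fintype ι]

/-- In the patches `c₁` and `c₂`, which have the same coordinates, the operator `P` is given by
`∑ₜ aₜ ∂^{lₜ}`, with coefficients that are smooth on the whole coordinate space. The last condition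
provides room around the patch for a smooth cutoff. -/
structure IsLocalForm (P : smoothSections (n := n) F E →ₗ[ℂ] smoothSections (n := n) F' E')
    (c₁ : BundlePatch n F E V) (c₂ : BundlePatch n F' E' W) (a : ι → Coord n → V →L[ℂ] W)
    (l : ι → List (Fin n)) : Prop where
  chart_eq : c₂.chart = c₁.chart
  K_eq : c₂.K = c₁.K
  contDiff : ∀ t, ContDiff ℝ ∞ (a t)
  formula : ∀ u, ∀ y ∈ c₁.K, c₂.coord (P u).1 y = wordOp a l (c₁.coord u.1) y
  exists_cutoff : ∃ χ : Coord n → ℝ, ContDiff ℝ ∞ χ ∧ HasCompactSupport χ ∧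
    (∀ y ∈ c₁.K, ∀ᶠ z in 𝓝 y, χ z = 1) ∧
    ∀ y ∈ tsupport χ, y ∈ c₁.chart.target ∧ c₁.chart.symm y ∈ c₁.triv.baseSet

theorem BundlePatch.coord_ext_eventuallyEq (c : BundlePatch n F E V) {w : Coord n → V}
    (hws : tsupport w ⊆ c.K) {y : Coord n} (hy : y ∈ c.K) : c.coord (c.ext w) =ᶠ[𝓝 y] w := by
  have ho : IsOpen (c.chart.target ∩ c.chart.symm ⁻¹' c.triv.baseSet) :=
    c.chart.isOpen_inter_preimage_symm c.triv.open_baseSet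
  filter_upwards [ho.mem_nhds ⟨c.subset_target hy, c.mem_baseSet y hy⟩] with z hz
  by_cases hzK : z ∈ c.K
  · rw [coord, c.triv_ext w (c.symm_mem_carrier hzK), ContinuousLinearEquiv.apply_symm_apply,
      c.chart.right_inv hz.1]
  · have h0 : w z = 0 := image_eq_zero_of_notMem_tsupport fun h => hzK (hws h)
    have h1 : c.chart.symm z ∉ c.carrier := fun h => hzK (by
      have := h.2
      rwa [mem_preimage, c.chart.right_inv hz.1] at this)
    have h2 : (c.triv ⟨c.chart.symm z, (0 : E (c.chart.symm z))⟩).2 = 0 :=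
      (c.triv.linear ℂ hz.2).map_zero
    rw [coord, c.ext_of_notMem w h1, h2, h0, map_zero]

namespace IsLocalForm

variable {c₁ : BundlePatch n F E V} {c₂ : BundlePatch n F' E' W} {a : ι → Coord n → V →L[ℂ] W}
  {l : ι → List (Fin n)}

/-- `P` acts on sections supported in the patch by its coordinate expression, and by locality the
result vanishes outside the patch. -/
theorem apply_extSection (hf : IsLocalForm P c₁ c₂ a l) (hP : IsWeightedDiffOp fol d P)
    {w : Coord n → V} (hw : ContDiff ℝ ∞ w) (hws : tsupport w ⊆ c₁.K) :
    (P (c₁.extSection hw hws)).1 = c₂.ext (wordOp a l w) := by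
  have hcar : c₂.carrier = c₁.carrier := by
    rw [BundlePatch.carrier, BundlePatch.carrier, hf.chart_eq, hf.K_eq]
  funext x
  by_cases hx : x ∈ c₂.carrier
  · have hy : c₂.chart x ∈ c₁.K := hf.K_eq ▸ hx.2
    have h1 : c₂.coord (P (c₁.extSection hw hws)).1 (c₂.chart x) =
        wordOp a l (c₁.coord (c₁.ext w)) (c₂.chart x) := hf.formula (c₁.extSection hw hws) _ hy
    rw [wordOp_congr a l (c₁.coord_ext_eventuallyEq hws hy)] at h1
    rw [← c₂.ext_coord (P (c₁.extSection hw hws)).1 hx, c₂.ext_of_mem _ hx, c₂.ext_of_mem _ hx, h1]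
  · rw [c₂.ext_of_notMem _ hx]
    refine hP.apply_eq_zero _ ?_
    rw [hcar] at hx
    filter_upwards [c₁.isCompact_carrier.isClosed.isOpen_compl.mem_nhds hx] with z hz
    exact c₁.ext_of_notMem w hz

variable [CompactSpace M] [MeasurableSpace M] [BorelSpace M]
  [FiniteDimensional ℂ F] [FiniteDimensional ℂ F']
  (h : HermitianMetric (n := n) F E) (h' : HermitianMetric (n := n) F' E') (μ : SmoothDensity n M)

theorem _root_.WeightedFoliation.mem_graph_unboundedOperator
    {z : L2 h μ.measure × L2 h' μ.measure} :
    z ∈ (unboundedOperator h h' μ P).graph ↔ ∃ u, z = (toL2 h μ u, toL2 h' μ (P u)) := by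
  have key : ∀ u, unboundedOperator h h' μ P ⟨toL2 h μ u, u, rfl⟩ = toL2 h' μ (P u) := by
    intro u
    change toL2 h' μ (P ((LinearEquiv.ofInjective (toL2 h μ) (toL2_injective h μ)).symm
      ⟨toL2 h μ u, u, rfl⟩)) = _
    congr 2
    exact (LinearEquiv.ofInjective (toL2 h μ) (toL2_injective h μ)).symm_apply_apply u
  rw [LinearPMap.mem_graph_iff]
  constructor
  · rintro ⟨⟨_, u, rfl⟩, h1, h2⟩
    exact ⟨u, Prod.ext h1.symm (h2.symm.trans (key u))⟩
  · rintro ⟨u, rfl⟩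
    exact ⟨⟨toL2 h μ u, u, rfl⟩, rfl, key u⟩

variable [FiniteDimensional ℂ V] [FiniteDimensional ℂ W]

/-- The closure of `P` on functions supported in the patch contains the closure of its coordinate
expression. -/
theorem extend_mem_closure_graph (hf : IsLocalForm P c₁ c₂ a l) (hP : IsWeightedDiffOp fol d P)
    {f : CoordL2 n V} {g : CoordL2 n W}
    (hfg : ∀ ε > 0, ∃ w : Coord n → V, ContDiff ℝ ∞ w ∧ tsupport w ⊆ c₁.K ∧
      ∃ (h₁ : MemLp w 2 volume) (h₂ : MemLp (wordOp a l w) 2 volume),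
        ‖h₁.toLp w - f‖ ≤ ε ∧ ‖h₂.toLp (wordOp a l w) - g‖ ≤ ε) :
    (c₁.extend h μ f, c₂.extend h' μ g) ∈
      (unboundedOperator h h' μ P).graph.topologicalClosure := by
  let S : Set (CoordL2 n V × CoordL2 n W) := {z | ∃ w : Coord n → V, ContDiff ℝ ∞ w ∧
    tsupport w ⊆ c₁.K ∧ ∃ (h₁ : MemLp w 2 volume) (h₂ : MemLp (wordOp a l w) 2 volume),
      z = (h₁.toLp w, h₂.toLp (wordOp a l w))}
  have hS : (f, g) ∈ closure S := by
    refine Metric.mem_closure_iff.2 fun ε hε => ?_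
    obtain ⟨w, hw, hws, h₁, h₂, e₁, e₂⟩ := hfg (ε / 2) (half_pos hε)
    refine ⟨_, ⟨w, hw, hws, h₁, h₂, rfl⟩, ?_⟩
    rw [Prod.dist_eq, dist_comm, dist_eq_norm, dist_comm, dist_eq_norm]
    exact (max_le e₁ e₂).trans_lt (half_lt_self hε)
  have hc : Continuous fun z : CoordL2 n V × CoordL2 n W =>
      (c₁.extend h μ z.1, c₂.extend h' μ z.2) := by fun_prop
  refine map_mem_closure (f := fun z : CoordL2 n V × CoordL2 n W =>
      (c₁.extend h μ z.1, c₂.extend h' μ z.2)) hc hS ?_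
  rintro _ ⟨w, hw, hws, h₁, h₂, rfl⟩
  refine (mem_graph_unboundedOperator h h' μ).2 ⟨c₁.extSection hw hws, ?_⟩
  rw [← c₁.extend_toLp h μ h₁ rfl, ← c₂.extend_toLp h' μ h₂ (hf.apply_extSection hP hw hws)]

/-- Elements of the closure of the graph of `P` satisfy the equation in the patch in the weak
sense. -/
theorem inner_localize_eq (hf : IsLocalForm P c₁ c₂ a l) {κ : Type} [Fintype κ]
    {b : κ → Coord n → W →L[ℂ] V} {m : κ → List (Fin n)}
    (hadj : ∀ (f : Coord n → V) (g : Coord n → W), ContDiff ℝ ∞ f → HasCompactSupport f →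
      ContDiff ℝ ∞ g → HasCompactSupport g →
      ∫ y, inner ℂ (wordOp a l f y) (g y) = ∫ y, inner ℂ (f y) (wordOp b m g y))
    {u : L2 h μ.measure} {v : L2 h' μ.measure}
    (huv : (u, v) ∈ (unboundedOperator h h' μ P).graph.topologicalClosure)
    {w : Coord n → W} (hw : ContDiff ℝ ∞ w) (hws : tsupport w ⊆ c₁.K)
    (h₁ : MemLp w 2 volume) (h₂ : MemLp (wordOp b m w) 2 volume) :
    inner ℂ (c₂.localize h' μ v) (h₁.toLp w) =
      inner ℂ (c₁.localize h μ u) (h₂.toLp (wordOp b m w)) := by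
  let S : Set (L2 h μ.measure × L2 h' μ.measure) := {z |
    inner ℂ (c₂.localize h' μ z.2) (h₁.toLp w) =
      inner ℂ (c₁.localize h μ z.1) (h₂.toLp (wordOp b m w))}
  have hS : IsClosed S := by
    refine isClosed_eq ?_ ?_
    · exact ((c₂.localize h' μ).continuous.comp continuous_snd).inner continuous_const
    · exact ((c₁.localize h μ).continuous.comp continuous_fst).inner continuous_const
  refine closure_minimal (t := S) ?_ hS huv
  intro z hz
  obtain ⟨s, rfl⟩ := (mem_graph_unboundedOperator h h' μ).1 hz
  obtain ⟨χ, hχ, hχs, hχ1, hχt⟩ := hf.exists_cutoff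
  set s' : Coord n → V := fun y => χ y • c₁.coord s.1 y with hs'
  have hsub : Function.support s' ⊆ Function.support χ :=
    fun y hy h0 => hy (by simp only [hs', h0, zero_smul])
  have hs's : ContDiff ℝ ∞ s' := by
    refine contDiff_of_forall_contDiffAt_of_tsupport fun y hy => ?_
    obtain ⟨hy1, hy2⟩ := hχt y (closure_mono hsub hy)
    exact hχ.contDiffAt.smul (c₁.contDiffAt_coord s hy1 hy2)
  have hs'c : HasCompactSupport s' := hχs.mono hsub
  have hwc : HasCompactSupport w := c₁.isCompact.of_isClosed_subset isClosed_closure hws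
  have key := hadj s' w hs's hs'c hw hwc
  change inner ℂ (c₂.localize h' μ (toL2 h' μ (P s))) (h₁.toLp w) =
      inner ℂ (c₁.localize h μ (toL2 h μ s)) (h₂.toLp (wordOp b m w))
  rw [MeasureTheory.L2.inner_def, MeasureTheory.L2.inner_def]
  refine Eq.trans (integral_congr_ae ?_) (key.trans (integral_congr_ae ?_))
  · filter_upwards [c₂.localize_toL2 h' μ (P s), h₁.coeFn_toLp] with y e₁ e₂
    rw [e₁, e₂]
    by_cases hy : y ∈ c₁.K
    · have e₃ : s' =ᶠ[𝓝 y] c₁.coord s.1 := by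
        filter_upwards [hχ1 y hy] with z hz
        simp only [hs', hz, one_smul]
      rw [indicator_of_mem (hf.K_eq ▸ hy), hf.formula s y hy, wordOp_congr a l e₃]
    · rw [image_eq_zero_of_notMem_tsupport fun h => hy (hws h), inner_zero_right, inner_zero_right]
  · filter_upwards [c₁.localize_toL2 h μ s, h₂.coeFn_toLp] with y e₁ e₂
    rw [e₁, e₂]
    by_cases hy : y ∈ c₁.K
    · rw [indicator_of_mem hy]
      simp only [hs', (hχ1 y hy).self_of_nhds, one_smul]
    · rw [wordOp_eq_zero b m fun h => hy (hws h), inner_zero_right, inner_zero_right]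

/-- Closability of `P` in the patch: the formal adjoint of `P` shows that the limit `v` of `P uₖ`,
for `uₖ → 0`, is orthogonal to all test functions. -/
theorem mulLp_localize_eq_zero (hf : IsLocalForm P c₁ c₂ a l) {κ : Type} [Fintype κ]
    {b : κ → Coord n → W →L[ℂ] V} {m : κ → List (Fin n)} (hb : ∀ t, ContDiff ℝ ∞ (b t))
    (hadj : ∀ (f : Coord n → V) (g : Coord n → W), ContDiff ℝ ∞ f → HasCompactSupport f →
      ContDiff ℝ ∞ g → HasCompactSupport g →
      ∫ y, inner ℂ (wordOp a l f y) (g y) = ∫ y, inner ℂ (f y) (wordOp b m g y))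
    {v : L2 h' μ.measure}
    (hv : (0, v) ∈ (unboundedOperator h h' μ P).graph.topologicalClosure)
    {φ : Coord n → ℝ} (hφ : ContDiff ℝ ∞ φ) (hφs : tsupport φ ⊆ c₁.K) :
    mulLp (smulId W φ) (c₂.localize h' μ v) = 0 := by
  have hφc : HasCompactSupport φ := c₁.isCompact.of_isClosed_subset isClosed_closure hφs
  have hφW : MemLp (smulId W φ) ⊤ volume :=
    memLp_top_of_hasCompactSupport (contDiff_smulId hφ).continuous (hasCompactSupport_smulId hφc)
  set f := c₂.localize h' μ v with hfdef
  have hsmooth : ∀ g : Coord n → W, ContDiff ℝ ∞ g → HasCompactSupport g →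
      ∀ hg : MemLp g 2 volume, inner ℂ (mulLp (smulId W φ) f) (hg.toLp g) = (0 : ℂ) := by
    intro g hg hgs hg2
    have hw : ContDiff ℝ ∞ fun y => φ y • g y := hφ.smul hg
    have hws : tsupport (fun y => φ y • g y) ⊆ c₁.K :=
      (tsupport_smul_subset_left φ g).trans hφs
    have hwc : HasCompactSupport fun y => φ y • g y := hφc.smul_right
    have h₁ : MemLp (fun y => φ y • g y) 2 volume := hw.continuous.memLp_of_hasCompactSupport hwc
    have h₂ : MemLp (wordOp b m fun y => φ y • g y) 2 volume :=
      (contDiff_wordOp hb m hw).continuous.memLp_of_hasCompactSupport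
        (hwc.mono' (subset_closure.trans (tsupport_wordOp_subset b m _)))
    rw [inner_mulLp_smulId hφW, mulLp_toLp hφW hg2 h₁ fun y => rfl, hfdef,
      hf.inner_localize_eq h h' μ hadj hv hw hws h₁ h₂, map_zero, inner_zero_left]
  set T : CoordL2 n W →L[ℂ] ℂ := innerSL ℂ (mulLp (smulId W φ) f) with hT
  have hT0 : ‖T‖ ≤ 0 := opNorm_le_of_smooth T le_rfl fun g hg hgs hg2 => by
    rw [hT, innerSL_apply_apply, hsmooth g hg hgs hg2, norm_zero, zero_mul]
  rw [← inner_self_eq_zero (𝕜 := ℂ)]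
  have hT1 := T.le_of_opNorm_le hT0 (mulLp (smulId W φ) f)
  rw [zero_mul] at hT1
  exact norm_le_zero_iff.1 hT1

/-- The kernel of the closure of `P` is controlled in the patch by the right parametrix of the
formal adjoint. -/
theorem mulLp_localize_eq_neg_adjoint (hf : IsLocalForm P c₁ c₂ a l) {κ : Type} [Fintype κ]
    {b : κ → Coord n → W →L[ℂ] V} {m : κ → List (Fin n)}
    (hadj : ∀ (f : Coord n → V) (g : Coord n → W), ContDiff ℝ ∞ f → HasCompactSupport f →
      ContDiff ℝ ∞ g → HasCompactSupport g →
      ∫ y, inner ℂ (wordOp a l f y) (g y) = ∫ y, inner ℂ (f y) (wordOp b m g y))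
    {u : L2 h μ.measure}
    (hu : (u, 0) ∈ (unboundedOperator h h' μ P).graph.topologicalClosure)
    {φ : Coord n → ℝ} (hφ : ContDiff ℝ ∞ φ) (hφs : tsupport φ ⊆ c₁.K)
    {Q : CoordL2 n V →L[ℂ] CoordL2 n W} {K : CoordL2 n V →L[ℂ] CoordL2 n V}
    (hQ : ∀ f, ∀ ε > 0, ∃ w : Coord n → W, ContDiff ℝ ∞ w ∧ tsupport w ⊆ tsupport φ ∧
      ∃ (h₁ : MemLp w 2 volume) (h₂ : MemLp (wordOp b m w) 2 volume),
        ‖h₁.toLp w - Q f‖ ≤ ε ∧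
          ‖h₂.toLp (wordOp b m w) - (mulLp (smulId V φ) f + K f)‖ ≤ ε) :
    mulLp (smulId V φ) (c₁.localize h μ u) =
      -ContinuousLinearMap.adjoint K (c₁.localize h μ u) := by
  have hφc : HasCompactSupport φ := c₁.isCompact.of_isClosed_subset isClosed_closure hφs
  have hφV : MemLp (smulId V φ) ⊤ volume :=
    memLp_top_of_hasCompactSupport (contDiff_smulId hφ).continuous (hasCompactSupport_smulId hφc)
  set f := c₁.localize h μ u with hfdef
  have key : ∀ g : CoordL2 n V, inner ℂ f (mulLp (smulId V φ) g + K g) = (0 : ℂ) := by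
    intro g
    refine norm_le_zero_iff.1 (le_of_forall_pos_le_add fun ε hε => ?_)
    obtain ⟨w, hw, hws, h₁, h₂, -, e₂⟩ := hQ g (ε / (‖f‖ + 1)) (by positivity)
    have h0 : inner ℂ f (h₂.toLp (wordOp b m w)) = (0 : ℂ) := by
      rw [hfdef, ← hf.inner_localize_eq h h' μ hadj hu hw (hws.trans hφs) h₁ h₂, map_zero,
        inner_zero_left]
    rw [zero_add, ← sub_zero (inner ℂ f _), ← h0, ← inner_sub_right]
    refine (norm_inner_le_norm _ _).trans ?_
    rw [norm_sub_rev]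
    calc ‖f‖ * _ ≤ (‖f‖ + 1) * (ε / (‖f‖ + 1)) := by gcongr; linarith
      _ = ε := by field_simp
  rw [eq_neg_iff_add_eq_zero, ← inner_self_eq_zero (𝕜 := ℂ)]
  set g := mulLp (smulId V φ) f + ContinuousLinearMap.adjoint K f with hg
  have h1 := key g
  rw [inner_add_right, ← inner_mulLp_smulId hφV, ← ContinuousLinearMap.adjoint_inner_left,
    ← inner_add_left] at h1
  exact h1

end IsLocalForm

end LocalForm

/-! ### Patching the local parametrices -/

section Localization

variable {n : ℕ} {M : Type*} [TopologicalSpace M] [ChartedSpace (EuclideanSpace ℝ (Fin n)) M]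
  [IsManifold (𝓡 n) ∞ M] [T2Space M] [CompactSpace M]

/-- A smooth function on the manifold which is supported in a chart, in the coordinates of this
chart. -/
theorem exists_contDiff_of_tsupport_subset_region
    {φ : OpenPartialHomeomorph M (Coord n)} (hφ : φ ∈ IsManifold.maximalAtlas (𝓡 n) ∞ M)
    {K : Set (Coord n)} {ρ : M → ℝ} (hρ : ContMDiff (𝓡 n) 𝓘(ℝ, ℝ) ∞ ρ)
    (hρs : tsupport ρ ⊆ region φ K) :
    ∃ g : Coord n → ℝ, ContDiff ℝ ∞ g ∧ tsupport g ⊆ K ∧ ∀ x ∈ φ.source, g (φ x) = ρ x := by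
  classical
  have hc : IsCompact (φ '' tsupport ρ) := (isClosed_tsupport ρ).isCompact.image_of_continuousOn
    (φ.continuousOn.mono fun x hx => (hρs hx).1)
  set g : Coord n → ℝ := fun y => if y ∈ φ.target then ρ (φ.symm y) else 0 with hg
  have hgs : tsupport g ⊆ φ '' tsupport ρ := by
    refine closure_minimal (fun y hy => ?_) hc.isClosed
    have hyt : y ∈ φ.target := by
      by_contra h0
      exact hy (if_neg h0)
    have h1 : g y = ρ (φ.symm y) := if_pos hyt
    exact ⟨φ.symm y, subset_closure fun h0 => hy (h1.trans h0), φ.right_inv hyt⟩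
  refine ⟨g, ?_, hgs.trans ?_, fun x hx => ?_⟩
  · refine contDiff_of_forall_contDiffAt_of_tsupport fun y hy => ?_
    obtain ⟨x, hx, rfl⟩ := hgs hy
    have hxt := φ.map_source (hρs hx).1
    have h1 : ContMDiffAt (𝓡 n) 𝓘(ℝ, ℝ) ∞ (fun z => ρ (φ.symm z)) (φ x) :=
      hρ.contMDiffAt.comp _ (contMDiffAt_symm_of_mem_maximalAtlas hφ hxt)
    refine (contMDiffAt_iff_contDiffAt.1 h1).congr_of_eventuallyEq ?_
    filter_upwards [φ.open_target.mem_nhds hxt] with z hz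
    exact if_pos hz
  · rintro _ ⟨x, hx, rfl⟩
    exact (hρs hx).2
  · simp only [hg, if_pos (φ.map_source hx), φ.left_inv hx]

variable [MeasurableSpace M] [BorelSpace M]
  {F : Type*} [NormedAddCommGroup F] [NormedSpace ℂ F] [FiniteDimensional ℂ F]
  {E : M → Type*} [∀ x, AddCommGroup (E x)] [∀ x, Module ℂ (E x)]
  [TopologicalSpace (TotalSpace F E)] [∀ x, TopologicalSpace (E x)]
  [FiberBundle F E] [VectorBundle ℂ F E]
  {V : Type*} [NormedAddCommGroup V] [InnerProductSpace ℂ V]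
  (h : HermitianMetric (n := n) F E) (μ : SmoothDensity n M)
  {ι : Type*} [Fintype ι] {c : ι → BundlePatch n F E V} {φ : ι → Coord n → ℝ}

theorem BundlePatch.ext_smul_indicator_coord (c : BundlePatch n F E V) (φ : Coord n → ℝ)
    (s : ∀ x, E x) (x : M) : c.ext (fun y => smulId V φ y (c.K.indicator (c.coord s) y)) x =
      ((c.carrier.indicator (fun x => φ (c.chart x)) x : ℝ) : ℂ) • s x := by
  by_cases hx : x ∈ c.carrier
  · rw [c.ext_of_mem _ hx, indicator_of_mem hx,
      indicator_of_mem (show c.chart x ∈ c.K from hx.2), smulId_apply, ← Complex.coe_smul, map_smul]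
    conv_rhs => rw [← c.ext_coord s hx, c.ext_of_mem _ hx]
    have hb := c.carrier_subset_baseSet hx
    rw [← c.triv.symmₗ_apply (R := ℂ) hb, ← c.triv.symmₗ_apply (R := ℂ) hb, map_smul]
  · rw [c.ext_of_notMem _ hx, indicator_of_notMem hx, Complex.ofReal_zero, zero_smul]

/-- A section is recovered from its localizations by means of a partition of unity. -/
theorem sum_extend_mulLp_localize (hφ : ∀ j, ContDiff ℝ ∞ (φ j))
    (hφs : ∀ j, HasCompactSupport (φ j))
    (hsum : ∀ x, ∑ j, (c j).carrier.indicator (fun x => φ j ((c j).chart x)) x = 1)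
    (u : L2 h μ.measure) :
    ∑ j, (c j).extend h μ (mulLp (smulId V (φ j)) ((c j).localize h μ u)) = u := by
  obtain ⟨s, rfl⟩ := SeparationQuotient.surjective_mk u
  have key : ∀ j, ∃ t : L2Section h μ.measure,
      (c j).extend h μ (mulLp (smulId V (φ j))
        ((c j).localize h μ (SeparationQuotient.mk s))) = SeparationQuotient.mk t ∧
      ∀ᵐ x ∂μ.measure, t.1 x =
        (((c j).carrier.indicator (fun x => φ j ((c j).chart x)) x : ℝ) : ℂ) • s.1 x := by
    intro j
    obtain ⟨hs, e⟩ := (c j).localize_mk h μ s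
    obtain ⟨t, ht, ht'⟩ := (c j).exists_extend_eq_mk h μ (mulLp (smulId V (φ j))
        ((c j).localize h μ (SeparationQuotient.mk s)))
    refine ⟨t, ht, ?_⟩
    have h1 : mulLp (smulId V (φ j)) ((c j).localize h μ (SeparationQuotient.mk s)) =ᵐ[volume]
        fun y => smulId V (φ j) y ((c j).K.indicator ((c j).coord s.1) y) := by
      rw [e]
      filter_upwards [coeFn_mulLp (memLp_top_of_hasCompactSupport
        (contDiff_smulId (V := V) (hφ j)).continuous (hasCompactSupport_smulId (hφs j)))
          (hs.toLp _), hs.coeFn_toLp] with y e₁ e₂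
      rw [e₁, e₂]
    filter_upwards [(c j).ext_ae_eq μ h1] with x hx
    rw [ht', hx, BundlePatch.ext_smul_indicator_coord]
  choose t ht ht' using key
  simp only [ht]
  have hmk : ∑ j, (SeparationQuotient.mk (t j) : L2 h μ.measure) =
      SeparationQuotient.mk (∑ j, t j) :=
    (map_sum (SeparationQuotient.mkCLM ℂ (L2Section h μ.measure)) t Finset.univ).symm
  rw [hmk]
  refine L2.mk_eq_mk_of_ae h ?_
  filter_upwards [ae_all_iff.2 ht'] with x hx
  have h2 : (∑ j, t j).1 = ∑ j, (t j).1 :=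
    map_sum (squareIntegrable h μ.measure).subtype t Finset.univ
  rw [h2, Finset.sum_apply]
  simp only [hx]
  rw [← Finset.sum_smul, ← Complex.ofReal_sum, hsum x, Complex.ofReal_one, one_smul]

end Localization

theorem isInvertible_adjoint {V W : Type*} [NormedAddCommGroup V] [InnerProductSpace ℂ V]
    [CompleteSpace V] [NormedAddCommGroup W] [InnerProductSpace ℂ W] [CompleteSpace W]
    {A : V →L[ℂ] W} (hA : A.IsInvertible) : (ContinuousLinearMap.adjoint A).IsInvertible := by
  obtain ⟨S, rfl⟩ := hA
  refine ContinuousLinearMap.IsInvertible.of_inverse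
    (g := ContinuousLinearMap.adjoint (S.symm : W →L[ℂ] V)) ?_ ?_
  · rw [← ContinuousLinearMap.adjoint_comp, S.coe_symm_comp_coe,
      ContinuousLinearMap.adjoint_id]
  · rw [← ContinuousLinearMap.adjoint_comp, S.coe_comp_coe_symm,
      ContinuousLinearMap.adjoint_id]

section Global

variable {n p : ℕ} {M : Type*} [TopologicalSpace M] [ChartedSpace (EuclideanSpace ℝ (Fin n)) M]
  [IsManifold (𝓡 n) ∞ M] [T2Space M] [CompactSpace M] [MeasurableSpace M] [BorelSpace M]
  {fol : Foliation n M p}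
  {F : Type*} [NormedAddCommGroup F] [NormedSpace ℂ F] [FiniteDimensional ℂ F]
  {E : M → Type*} [∀ x, AddCommGroup (E x)] [∀ x, Module ℂ (E x)]
  [TopologicalSpace (TotalSpace F E)] [∀ x, TopologicalSpace (E x)]
  [FiberBundle F E] [VectorBundle ℂ F E] [ContMDiffVectorBundle ∞ F E (𝓡 n)]
  {F' : Type*} [NormedAddCommGroup F'] [NormedSpace ℂ F'] [FiniteDimensional ℂ F']
  {E' : M → Type*} [∀ x, AddCommGroup (E' x)] [∀ x, Module ℂ (E' x)]
  [TopologicalSpace (TotalSpace F' E')] [∀ x, TopologicalSpace (E' x)]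
  [FiberBundle F' E'] [VectorBundle ℂ F' E'] [ContMDiffVectorBundle ∞ F' E' (𝓡 n)]
  {V : Type*} [NormedAddCommGroup V] [InnerProductSpace ℂ V] [FiniteDimensional ℂ V]
  {W : Type*} [NormedAddCommGroup W] [InnerProductSpace ℂ W] [FiniteDimensional ℂ W]
  {d : ℕ} {P : smoothSections (n := n) F E →ₗ[ℂ] smoothSections (n := n) F' E'}
  (h : HermitianMetric (n := n) F E) (h' : HermitianMetric (n := n) F' E') (μ : SmoothDensity n M)

/-- What the local theory says about the closure of `P` in a pair of patches with the same
coordinates: there is a right parametrix, the sections in the kernel are controlled by an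
approximable operator, and sections `v` such that `(0, v)` is in the closure of the graph vanish. -/
structure IsGoodPatch (P : smoothSections (n := n) F E →ₗ[ℂ] smoothSections (n := n) F' E')
    (c₁ : BundlePatch n F E V) (c₂ : BundlePatch n F' E' W) : Prop where
  chart_eq : c₂.chart = c₁.chart
  K_eq : c₂.K = c₁.K
  exists_parametrix : ∀ φ : Coord n → ℝ, ContDiff ℝ ∞ φ → tsupport φ ⊆ c₁.K →
    ∃ (Q : CoordL2 n W →L[ℂ] CoordL2 n V) (K : CoordL2 n W →L[ℂ] CoordL2 n W),
      IsApproximable K ∧ ∀ f, (c₁.extend h μ (Q f), c₂.extend h' μ (mulLp (smulId W φ) f + K f)) ∈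
        (unboundedOperator h h' μ P).graph.topologicalClosure
  exists_kernel_bound : ∀ φ : Coord n → ℝ, ContDiff ℝ ∞ φ → tsupport φ ⊆ c₁.K →
    ∃ K : CoordL2 n V →L[ℂ] CoordL2 n V, IsApproximable K ∧
      ∀ u, (u, (0 : L2 h' μ.measure)) ∈ (unboundedOperator h h' μ P).graph.topologicalClosure →
        mulLp (smulId V φ) (c₁.localize h μ u) = K (c₁.localize h μ u)
  localize_eq_zero : ∀ φ : Coord n → ℝ, ContDiff ℝ ∞ φ → tsupport φ ⊆ c₁.K →
    ∀ v, ((0 : L2 h μ.measure), v) ∈ (unboundedOperator h h' μ P).graph.topologicalClosure →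
      mulLp (smulId W φ) (c₂.localize h' μ v) = 0

/-- Every point has a good patch: the ball on which both `P` and its formal adjoint have a right
parametrix. -/
theorem exists_isGoodPatch (hP : IsWeightedDiffOp fol d P)
    (hσ : HasInvertibleWeightedSymbol fol d P) (ι₁ : F ≃L[ℂ] V) (ι₂ : F' ≃L[ℂ] W) (x : M) :
    ∃ (c₁ : BundlePatch n F E V) (c₂ : BundlePatch n F' E' W), IsGoodPatch h h' μ P c₁ c₂ ∧
      x ∈ c₁.chart.source ∧ c₁.K ∈ 𝓝 (c₁.chart x) := by
  obtain ⟨c, R, a, hx, hR, hRc, ha, hσa, hPa⟩ := exists_local_model hP hσ ι₁ ι₂ x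
  set y := c.chart x with hy
  have hl : ∀ t : multiIndices n p d, wordWeight p (multiWord t.1) ≤ d := fun t => by
    rw [wordWeight_multiWord]
    exact mem_multiIndices.1 t.2
  obtain ⟨κ, _, b, m, hb, hm, hadj, hsymb⟩ := exists_formalAdjoint p d ha hl
  obtain ⟨r₁, hr₁, hpar₁⟩ := exists_local_parametrix p d ha hl y hσa
  obtain ⟨r₂, hr₂, hpar₂⟩ := exists_local_parametrix p d hb hm y fun ξ hξ => by
    rw [hsymb]
    exact isInvertible_adjoint (hσa ξ hξ)
  set r := min (min r₁ r₂) (R / 3) with hr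
  have hr0 : 0 < r := lt_min (lt_min hr₁ hr₂) (by positivity)
  have hrR : r ≤ R / 3 := min_le_right _ _
  have hrr₁ : Metric.closedBall y r ⊆ Metric.closedBall y r₁ :=
    Metric.closedBall_subset_closedBall ((min_le_left _ _).trans (min_le_left _ _))
  have hrr₂ : Metric.closedBall y r ⊆ Metric.closedBall y r₂ :=
    Metric.closedBall_subset_closedBall ((min_le_left _ _).trans (min_le_right _ _))
  have hdom : ∀ z ∈ Metric.closedBall y R, z ∈ c.chart.target ∧ c.chart.symm z ∈ c.domain :=
    fun z hz => c.symm_mem_domain (hRc hz)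
  have hsub : Metric.closedBall y r ⊆ Metric.closedBall y R :=
    Metric.closedBall_subset_closedBall (by linarith)
  let c₁ : BundlePatch n F E V := ⟨c.chart, c.isFoliationChart.1, c.triv, c.triv_mem, ι₁,
    Metric.closedBall y r, isCompact_closedBall y r, fun z hz => (hdom z (hsub hz)).1,
    fun z hz => (hdom z (hsub hz)).2.1.2⟩
  let c₂ : BundlePatch n F' E' W := ⟨c.chart, c.isFoliationChart.1, c.triv', c.triv'_mem, ι₂,
    Metric.closedBall y r, isCompact_closedBall y r, fun z hz => (hdom z (hsub hz)).1,
    fun z hz => (hdom z (hsub hz)).2.2⟩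
  have hf : IsLocalForm P c₁ c₂ a fun t => multiWord t.1 := by
    refine ⟨rfl, rfl, ha, fun u z hz => hPa u z (hsub hz), ?_⟩
    obtain ⟨χ, hχ, hχ1, hχs⟩ := exists_smooth_cutoff y (r := R / 2) (R := R) (by positivity)
      (half_lt_self hR)
    refine ⟨χ, hχ, (isCompact_closedBall y R).of_isClosed_subset isClosed_closure hχs,
      fun z hz => ?_, fun z hz => ⟨(hdom z (hχs hz)).1, (hdom z (hχs hz)).2.1.2⟩⟩
    have hz' : z ∈ Metric.ball y (R / 2) := by
      have : dist z y ≤ r := hz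
      rw [Metric.mem_ball]
      linarith
    filter_upwards [Metric.isOpen_ball.mem_nhds hz'] with w hw
    exact hχ1 w (Metric.ball_subset_closedBall hw)
  refine ⟨c₁, c₂, ⟨rfl, rfl, fun φ hφ hφs => ?_, fun φ hφ hφs => ?_, fun φ hφ hφs v hv => ?_⟩,
    hx.1.1, Metric.closedBall_mem_nhds y hr0⟩
  · obtain ⟨Q, K, hK, hQ⟩ := hpar₁ φ hφ (hφs.trans hrr₁)
    refine ⟨Q, K, hK, fun f => hf.extend_mem_closure_graph h h' μ hP fun ε hε => ?_⟩
    obtain ⟨w, hw, hws, h₁, h₂, e₁, e₂⟩ := hQ f ε hε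
    exact ⟨w, hw, hws.trans hφs, h₁, h₂, e₁, e₂⟩
  · obtain ⟨Q, K, hK, hQ⟩ := hpar₂ φ hφ (hφs.trans hrr₂)
    refine ⟨-ContinuousLinearMap.adjoint K, hK.adjoint.neg, fun u hu => ?_⟩
    exact hf.mulLp_localize_eq_neg_adjoint h h' μ hadj hu hφ hφs hQ
  · exact hf.mulLp_localize_eq_zero h h' μ hb hadj hv hφ hφs

/-- A compact manifold is covered by finitely many good patches, with a subordinate smooth partition
of unity. -/
theorem exists_finite_isGoodPatch (hP : IsWeightedDiffOp fol d P)
    (hσ : HasInvertibleWeightedSymbol fol d P) (ι₁ : F ≃L[ℂ] V) (ι₂ : F' ≃L[ℂ] W) :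
    ∃ (t : Finset M) (c₁ : t → BundlePatch n F E V) (c₂ : t → BundlePatch n F' E' W)
      (φ : t → Coord n → ℝ), (∀ j, IsGoodPatch h h' μ P (c₁ j) (c₂ j)) ∧
      (∀ j, ContDiff ℝ ∞ (φ j)) ∧ (∀ j, tsupport (φ j) ⊆ (c₁ j).K) ∧
      ∀ x, ∑ j, (c₁ j).carrier.indicator (fun x => φ j ((c₁ j).chart x)) x = 1 := by
  choose c₁ c₂ hgood hxs hxK using exists_isGoodPatch h h' μ hP hσ ι₁ ι₂
  let U : M → Set M := fun x => (c₁ x).chart.source ∩ (c₁ x).chart ⁻¹' interior (c₁ x).K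
  have hUo : ∀ x, IsOpen (U x) := fun x => (c₁ x).chart.isOpen_inter_preimage isOpen_interior
  have hxU : ∀ x, x ∈ U x := fun x => ⟨hxs x, mem_interior_iff_mem_nhds.2 (hxK x)⟩
  obtain ⟨t, ht⟩ := isCompact_univ.elim_finite_subcover U hUo
    fun x _ => mem_iUnion.2 ⟨x, hxU x⟩
  obtain ⟨ρ, hρ⟩ := SmoothPartitionOfUnity.exists_isSubordinate (𝓡 n) isClosed_univ
    (fun j : t => U j.1) (fun j => hUo j.1) fun x hx => by
      obtain ⟨i, hi, hxi⟩ := mem_iUnion₂.1 (ht hx)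
      exact mem_iUnion.2 ⟨⟨i, hi⟩, hxi⟩
  have hρs : ∀ j : t, tsupport (ρ j) ⊆ (c₁ j.1).carrier := fun j z hz =>
    ⟨(hρ j hz).1, show _ ∈ (c₁ j.1).K from interior_subset (hρ j hz).2⟩
  choose φ hφ hφs hφρ using fun j : t =>
    exists_contDiff_of_tsupport_subset_region (c₁ j.1).chart_mem (ρ j).contMDiff (hρs j)
  refine ⟨t, fun j => c₁ j.1, fun j => c₂ j.1, φ, fun j => hgood j.1, hφ, hφs, fun x => ?_⟩
  have h1 := ρ.sum_eq_one (mem_univ x)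
  rw [finsum_eq_sum_of_fintype] at h1
  rw [← h1]
  refine Finset.sum_congr rfl fun j _ => ?_
  by_cases hx : x ∈ (c₁ j.1).carrier
  · rw [indicator_of_mem hx, hφρ j x hx.1]
  · rw [indicator_of_notMem hx]
    exact (image_eq_zero_of_notMem_tsupport fun h0 => hx (hρs j h0)).symm

/-- The space of square integrable sections is complete, since it is a retract of a finite product
of spaces of square integrable functions on Euclidean space. -/
theorem completeSpace_L2 {ι : Type*} [Fintype ι] {c : ι → BundlePatch n F E V}
    {φ : ι → Coord n → ℝ} (hsum : ∀ u : L2 h μ.measure,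
      ∑ j, (c j).extend h μ (mulLp (smulId V (φ j)) ((c j).localize h μ u)) = u) :
    CompleteSpace (L2 h μ.measure) := by
  refine Metric.complete_of_cauchySeq_tendsto fun u hu => ?_
  have hlim : ∀ j, ∃ g, Filter.Tendsto (fun k => (c j).localize h μ (u k)) Filter.atTop (𝓝 g) :=
    fun j => cauchySeq_tendsto_of_complete
      (((c j).localize h μ).uniformContinuous.comp_cauchySeq hu)
  choose g hg using hlim
  refine ⟨∑ j, (c j).extend h μ (mulLp (smulId V (φ j)) (g j)), ?_⟩
  have h1 := tendsto_finsetSum Finset.univ fun j _ =>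
    (((c j).extend h μ ∘L mulLp (smulId V (φ j))).continuous.tendsto (g j)).comp (hg j)
  refine h1.congr fun k => ?_
  exact hsum (u k)

/-- An operator with invertible weighted symbol is closable and its closure is Fredholm. The fibres
are identified with inner product spaces `V` and `W`. -/
theorem isClosable_and_isFredholm_of_equiv (hP : IsWeightedDiffOp fol d P)
    (hσ : HasInvertibleWeightedSymbol fol d P) (ι₁ : F ≃L[ℂ] V) (ι₂ : F' ≃L[ℂ] W) :
    (unboundedOperator h h' μ P).IsClosable ∧ IsFredholm (unboundedOperator h h' μ P).closure := by
  obtain ⟨t, c₁, c₂, φ, hgood, hφ, hφK, hpart⟩ := exists_finite_isGoodPatch h h' μ hP hσ ι₁ ι₂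
  have hφs : ∀ j, HasCompactSupport (φ j) := fun j =>
    (c₁ j).isCompact.of_isClosed_subset isClosed_closure (hφK j)
  have hpart₂ : ∀ x, ∑ j, (c₂ j).carrier.indicator (fun x => φ j ((c₂ j).chart x)) x = 1 := by
    intro x
    rw [← hpart x]
    refine Finset.sum_congr rfl fun j _ => ?_
    rw [BundlePatch.carrier, BundlePatch.carrier, (hgood j).chart_eq, (hgood j).K_eq]
  have hsum₁ := sum_extend_mulLp_localize h μ hφ hφs hpart
  have hsum₂ := sum_extend_mulLp_localize h' μ hφ hφs hpart₂
  have := completeSpace_L2 h' μ hsum₂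
  choose Q K hK hQ using fun j => (hgood j).exists_parametrix (φ j) (hφ j) (hφK j)
  choose K' hK' hker using fun j => (hgood j).exists_kernel_bound (φ j) (hφ j) (hφK j)
  refine isClosable_and_isFredholm_closure (unboundedOperator h h' μ P) (fun v hv => ?_)
    (K := ∑ j, (c₂ j).extend h' μ ∘L K j ∘L (c₂ j).localize h' μ)
    (.sum _ fun j _ => ((hK j).comp_right _).comp_left _) (fun v => ?_)
    (K' := ∑ j, (c₁ j).extend h μ ∘L K' j ∘L (c₁ j).localize h μ)
    (.sum _ fun j _ => ((hK' j).comp_right _).comp_left _) (fun u hu => ?_)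
  · rw [← hsum₂ v]
    refine Finset.sum_eq_zero fun j _ => ?_
    rw [(hgood j).localize_eq_zero (φ j) (hφ j) (hφK j) v hv, map_zero]
  · refine ⟨∑ j, (c₁ j).extend h μ (Q j ((c₂ j).localize h' μ v)), ?_⟩
    have h1 := Submodule.sum_mem _ fun j (_ : j ∈ Finset.univ) => hQ j ((c₂ j).localize h' μ v)
    convert! h1 using 1
    refine Prod.ext ?_ ?_
    · rw [Prod.fst_sum]
    · rw [Prod.snd_sum]
      simp only [map_add, Finset.sum_add_distrib, hsum₂ v]
      congr 1
      simp
  · conv_lhs => rw [← hsum₁ u]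
    simp only [sum_apply]
    exact Finset.sum_congr rfl fun j _ => by rw [hker j u hu]; rfl

end Global

end WeightedFoliation

end

theorem mainTheorem4 {n p : ℕ} {M : Type*} [TopologicalSpace M]
    [ChartedSpace (EuclideanSpace ℝ (Fin n)) M] [IsManifold (𝓡 n) ∞ M] [T2Space M] [CompactSpace M]
    [MeasurableSpace M] [BorelSpace M]
    (fol : Foliation n M p)
    {F₁ : Type*} [NormedAddCommGroup F₁] [NormedSpace ℂ F₁] [FiniteDimensional ℂ F₁]
    {E : M → Type*} [∀ x, AddCommGroup (E x)] [∀ x, Module ℂ (E x)]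
    [TopologicalSpace (TotalSpace F₁ E)] [∀ x, TopologicalSpace (E x)]
    [FiberBundle F₁ E] [VectorBundle ℂ F₁ E] [ContMDiffVectorBundle ∞ F₁ E (𝓡 n)]
    {F₂ : Type*} [NormedAddCommGroup F₂] [NormedSpace ℂ F₂] [FiniteDimensional ℂ F₂]
    {F : M → Type*} [∀ x, AddCommGroup (F x)] [∀ x, Module ℂ (F x)]
    [TopologicalSpace (TotalSpace F₂ F)] [∀ x, TopologicalSpace (F x)]
    [FiberBundle F₂ F] [VectorBundle ℂ F₂ F] [ContMDiffVectorBundle ∞ F₂ F (𝓡 n)]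
    (hE : HermitianMetric (n := n) F₁ E) (hF : HermitianMetric (n := n) F₂ F)
    (μ : SmoothDensity n M)
    (d : ℕ) (P : smoothSections (n := n) F₁ E →ₗ[ℂ] smoothSections (n := n) F₂ F)
    (hP : IsWeightedDiffOp fol d P) (hσ : HasInvertibleWeightedSymbol fol d P) :
    (unboundedOperator hE hF μ P).IsClosable ∧
      IsFredholm (unboundedOperator hE hF μ P).closure := by
  exact isClosable_and_isFredholm_of_equiv hE hF μ hP hσ
    (ContinuousLinearEquiv.ofFinrankEq (finrank_euclideanSpace_fin (𝕜 := ℂ)).symm)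
    (ContinuousLinearEquiv.ofFinrankEq (finrank_euclideanSpace_fin (𝕜 := ℂ)).symm)
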